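/- Let $d\ge 1$ and let $X$ be an $\mathbb R^d$-valued random vector whose law has a density $p$ with respect to Lebesgue measure (for example the value at time $1$ of a diffusion). Fix a unit cube $G=\prod_{j=1}^d[z_j,z_j+1)$ with $z\in\mathbb Z^d$, and constants $\delta,C>0$. Put $$r_n=\frac{3\delta}{2\pi^2n^3C}\quad(n\ge1),$$ and assume that on the $r_1$-neighbourhood $\bigcup_{x\in G}B_{r_1}(x)$ of $G$ the density satisfies $p\ge\delta$ and $|p(y)-p(y')|\le C\|y-y'\|_2$. Let $V(r)$ be the volume of a ball of radius $r$ in $\mathbb R^d$, let $N$ be a random variable with $\mathbb P(N=n)=1/(n(n+1))$ for $n\ge1$, and for $x\in G$ and $n\ge0$ put $\hat p_0(x)=0$, $\hat p_k(x)=V(r_k)^{-1}I(X\in B_{r_k}(x))$ for $k\ge1$, $$\Lambda_n(x)=\sum_{k=0}^n\frac{\hat p_{k+1}(x)-\hat p_k(x)}{\mathbb P(N\ge k)},\qquad m_n=\frac1{V(r_1)}+\sum_{k=1}^n\Big(\frac k{V(r_{k+1})}+\frac k{V(r_k)}\Big).$$ Then there is a family of random variables $\{\Lambda_n^+(x):n\ge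 0,\ x\in G\}$ such that for all $n$ and $x$: 1. $0\le\Lambda_n^+(x)\le m_n$; 2. $\mathbb E[\Lambda_n^+(x)]=\mathbb E[\Lambda_n(x)]$; 3. there is an algorithm for simulating $\Lambda_n^+(x)$, which terminates with probability one. One can take $\Lambda_n^+(x)=\bar\Gamma\,S_\tau$, where $S_k$ is the sum of the first $k$ of a sequence of i.i.d. copies of $\Lambda_n(x)$, where $\tau=\inf\{k\ge1:S_k\ge0\}$ (which is almost surely finite, with $\mathbb E[\tau]<\infty$), and where $\bar\Gamma$ is a Bernoulli variable with parameter $1/\mathbb E[\tau]$ independent of that sequence. In 3, an algorithm is a randomized program over real registers with assignments, conditionals and while loops. It can do exact arithmetic with rational constants and $\pi$, compare real numbers, and draw independent uniform variables on $[0,1]$. It has access to $X$ only as follows: it can start independent copies of $X$ and ask, for each copy, for successive approximations with errors at most $1/2,1/4,1/8,\dots$ almost surely, where the approximations $Y_0,Y_1,\dots$ of $X$ may be any random vectors with $\|Y_k-X\|_2\le 2^{-(k+1)}$ for all $k$ almost surely, and where the pairs formed by different copies and their approximations are independent and identically distributed. The program depends only on $d$. Its input is $(n,\delta,C,x)$;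 it is the same for all $n$, $x$, $\delta$, $C$, all cubes $G$, and all laws of $X$ and of its approximations, and the law of $X$ is not part of its input. -/

import Mathlib

open MeasureTheory ProbabilityTheory

noncomputable section

namespace ExactSDE

/-- `ℝ^d` with the Euclidean norm. -/
abbrev E (d : ℕ) : Type := EuclideanSpace ℝ (Fin d)

/-! ### The multilevel estimator -/

/-- The unit hypercube `[z₁, z₁+1) × ⋯ × [z_d, z_d+1)`. -/
def unitCube {d : ℕ} (z : Fin d → ℤ) : Set (E d) :=
  {x | ∀ j, x j ∈ Set.Ico (z j : ℝ) (z j + 1)}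

/-- The radii `r_n = 3 δ / (2 π² n³ C)` (used for `n ≥ 1`). -/
def radius (δ C : ℝ) (n : ℕ) : ℝ := 3 * δ / (2 * Real.pi ^ 2 * (n : ℝ) ^ 3 * C)

/-- `V(r)`: the Lebesgue volume of a Euclidean ball of radius `r` in `ℝ^d`. -/
def ballVolume (d : ℕ) (r : ℝ) : ℝ := volume.real (Metric.ball (0 : E d) r)

/-- `P(N = n) = 1 / (n (n + 1))` for `n ≥ 1`, and `P(N = 0) = 0`. -/
def levelMass (n : ℕ) : ℝ := if n = 0 then 0 else 1 / ((n : ℝ) * ((n : ℝ) + 1))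

/-- `P(N ≥ k)`. -/
def levelTail (k : ℕ) : ℝ := ∑' j : ℕ, levelMass (k + j)

/-- `p̂_n(x) = V(r_n)⁻¹ 1{y ∈ B_{r_n}(x)}` for `n ≥ 1`, and `p̂_0(x) = 0`, as a function of the value
`y` of the random vector. -/
def pHat {d : ℕ} (δ C : ℝ) (n : ℕ) (x y : E d) : ℝ :=
  if n = 0 then 0
  else (ballVolume d (radius δ C n))⁻¹ *
    (Metric.ball x (radius δ C n)).indicator (fun _ => (1 : ℝ)) y

/-- `Λ_n(x) = ∑_{k=0}^n (p̂_{k+1}(x) - p̂_k(x)) / P(N ≥ k)`, as a function of the value `y` of the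
random vector. -/
def levelSum {d : ℕ} (δ C : ℝ) (n : ℕ) (x y : E d) : ℝ :=
  ∑ k ∈ Finset.range (n + 1), (pHat δ C (k + 1) x y - pHat δ C k x y) / levelTail k

/-- `m_n = V(r_1)⁻¹ + ∑_{k=1}^n (k V(r_{k+1})⁻¹ + k V(r_k)⁻¹)`. -/
def levelBound (d : ℕ) (δ C : ℝ) (n : ℕ) : ℝ :=
  (ballVolume d (radius δ C 1))⁻¹ +
    ∑ k ∈ Finset.Icc 1 n,
      ((k : ℝ) * (ballVolume d (radius δ C (k + 1)))⁻¹ +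
        (k : ℝ) * (ballVolume d (radius δ C k))⁻¹)

/-! ### Stopped partial sums -/

/-- `S_k = l_0 + ⋯ + l_{k-1}`, the sum of the first `k` terms. -/
def partialSum (l : ℕ → ℝ) (k : ℕ) : ℝ := ∑ j ∈ Finset.range k, l j

/-- `τ = inf {k ≥ 1 : S_k ≥ 0}` (with value `0` if there is no such `k`). -/
def stopIndex (l : ℕ → ℝ) : ℕ := sInf {k : ℕ | 1 ≤ k ∧ 0 ≤ partialSum l k}

/-- `Z` is, almost surely, the product of `S_τ`, formed from i.i.d. random variables of law `ν`, and
of a Bernoulli variable with parameter `1 / E[τ]` independent of them; moreover `τ` is almost surely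
finite with finite mean. -/
def IsThinnedStoppedSum {Ω : Type*} [MeasurableSpace Ω] (P : Measure Ω) (ν : Measure ℝ)
    (Z : Ω → ℝ) : Prop :=
  ∃ (L : ℕ → Ω → ℝ) (Γ : Ω → ℝ),
    (∀ k, Measurable (L k)) ∧ (∀ k, P.map (L k) = ν) ∧ iIndepFun L P ∧
    (∀ᵐ ω ∂P, ∃ k, 1 ≤ k ∧ 0 ≤ partialSum (fun j => L j ω) k) ∧
    Integrable (fun ω => (stopIndex (fun j => L j ω) : ℝ)) P ∧
    Measurable Γ ∧ (∀ ω, Γ ω = 0 ∨ Γ ω = 1) ∧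
    P.real {ω | Γ ω = 1} = (∫ ω, (stopIndex (fun j => L j ω) : ℝ) ∂P)⁻¹ ∧
    IndepFun Γ (fun ω j => L j ω) P ∧
    ∀ᵐ ω ∂P, Z ω = Γ ω * partialSum (fun j => L j ω) (stopIndex (fun j => L j ω))

/-! ### Randomized programs over the reals

Programs act on countably many real registers.  They can do exact arithmetic with rational constants
and `π`, compare reals, loop, draw fresh uniform variables on `[0, 1]`, and access independent copies
of a random vector, each one through successive approximations only. -/

/-- Arithmetic expressions. -/
inductive Expr : Type
  | reg (i : ℕ)
  | const (q : ℚ)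
  | pi
  | add (a b : Expr)
  | sub (a b : Expr)
  | mul (a b : Expr)
  | div (a b : Expr)

/-- Value of an expression. -/
def Expr.eval : Expr → (ℕ → ℝ) → ℝ
  | .reg i, r => r i
  | .const q, _ => (q : ℝ)
  | .pi, _ => Real.pi
  | .add a b, r => a.eval r + b.eval r
  | .sub a b, r => a.eval r - b.eval r
  | .mul a b, r => a.eval r * b.eval r
  | .div a b, r => a.eval r / b.eval r

theorem Expr.measurable_eval (e : Expr) : Measurable e.eval := by
  induction e with
  | reg i => exact measurable_pi_apply i
  | const q => exact measurable_const
  | pi => exact measurable_const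
  | add a b ha hb => exact ha.add hb
  | sub a b ha hb => exact ha.sub hb
  | mul a b ha hb => exact ha.mul hb
  | div a b ha hb => exact ha.div hb

/-- Commands. -/
inductive Cmd (d : ℕ) : Type
  /-- do nothing -/
  | skip
  /-- store the value of `e` in register `i` -/
  | assign (i : ℕ) (e : Expr)
  /-- store a fresh uniform random number from `[0, 1]` in register `i` -/
  | uniform (i : ℕ)
  /-- start a fresh independent copy of the random vector, at its first approximation -/
  | draw
  /-- pass to the next approximation of the current copy -/
  | sharpen
  /-- store coordinate `j` of the current approximation in register `i` -/
  | load (i : ℕ) (j : Fin d)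
  /-- sequential composition -/
  | seq (a b : Cmd d)
  /-- if `e₁ < e₂` then `a` else `b` -/
  | ite (e₁ e₂ : Expr) (a b : Cmd d)
  /-- while `e₁ < e₂` do `a` -/
  | loop (e₁ e₂ : Expr) (a : Cmd d)

/-- The contents of the registers, and the sequence of the approximations of the current copy of the
random vector, starting with the current one. -/
abbrev State (d : ℕ) : Type := (ℕ → ℝ) × (ℕ → E d)

/-- The states in which the test `e₁ < e₂` succeeds. -/
def testSet (d : ℕ) (e₁ e₂ : Expr) : Set (State d) := {s | e₁.eval s.1 < e₂.eval s.1}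

theorem measurableSet_testSet (d : ℕ) (e₁ e₂ : Expr) : MeasurableSet (testSet d e₁ e₂) :=
  measurableSet_lt (e₁.measurable_eval.comp measurable_fst) (e₂.measurable_eval.comp measurable_fst)

theorem measurable_store {α : Type*} [MeasurableSpace α] {r : α → ℕ → ℝ} {v : α → ℝ} (i : ℕ)
    (hr : Measurable r) (hv : Measurable v) :
    Measurable fun a => Function.update (r a) i (v a) := by
  refine measurable_pi_lambda _ fun k => ?_
  by_cases h : k = i
  · subst h; simpa using hv
  · simp only [Function.update_of_ne h]
    exact (measurable_pi_apply k).comp hr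

/-- The uniform distribution on `[0, 1]`. -/
def uniformLaw : Measure ℝ := volume.restrict (Set.Icc 0 1)

instance : IsProbabilityMeasure uniformLaw := ⟨by simp [uniformLaw]⟩

open Classical in
/-- The kernel equal to `κ` on the measurable set `s` and to `η` off `s`. -/
def branch {α β : Type*} [MeasurableSpace α] [MeasurableSpace β] {s : Set α} (hs : MeasurableSet s)
    (κ η : Kernel α β) : Kernel α β := Kernel.piecewise hs κ η

/-- `n`-fold composition of a kernel with itself. -/
def iter {α : Type*} [MeasurableSpace α] (κ : Kernel α α) : ℕ → Kernel α α
  | 0 => Kernel.id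
  | n + 1 => κ ∘ₖ iter κ n

/-- Semantics of commands, when the sequence of approximations of a copy of the random vector has
law `Q`: from the state `s`, the (sub-probability) law `c.denote Q s` of the state in which `c`
terminates; its missing mass is the probability of running forever.  The clause for `loop` sums,
over `n`, the laws of leaving the loop after exactly `n` rounds. -/
def Cmd.denote {d : ℕ} (Q : Measure (ℕ → E d)) [SFinite Q] : Cmd d → Kernel (State d) (State d)
  | .skip => Kernel.id
  | .assign i e =>
      Kernel.deterministic (fun s => (Function.update s.1 i (e.eval s.1), s.2))
        ((measurable_store i measurable_fst (e.measurable_eval.comp measurable_fst)).prodMk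
          measurable_snd)
  | .uniform i =>
      (Kernel.id ×ₖ Kernel.const (State d) uniformLaw).map
        (fun su => (Function.update su.1.1 i su.2, su.1.2))
  | .draw => (Kernel.id ×ₖ Kernel.const (State d) Q).map (fun sy => (sy.1.1, sy.2))
  | .sharpen =>
      Kernel.deterministic (fun s => (s.1, fun k => s.2 (k + 1)))
        (measurable_fst.prodMk
          (measurable_pi_lambda _ fun k => (measurable_pi_apply (k + 1)).comp measurable_snd))
  | .load i j =>
      Kernel.deterministic (fun s => (Function.update s.1 i (s.2 0 j), s.2))
        ((measurable_store i measurable_fst (by fun_prop)).prodMk measurable_snd)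
  | .seq a b => b.denote Q ∘ₖ a.denote Q
  | .ite e₁ e₂ a b => branch (measurableSet_testSet d e₁ e₂) (a.denote Q) (b.denote Q)
  | .loop e₁ e₂ a =>
      Kernel.sum fun n =>
        branch (measurableSet_testSet d e₁ e₂) 0 Kernel.id ∘ₖ
          iter (branch (measurableSet_testSet d e₁ e₂) (a.denote Q) 0) n

/-- The functions mapped along in the clauses `uniform` and `draw` of `Cmd.denote` are measurable, so
that `Kernel.map` has its proper meaning there. -/
theorem measurable_uniform_update (d i : ℕ) :
    Measurable fun su : State d × ℝ => ((Function.update su.1.1 i su.2, su.1.2) : State d) :=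
  (measurable_store i (measurable_fst.comp measurable_fst) measurable_snd).prodMk
    (measurable_snd.comp measurable_fst)

theorem measurable_draw_update (d : ℕ) :
    Measurable fun sy : State d × (ℕ → E d) => ((sy.1.1, sy.2) : State d) :=
  (measurable_fst.comp measurable_fst).prodMk measurable_snd

/-- Initial state on input `(n, δ, C, x)`: the registers `0, 1, 2` hold `n, δ, C`, the registers
`3, …, d + 2` hold the coordinates of `x`, and everything else is zero. -/
def inputState {d : ℕ} (n : ℕ) (δ C : ℝ) (x : E d) : State d :=
  (fun i =>
    if i = 0 then (n : ℝ) else if i = 1 then δ else if i = 2 then C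
    else if h : i - 3 < d then x ⟨i - 3, h⟩ else 0,
   fun _ => 0)

/-- Started in `s`, the program `c` terminates with probability one, and its output (the final
content of register `0`) has law `ν`. -/
def Cmd.Simulates {d : ℕ} (c : Cmd d) (Q : Measure (ℕ → E d)) [SFinite Q] (s : State d)
    (ν : Measure ℝ) : Prop :=
  c.denote Q s Set.univ = 1 ∧ (c.denote Q s).map (fun t => t.1 0) = ν

end ExactSDE

end

/-! The analytic input is that `E Λ ≥ δ/2 > 0`. The mean of `p̂_k(x)` is the average of `p` over a
ball of radius `r_k`, so it is at least `δ` for `k = 1` and within `C r_k` of `p(x)` for every `k ≥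
1`. As `1 / P(N ≥ k) = k`, the `k`-th increment lowers the mean by at most `2 k C r_k = 3δ / (π²
k²)`, and these losses sum to at most `δ/2` (`half_le_integral_levelSum`). Also `|Λ| ≤ m` pointwise
(`abs_levelSum_le`).

For i.i.d. variables with these two properties, `E min(τ, k) · E Λ = E S_{min(τ, k)} ≤ m`. Hence `E
τ < ∞`, and Wald's identity `E S_τ = E τ · E Λ` follows (`summable_notStopped`,
`integral_stoppedSum`). Since `S_{τ-1} ≤ 0`, one has `0 ≤ S_τ ≤ m`. Multiplying by an independent
Bernoulli variable of parameter `1 / E τ` restores the mean `E Λ`.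

The difficulty is to simulate that variable when `E τ` is unknown. By Wald its parameter is `E Λ / E
S_τ`. Put `y = E Λ / m` and `w = (E S_τ - E Λ) / (2m)`, so that `E S_τ / m = y + 2w`. Toss a
`y`-coin with probability `1/3` and a `w`-coin with probability `2/3`; output one at a success of
the first kind, zero at a success of the second kind, and repeat otherwise. One is output with
probability `y / (y + 2w)`, as required (`wp_gammaCmd`). The `w`-coin is direct, because `S_τ` minus
its first summand lies in `[0, 2m]`.

For the `y`-coin, the sign of `Λ` allows only tosses of parameter `(1 + y)/2` directly. A walk with
these up-probabilities, started at one, hits zero with probability `r = (1 - y)/(1 + y)`, and `(1 +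
y)/2 · (1 - r) = y`. But the walk may escape to infinity. Accepting up-steps only with probability
`β` changes the hitting probability from `i` to `(r/β)^i`. Replacing `β` by `β(1 - η)` while
surviving with probability `(1 - η)^i` therefore leaves the answer unchanged. Doing this at heights
about `3/η`, with `η` halved each time, forces termination; the known bound `y ≥ ε = δ/(2m)` keeps
the drift upward (`tiltValue_walkValue`, `tiltValue_walkRank_le`, `wp_walkLoopCmd`).

All loops of random length are evaluated by one principle, `wp_loop_eq`: a ranking function whose
mean drops by a fixed amount gives termination, and a bounded harmonic function agreeing with the
postcondition at the exit gives the value. Exact evaluation of `Λ` from approximations is a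
deterministic run along a fixed sequence. It terminates because `X`, having a density, almost surely
lies on none of the spheres of radius `r_k` (`runsTo_levelSumCmd`, `ae_norm_sub_ne`).

Registers up to `d + 2` hold the input and `d + 3` holds `m`. Registers are allotted so that a
subroutine overwrites none of those still needed by its callers; `Agree` and `Low` express this. -/

open MeasureTheory ProbabilityTheory

noncomputable section

namespace ExactSDE

open scoped ENNReal

/-! ### Expectation semantics of commands, and exact evaluation of loops. -/

section WeakestPrecondition

variable {d : ℕ} (Q : Measure (ℕ → E d)) [IsProbabilityMeasure Q]

/-- The expected value of `f` at the final state of `c`, started in `s` (zero if `c` diverges). -/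
def wp (c : Cmd d) (f : State d → ℝ≥0∞) (s : State d) : ℝ≥0∞ := ∫⁻ t, f t ∂(c.denote Q s)

theorem measurable_wp (c : Cmd d) {f : State d → ℝ≥0∞} (hf : Measurable f) :
    Measurable (wp Q c f) := hf.lintegral_kernel

theorem wp_mono_ae (c : Cmd d) {f g : State d → ℝ≥0∞} {s : State d}
    (h : ∀ᵐ t ∂(c.denote Q s), f t ≤ g t) : wp Q c f s ≤ wp Q c g s := lintegral_mono_ae h

@[simp] theorem wp_skip {f : State d → ℝ≥0∞} (hf : Measurable f) (s : State d) :
    wp Q .skip f s = f s := by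
  simp only [wp, Cmd.denote, Kernel.id_apply]
  exact lintegral_dirac' s hf

@[simp] theorem wp_assign {f : State d → ℝ≥0∞} (hf : Measurable f) (i : ℕ) (e : Expr)
    (s : State d) : wp Q (.assign i e) f s = f (Function.update s.1 i (e.eval s.1), s.2) := by
  simp only [wp, Cmd.denote]
  rw [Kernel.lintegral_deterministic' _ hf]

@[simp] theorem wp_sharpen {f : State d → ℝ≥0∞} (hf : Measurable f) (s : State d) :
    wp Q .sharpen f s = f (s.1, fun k => s.2 (k + 1)) := by
  simp only [wp, Cmd.denote]
  rw [Kernel.lintegral_deterministic' _ hf]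

@[simp] theorem wp_load {f : State d → ℝ≥0∞} (hf : Measurable f) (i : ℕ) (j : Fin d)
    (s : State d) : wp Q (.load i j) f s = f (Function.update s.1 i (s.2 0 j), s.2) := by
  simp only [wp, Cmd.denote]
  rw [Kernel.lintegral_deterministic' _ hf]

theorem wp_uniform {f : State d → ℝ≥0∞} (hf : Measurable f) (i : ℕ) (s : State d) :
    wp Q (.uniform i) f s = ∫⁻ u, f (Function.update s.1 i u, s.2) ∂uniformLaw := by
  simp only [wp, Cmd.denote]
  rw [Kernel.lintegral_map _ (measurable_uniform_update d i) _ hf,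
    Kernel.lintegral_id_prod (f := fun su : State d × ℝ =>
      f (Function.update su.1.1 i su.2, su.1.2)) (hf.comp (measurable_uniform_update d i))]
  simp

theorem wp_draw {f : State d → ℝ≥0∞} (hf : Measurable f) (s : State d) :
    wp Q .draw f s = ∫⁻ y, f (s.1, y) ∂Q := by
  simp only [wp, Cmd.denote]
  rw [Kernel.lintegral_map _ (measurable_draw_update d) _ hf,
    Kernel.lintegral_id_prod (f := fun sy : State d × (ℕ → E d) => f (sy.1.1, sy.2))
      (hf.comp (measurable_draw_update d))]
  simp

@[simp] theorem wp_seq {f : State d → ℝ≥0∞} (hf : Measurable f) (a b : Cmd d) (s : State d) :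
    wp Q (.seq a b) f s = wp Q a (wp Q b f) s := by
  simp only [wp, Cmd.denote]
  rw [Kernel.lintegral_comp _ _ _ hf]

open Classical in
theorem wp_ite (f : State d → ℝ≥0∞) (e₁ e₂ : Expr) (a b : Cmd d) (s : State d) :
    wp Q (.ite e₁ e₂ a b) f s =
      if e₁.eval s.1 < e₂.eval s.1 then wp Q a f s else wp Q b f s := by
  simp only [wp, Cmd.denote, branch]
  rw [Kernel.lintegral_piecewise]
  rfl

/-- The definition of `iter` adds the new round at the end; unfolding a loop from its start needs it
at the beginning. -/
theorem iter_succ_comp {α : Type*} [MeasurableSpace α] (κ : Kernel α α) (n : ℕ) :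
    iter κ (n + 1) = iter κ n ∘ₖ κ := by
  induction n with
  | zero => simp [iter]
  | succ n ih => 
    rw [show iter κ (n + 1 + 1) = κ ∘ₖ iter κ (n + 1) from rfl, ih, ← Kernel.comp_assoc, ← ih]
    rfl

/-- The contribution to `wp` of leaving the loop after exactly `n` rounds. -/
def loopTerm (e₁ e₂ : Expr) (a : Cmd d) (f : State d → ℝ≥0∞) (n : ℕ) (s : State d) : ℝ≥0∞ :=
  ∫⁻ t, f t ∂((branch (measurableSet_testSet d e₁ e₂) 0 Kernel.id ∘ₖ
    iter (branch (measurableSet_testSet d e₁ e₂) (a.denote Q) 0) n) s)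

theorem measurable_loopTerm (e₁ e₂ : Expr) (a : Cmd d) {f : State d → ℝ≥0∞} (hf : Measurable f)
    (n : ℕ) : Measurable (loopTerm Q e₁ e₂ a f n) := hf.lintegral_kernel

open Classical in
theorem loopTerm_zero (e₁ e₂ : Expr) (a : Cmd d) {f : State d → ℝ≥0∞} (hf : Measurable f)
    (s : State d) :
    loopTerm Q e₁ e₂ a f 0 s = if e₁.eval s.1 < e₂.eval s.1 then 0 else f s := by
  simp only [loopTerm, iter, Kernel.comp_id, branch]
  rw [Kernel.lintegral_piecewise]
  simp only [zero_apply, lintegral_zero_measure, Kernel.id_apply, lintegral_dirac' s hf]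
  rfl

open Classical in
theorem loopTerm_succ (e₁ e₂ : Expr) (a : Cmd d) {f : State d → ℝ≥0∞} (hf : Measurable f)
    (n : ℕ) (s : State d) :
    loopTerm Q e₁ e₂ a f (n + 1) s =
      if e₁.eval s.1 < e₂.eval s.1 then wp Q a (loopTerm Q e₁ e₂ a f n) s else 0 := by
  simp only [loopTerm]
  rw [iter_succ_comp, ← Kernel.comp_assoc, Kernel.lintegral_comp _ _ _ hf]
  conv_lhs => enter [1]; rw [branch]
  rw [Kernel.lintegral_piecewise]
  simp only [zero_apply, lintegral_zero_measure]
  rfl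

theorem wp_loop_eq_tsum (e₁ e₂ : Expr) (a : Cmd d) (f : State d → ℝ≥0∞) (s : State d) :
    wp Q (.loop e₁ e₂ a) f s = ∑' n, loopTerm Q e₁ e₂ a f n s := by
  simp only [wp, Cmd.denote, loopTerm]
  rw [Kernel.sum_apply, lintegral_sum_measure]

open Classical in
theorem wp_loop (e₁ e₂ : Expr) (a : Cmd d) {f : State d → ℝ≥0∞} (hf : Measurable f)
    (s : State d) :
    wp Q (.loop e₁ e₂ a) f s =
      if e₁.eval s.1 < e₂.eval s.1 then wp Q a (wp Q (.loop e₁ e₂ a) f) s else f s := by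
  have key : ∀ t, wp Q (.loop e₁ e₂ a) f t = ∑' n, loopTerm Q e₁ e₂ a f n t :=
    wp_loop_eq_tsum Q e₁ e₂ a f
  rw [key, tsum_eq_zero_add' ENNReal.summable, loopTerm_zero Q e₁ e₂ a hf]
  simp only [loopTerm_succ Q e₁ e₂ a hf]
  split_ifs with h
  · rw [zero_add]
    conv_rhs => rw [wp]
    simp only [key]
    rw [lintegral_tsum fun n => (measurable_loopTerm Q e₁ e₂ a hf n).aemeasurable]
    rfl
  · simp

variable {e₁ e₂ : Expr} {a : Cmd d}

/-- The probability of not having left the loop before round `n`. -/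
def loopRemain (Q : Measure (ℕ → E d)) [IsProbabilityMeasure Q] (e₁ e₂ : Expr) (a : Cmd d) :
    ℕ → State d → ℝ≥0∞
  | 0 => fun _ => 1
  | n + 1 => (testSet d e₁ e₂).indicator (wp Q a (loopRemain Q e₁ e₂ a n))

theorem measurable_loopRemain (n : ℕ) : Measurable (loopRemain Q e₁ e₂ a n) := by
  induction n with
  | zero => exact measurable_const
  | succ n ih => exact (measurable_wp Q a ih).indicator (measurableSet_testSet d e₁ e₂)

/-- Exact evaluation of a loop, from a ranking function `V` and a bounded harmonic function `h`. -/
theorem wp_loop_eq {f h V : State d → ℝ≥0∞} (hf : Measurable f) (hV : Measurable V) {c M : ℝ≥0∞}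
    (hc : c ≠ 0) (hc' : c ≠ ∞) (hM : M ≠ ∞)
    (term : ∀ s, V s ≠ ∞ → e₁.eval s.1 < e₂.eval s.1 →
      wp Q a (fun _ => 1) s = 1 ∧ wp Q a V s + c ≤ V s)
    (hbd : ∀ s, V s ≠ ∞ → h s ≤ M)
    (hstep : ∀ s, V s ≠ ∞ → e₁.eval s.1 < e₂.eval s.1 → wp Q a h s = h s)
    (hexit : ∀ s, V s ≠ ∞ → ¬ e₁.eval s.1 < e₂.eval s.1 → f s = h s)
    (s : State d) (hs : V s ≠ ∞) : wp Q (.loop e₁ e₂ a) f s = h s := by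
  classical
  -- Finiteness of `V` serves as the loop invariant: a finite mean of `V` after a round makes `V`
  -- almost surely finite there.
  have hae : ∀ s, V s ≠ ∞ → e₁.eval s.1 < e₂.eval s.1 → ∀ᵐ t ∂(a.denote Q s), V t ≠ ∞ := by
    intro s hs ht
    have h1 := (term s hs ht).2
    have h2 : wp Q a V s ≠ ∞ := by
      intro h
      rw [h, top_add, top_le_iff] at h1
      exact hs h1
    filter_upwards [ae_lt_top hV h2] with t ht using ht.ne
  set R := loopRemain Q e₁ e₂ a with hR
  set T : ℕ → State d → ℝ≥0∞ := fun N s => ∑ n ∈ Finset.range N, loopTerm Q e₁ e₂ a f n s with hT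
  have hTm : ∀ N, Measurable (T N) := fun N =>
    Finset.measurable_fun_sum _ fun n _ => measurable_loopTerm Q e₁ e₂ a hf n
  have hRm : ∀ N, Measurable (R N) := fun N => measurable_loopRemain Q N
  have hTs : ∀ N s, T (N + 1) s = if e₁.eval s.1 < e₂.eval s.1 then wp Q a (T N) s else f s := by
    intro N s
    simp only [hT, Finset.sum_range_succ', loopTerm_zero Q e₁ e₂ a hf,
      loopTerm_succ Q e₁ e₂ a hf]
    split_ifs with h
    · simp only [wp, add_zero]
      rw [lintegral_finsetSum _ fun n _ => measurable_loopTerm Q e₁ e₂ a hf n]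
    · simp
  have hRs : ∀ N s, R (N + 1) s = if e₁.eval s.1 < e₂.eval s.1 then wp Q a (R N) s else 0 := by
    intro N s
    simp only [hR, loopRemain, Set.indicator, testSet, Set.mem_ofPred_eq]
    congr
  have hR1 : ∀ N s, V s ≠ ∞ → R N s ≤ 1 := by
    intro N
    induction N with
    | zero => intro s _; exact le_rfl
    | succ N ih =>
      intro s hs
      rw [hRs]
      split_ifs with ht
      · calc wp Q a (R N) s ≤ wp Q a (fun _ => 1) s := by
              refine wp_mono_ae Q a ?_
              filter_upwards [hae s hs ht] with t h using ih t h
          _ = 1 := (term s hs ht).1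
      · simp
  -- Each round that is entered consumes at least `c` of the mean rank, so the probability of
  -- reaching round `N` is at most `V s / (N c)`.
  have hRV : ∀ (N : ℕ) s, V s ≠ ∞ → N * c * R N s ≤ V s := by
    intro N
    induction N with
    | zero => intro s _; simp
    | succ N ih =>
      intro s hs
      rw [hRs]
      split_ifs with ht
      · calc ((N + 1 : ℕ) : ℝ≥0∞) * c * wp Q a (R N) s
            = N * c * wp Q a (R N) s + c * wp Q a (R N) s := by push_cast; ring
          _ ≤ wp Q a V s + c * 1 := by
              gcongr
              · rw [wp, ← lintegral_const_mul _ (hRm N)]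
                refine lintegral_mono_ae ?_
                filter_upwards [hae s hs ht] with t h using ih t h
              · rw [← (term s hs ht).1]
                refine wp_mono_ae Q a ?_
                filter_upwards [hae s hs ht] with t h using hR1 N t h
          _ ≤ V s := by rw [mul_one]; exact (term s hs ht).2
      · simp
  have hle : ∀ N s, V s ≠ ∞ → T N s ≤ h s := by
    intro N
    induction N with
    | zero => intro s _; simp [hT]
    | succ N ih =>
      intro s hs
      rw [hTs]
      split_ifs with ht
      · rw [← hstep s hs ht]
        refine wp_mono_ae Q a ?_
        filter_upwards [hae s hs ht] with t h using ih t h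
      · exact (hexit s hs ht).le
  -- Together with `hle` this squeezes `h` between `T N` and `T N + M * R N`; the error tends to
  -- zero by `hRV`.
  have hge : ∀ N s, V s ≠ ∞ → h s ≤ T N s + M * R N s := by
    intro N
    induction N with
    | zero => intro s hs; simpa [hT, hR, loopRemain] using hbd s hs
    | succ N ih =>
      intro s hs
      rw [hTs, hRs]
      split_ifs with ht
      · rw [← hstep s hs ht]
        calc wp Q a h s ≤ wp Q a (fun t => T N t + M * R N t) s := by
              refine wp_mono_ae Q a ?_
              filter_upwards [hae s hs ht] with t h using ih t h
          _ = wp Q a (T N) s + M * wp Q a (R N) s := by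
              simp only [wp]
              rw [lintegral_add_left (hTm N), lintegral_const_mul _ (hRm N)]
      · simp [hexit s hs ht]
  have hlim : Filter.Tendsto (fun N => T N s) Filter.atTop (nhds (wp Q (.loop e₁ e₂ a) f s)) := by
    rw [wp_loop_eq_tsum]
    exact ENNReal.tendsto_nat_tsum _
  refine le_antisymm (le_of_tendsto' hlim fun N => hle N s hs) ?_
  have hR0 : Filter.Tendsto (fun N => R N s) Filter.atTop (nhds 0) := by
    have h1 : Filter.Tendsto (fun N : ℕ => V s / c * (N : ℝ≥0∞)⁻¹) Filter.atTop (nhds 0) := by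
      have := ENNReal.Tendsto.const_mul (a := V s / c) ENNReal.tendsto_inv_nat_nhds_zero
        (Or.inr (ENNReal.div_ne_top hs hc))
      rwa [mul_zero] at this
    refine tendsto_of_tendsto_of_tendsto_of_le_of_le' tendsto_const_nhds h1
      (Filter.Eventually.of_forall fun _ => zero_le) ?_
    filter_upwards [Filter.eventually_ge_atTop 1] with N hN
    have hN0 : (N : ℝ≥0∞) ≠ 0 := by exact_mod_cast Nat.one_le_iff_ne_zero.mp hN
    rw [← div_eq_mul_inv, ENNReal.le_div_iff_mul_le (Or.inl hN0) (Or.inl (ENNReal.natCast_ne_top N)),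
      ENNReal.le_div_iff_mul_le (Or.inl hc) (Or.inl hc')]
    calc R N s * N * c = N * c * R N s := by ring
      _ ≤ V s := hRV N s hs
  have := (hlim.add (ENNReal.Tendsto.const_mul (a := M) hR0 (Or.inr hM)))
  rw [mul_zero, add_zero] at this
  exact ge_of_tendsto' this fun N => hge N s hs

end WeakestPrecondition

/-! ### Deterministic runs -/

section Deterministic

variable {d : ℕ}

/-- Started in `s`, the command `c` deterministically terminates in a state satisfying `Post`. -/
def RunsTo (c : Cmd d) (s : State d) (Post : State d → Prop) : Prop :=
  ∃ t, Post t ∧ ∀ (Q : Measure (ℕ → E d)) [IsProbabilityMeasure Q] (f : State d → ℝ≥0∞),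
    Measurable f → wp Q c f s = f t

theorem RunsTo.mono {c : Cmd d} {s : State d} {P R : State d → Prop} (h : RunsTo c s P)
    (hPR : ∀ t, P t → R t) : RunsTo c s R := by
  obtain ⟨t, ht, h⟩ := h
  exact ⟨t, hPR t ht, h⟩

theorem runsTo_skip {s : State d} {P : State d → Prop} (h : P s) : RunsTo .skip s P :=
  ⟨s, h, fun Q _ _ hf => wp_skip Q hf s⟩

theorem runsTo_assign {s : State d} {P : State d → Prop} {i : ℕ} {e : Expr}
    (h : P (Function.update s.1 i (e.eval s.1), s.2)) : RunsTo (.assign i e) s P :=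
  ⟨_, h, fun Q _ _ hf => wp_assign Q hf i e s⟩

theorem runsTo_load {s : State d} {P : State d → Prop} {i : ℕ} {j : Fin d}
    (h : P (Function.update s.1 i (s.2 0 j), s.2)) : RunsTo (.load i j) s P :=
  ⟨_, h, fun Q _ _ hf => wp_load Q hf i j s⟩

theorem runsTo_sharpen {s : State d} {P : State d → Prop}
    (h : P (s.1, fun k => s.2 (k + 1))) : RunsTo .sharpen s P :=
  ⟨_, h, fun Q _ _ hf => wp_sharpen Q hf s⟩

theorem RunsTo.seq {a b : Cmd d} {s : State d} {P R : State d → Prop} (ha : RunsTo a s P)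
    (hb : ∀ t, P t → RunsTo b t R) : RunsTo (.seq a b) s R := by
  obtain ⟨t, ht, ha⟩ := ha
  obtain ⟨u, hu, hb⟩ := hb t ht
  refine ⟨u, hu, fun Q _ f hf => ?_⟩
  rw [wp_seq Q hf, ha Q _ (measurable_wp Q b hf), hb Q f hf]

theorem runsTo_assign_seq {s : State d} {P : State d → Prop} {i : ℕ} {e : Expr} {c : Cmd d}
    (h : RunsTo c (Function.update s.1 i (e.eval s.1), s.2) P) :
    RunsTo (.seq (.assign i e) c) s P :=
  (runsTo_assign (P := fun t => t = (Function.update s.1 i (e.eval s.1), s.2)) rfl).seq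
    fun t ht => by subst ht; exact h

theorem runsTo_ite {e₁ e₂ : Expr} {a b : Cmd d} {s : State d} {P : State d → Prop}
    (h₁ : e₁.eval s.1 < e₂.eval s.1 → RunsTo a s P)
    (h₂ : ¬ e₁.eval s.1 < e₂.eval s.1 → RunsTo b s P) : RunsTo (.ite e₁ e₂ a b) s P := by
  by_cases h : e₁.eval s.1 < e₂.eval s.1
  · obtain ⟨t, ht, ha⟩ := h₁ h
    exact ⟨t, ht, fun Q _ f hf => by rw [wp_ite, if_pos h, ha Q f hf]⟩
  · obtain ⟨t, ht, ha⟩ := h₂ h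
    exact ⟨t, ht, fun Q _ f hf => by rw [wp_ite, if_neg h, ha Q f hf]⟩

/-- The invariant is indexed by the number of completed rounds. The test can succeed only while this
number is below `N`, so `N` minus it is a decreasing measure. -/
theorem runsTo_loop {e₁ e₂ : Expr} {a : Cmd d} (I : ℕ → State d → Prop) (N : ℕ)
    (step : ∀ k s, I k s → e₁.eval s.1 < e₂.eval s.1 → k < N ∧ RunsTo a s (I (k + 1)))
    {s : State d} (h0 : I 0 s) :
    RunsTo (.loop e₁ e₂ a) s fun t => ∃ k, I k t ∧ ¬ e₁.eval t.1 < e₂.eval t.1 := by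
  have main : ∀ (j k : ℕ) (s : State d), N ≤ k + j → I k s →
      RunsTo (.loop e₁ e₂ a) s fun t => ∃ k, I k t ∧ ¬ e₁.eval t.1 < e₂.eval t.1 := by
    intro j
    induction j with
    | zero =>
      intro k s hk hI
      by_cases h : e₁.eval s.1 < e₂.eval s.1
      · have := (step k s hI h).1
        omega
      · exact ⟨s, ⟨k, hI, h⟩, fun Q _ f hf => by rw [wp_loop Q _ _ _ hf, if_neg h]⟩
    | succ j ih =>
      intro k s hk hI
      by_cases h : e₁.eval s.1 < e₂.eval s.1
      · obtain ⟨t, ht, ha⟩ := (step k s hI h).2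
        obtain ⟨u, hu, hl⟩ := ih (k + 1) t (by omega) ht
        refine ⟨u, hu, fun Q _ f hf => ?_⟩
        rw [wp_loop Q _ _ _ hf, if_pos h, ha Q _ (measurable_wp Q _ hf), hl Q f hf]
      · exact ⟨s, ⟨k, hI, h⟩, fun Q _ f hf => by rw [wp_loop Q _ _ _ hf, if_neg h]⟩
  exact main N 0 s (by omega) h0

end Deterministic

/-! ### Volumes and radii as expressions -/

/-- The `n`-th power of an expression. -/
def powExpr (e : Expr) : ℕ → Expr
  | 0 => .const 1
  | n + 1 => .mul (powExpr e n) e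

@[simp] theorem eval_powExpr (e : Expr) (n : ℕ) (r : ℕ → ℝ) :
    (powExpr e n).eval r = e.eval r ^ n := by
  induction n with
  | zero => simp [powExpr, Expr.eval]
  | succ n ih => simp [powExpr, Expr.eval, ih, pow_succ]

/-- The volume of the unit ball of `ℝ^n`, as an expression. -/
def unitVolumeExpr : ℕ → Expr
  | 0 => .const 1
  | 1 => .const 2
  | n + 2 => .mul (unitVolumeExpr n) (.div .pi (.const (n / 2 + 1)))

/-- Raising `n` by two multiplies the volume by `π / (n/2 + 1)`, by the functional equation of `Γ`.
Starting from the values `1` and `2`, only rational constants and `π` occur, and no square root of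
`π`. -/
theorem eval_unitVolumeExpr (n : ℕ) (r : ℕ → ℝ) :
    (unitVolumeExpr n).eval r = √Real.pi ^ n / Real.Gamma (n / 2 + 1) := by
  induction n using Nat.twoStepInduction with
  | zero => simp [unitVolumeExpr, Expr.eval]
  | one =>
    have : Real.Gamma (((1 : ℕ) : ℝ) / 2 + 1) = 1 / 2 * √Real.pi := by
      rw [Nat.cast_one, Real.Gamma_add_one (by norm_num), Real.Gamma_one_half_eq]
    rw [this]
    have : √Real.pi ≠ 0 := (Real.sqrt_pos.2 Real.pi_pos).ne'
    simp only [unitVolumeExpr, Expr.eval]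
    field_simp
    norm_num
  | more n ih _ =>
    have h : ((n + 2 : ℕ) : ℝ) / 2 + 1 = ((n : ℝ) / 2 + 1) + 1 := by push_cast; ring
    have h0 : (n : ℝ) / 2 + 1 ≠ 0 := by positivity
    have h1 : Real.Gamma ((n : ℝ) / 2 + 1) ≠ 0 := (Real.Gamma_pos_of_pos (by positivity)).ne'
    rw [h, Real.Gamma_add_one h0]
    simp only [unitVolumeExpr, Expr.eval, ih]
    rw [pow_add, Real.sq_sqrt Real.pi_pos.le]
    push_cast
    field_simp

theorem ballVolume_eq {d : ℕ} (hd : 1 ≤ d) {r : ℝ} (hr : 0 ≤ r) :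
    ballVolume d r = √Real.pi ^ d / Real.Gamma (d / 2 + 1) * r ^ d := by
  have : Nonempty (Fin d) := ⟨⟨0, hd⟩⟩
  rw [ballVolume, Measure.real, EuclideanSpace.volume_ball, ENNReal.toReal_mul, ENNReal.toReal_pow,
    ENNReal.toReal_ofReal hr, ENNReal.toReal_ofReal, Fintype.card_fin, mul_comm]
  have := Real.Gamma_pos_of_pos (show 0 < (Fintype.card (Fin d) : ℝ) / 2 + 1 by positivity)
  positivity

theorem ballVolume_pos {d : ℕ} {r : ℝ} (hr : 0 < r) : 0 < ballVolume d r :=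
  ENNReal.toReal_pos (Metric.measure_ball_pos _ _ hr).ne' measure_ball_lt_top.ne

/-- `V(r)` for the radius `r` in register `i`. -/
def volumeExpr (d i : ℕ) : Expr := .mul (unitVolumeExpr d) (powExpr (.reg i) d)

theorem eval_volumeExpr {d : ℕ} (hd : 1 ≤ d) (i : ℕ) (r : ℕ → ℝ) (hr : 0 ≤ r i) :
    (volumeExpr d i).eval r = ballVolume d (r i) := by
  simp [volumeExpr, Expr.eval, eval_unitVolumeExpr, ballVolume_eq hd hr]

/-- `r_k`, where `δ` and `C` are in the registers `1` and `2`, and `k` is the value of `e`. -/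
def radiusExpr (e : Expr) : Expr :=
  .div (.mul (.const 3) (.reg 1))
    (.mul (.mul (.mul (.const 2) (powExpr .pi 2)) (powExpr e 3)) (.reg 2))

theorem eval_radiusExpr (e : Expr) (r : ℕ → ℝ) (k : ℕ) (h : e.eval r = k) :
    (radiusExpr e).eval r = radius (r 1) (r 2) k := by
  simp [radiusExpr, Expr.eval, radius, h]

theorem radius_nonneg {δ C : ℝ} (hδ : 0 < δ) (hC : 0 < C) (n : ℕ) : 0 ≤ radius δ C n := by
  unfold radius; positivity

theorem radius_pos {δ C : ℝ} (hδ : 0 < δ) (hC : 0 < C) {n : ℕ} (hn : 1 ≤ n) :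
    0 < radius δ C n := by
  have : (0 : ℝ) < n := by exact_mod_cast hn
  unfold radius
  have := Real.pi_pos
  positivity

/-- The masses `1/(j(j+1)) = 1/j - 1/(j+1)` telescope. -/
theorem levelTail_succ (k : ℕ) : levelTail (k + 1) = 1 / ((k : ℝ) + 1) := by
  have h : ∀ N : ℕ, ∑ j ∈ Finset.range N, levelMass (k + 1 + j) =
      1 / ((k : ℝ) + 1) - 1 / ((k : ℝ) + 1 + N) := by
    intro N
    induction N with
    | zero => simp
    | succ N ih =>
      rw [Finset.sum_range_succ, ih, levelMass, if_neg (by omega)]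
      push_cast
      have h1 : (k : ℝ) + 1 ≠ 0 := by positivity
      have h2 : (k : ℝ) + 1 + N ≠ 0 := by positivity
      have h3 : (k : ℝ) + 1 + (N + 1) ≠ 0 := by positivity
      have h4 : (k : ℝ) + 1 + N + 1 ≠ 0 := by positivity
      field_simp
      ring
  have hs : HasSum (fun j => levelMass (k + 1 + j)) (1 / ((k : ℝ) + 1)) := by
    rw [hasSum_iff_tendsto_nat_of_nonneg]
    · simp only [h]
      have : Filter.Tendsto (fun N : ℕ => 1 / ((k : ℝ) + 1 + N)) Filter.atTop (nhds 0) := by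
        simp only [one_div]
        exact (Filter.tendsto_atTop_add_const_left _ _ tendsto_natCast_atTop_atTop).inv_tendsto_atTop
      simpa using tendsto_const_nhds.sub this
    · intro j
      unfold levelMass
      split_ifs <;> positivity
  exact hs.tsum_eq

theorem levelTail_zero : levelTail 0 = 1 := by
  have h1 := levelTail_succ 0
  have h0 : levelMass 0 = 0 := by simp [levelMass]
  have hsum : Summable fun j : ℕ => levelMass (0 + j) := by
    by_contra h
    -- Summability comes for free: a non-summable family has `tsum` zero by convention, whereas
    -- `levelTail 1 = 1`.
    have h' : ¬ Summable fun j : ℕ => levelMass (0 + 1 + j) := by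
      intro h2
      refine h ?_
      rw [← summable_nat_add_iff 1]
      refine h2.congr fun j => ?_
      congr 1; omega
    rw [levelTail, tsum_eq_zero_of_not_summable h'] at h1
    norm_num at h1
  rw [levelTail, hsum.tsum_eq_zero_add]
  rw [levelTail] at h1
  simp only [zero_add, h0]
  simpa [add_comm] using h1

/-! ### Deterministic building blocks of the program -/

/-- The registers below `N` agree. -/
def Agree (N : ℕ) (r r' : ℕ → ℝ) : Prop := ∀ i < N, r i = r' i

theorem Agree.refl (N : ℕ) (r : ℕ → ℝ) : Agree N r r := fun _ _ => rfl

theorem Agree.trans {N : ℕ} {r₁ r₂ r₃ : ℕ → ℝ} (h : Agree N r₁ r₂) (h' : Agree N r₂ r₃) :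
    Agree N r₁ r₃ := fun i hi => (h i hi).trans (h' i hi)

theorem Agree.symm {N : ℕ} {r₁ r₂ : ℕ → ℝ} (h : Agree N r₁ r₂) : Agree N r₂ r₁ :=
  fun i hi => (h i hi).symm

theorem Agree.mono {N M : ℕ} {r r' : ℕ → ℝ} (h : Agree N r r') (hM : M ≤ N) : Agree M r r' :=
  fun i hi => h i (hi.trans_le hM)

theorem Agree.update {N j : ℕ} {r r' : ℕ → ℝ} (h : Agree N r r') (hj : N ≤ j) (v : ℝ) :
    Agree N (Function.update r j v) r' := by
  intro i hi
  rw [Function.update_of_ne (by omega)]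
  exact h i hi

/-- The registers `0, …, d + 2` hold the input `(n, δ, C, x)`. -/
structure Inputs {d : ℕ} (n : ℕ) (δ C : ℝ) (x : E d) (r : ℕ → ℝ) : Prop where
  level : r 0 = n
  delta : r 1 = δ
  lipschitz : r 2 = C
  coord : ∀ j : Fin d, r (j + 3) = x j

theorem inputs_inputState {d : ℕ} (n : ℕ) (δ C : ℝ) (x : E d) :
    Inputs n δ C x (inputState n δ C x).1 where
  level := by simp [inputState]
  delta := by simp [inputState]
  lipschitz := by simp [inputState]
  coord j := by simp [inputState]

theorem Inputs.of_agree {d : ℕ} {n : ℕ} {δ C : ℝ} {x : E d} {r r' : ℕ → ℝ}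
    (h : Inputs n δ C x r) {N : ℕ} (hN : d + 3 ≤ N) (ha : Agree N r' r) : Inputs n δ C x r' where
  level := by rw [ha 0 (by omega), h.level]
  delta := by rw [ha 1 (by omega), h.delta]
  lipschitz := by rw [ha 2 (by omega), h.lipschitz]
  coord j := by rw [ha _ (by omega), h.coord]

/-- Adds the squared coordinates of (current approximation) `- x`, for the coordinates in a list,
to the register `d + 19`. -/
def sqDistLoop (d : ℕ) : List (Fin d) → Cmd d
  | [] => .skip
  | j :: l => .seq (.load (d + 20) j)
      (.seq (.assign (d + 19) (.add (.reg (d + 19))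
        (powExpr (.sub (.reg (d + 20)) (.reg (j + 3))) 2))) (sqDistLoop d l))

/-- Stores the squared distance of the current approximation from `x` in the register `d + 19`. -/
def sqDistCmd (d : ℕ) : Cmd d :=
  .seq (.assign (d + 19) (.const 0)) (sqDistLoop d (List.finRange d))

theorem runsTo_sqDistLoop {d n : ℕ} {δ C : ℝ} {x : E d} (l : List (Fin d)) :
    ∀ s : State d, Inputs n δ C x s.1 → RunsTo (sqDistLoop d l) s fun t =>
      t.2 = s.2 ∧ Agree (d + 19) t.1 s.1 ∧
        t.1 (d + 19) = s.1 (d + 19) + (l.map fun j => (s.2 0 j - x j) ^ 2).sum := by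
  induction l with
  | nil => intro s _; exact runsTo_skip ⟨rfl, Agree.refl _ _, by simp⟩
  | cons j l ih =>
    intro s hs
    unfold sqDistLoop
    refine (runsTo_load (P := fun t => t = _) rfl).seq fun t ht => ?_
    subst ht
    refine runsTo_assign_seq ?_
    have hag : Agree (d + 19) (Function.update (Function.update s.1 (d + 20) (s.2 0 j)) (d + 19)
        ((Expr.add (.reg (d + 19)) (powExpr (.sub (.reg (d + 20)) (.reg (j + 3))) 2)).eval
          (Function.update s.1 (d + 20) (s.2 0 j)))) s.1 :=
      ((Agree.refl _ _).update (by omega) _).update (by omega) _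
    refine (ih _ (hs.of_agree (N := d + 19) (by omega) hag)).mono ?_
    rintro t ⟨h1, h2, h3⟩
    refine ⟨h1, h2.trans hag, ?_⟩
    rw [h3]
    have : Function.update s.1 (d + 20) (s.2 0 j) (j + 3) = x j := by
      rw [Function.update_of_ne (by omega), hs.coord]
    simp [Expr.eval, this, add_assoc]

theorem runsTo_sqDistCmd {d n : ℕ} {δ C : ℝ} {x : E d} (s : State d) (hs : Inputs n δ C x s.1) :
    RunsTo (sqDistCmd d) s fun t =>
      t.2 = s.2 ∧ Agree (d + 19) t.1 s.1 ∧ t.1 (d + 19) = ‖s.2 0 - x‖ ^ 2 := by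
  refine runsTo_assign_seq ?_
  have hag : Agree (d + 19) (Function.update s.1 (d + 19) ((Expr.const 0).eval s.1)) s.1 :=
    (Agree.refl _ _).update (by omega) _
  refine (runsTo_sqDistLoop _ _ (hs.of_agree (N := d + 19) (by omega) hag)).mono ?_
  rintro t ⟨h1, h2, h3⟩
  refine ⟨h1, h2.trans hag, ?_⟩
  rw [h3, EuclideanSpace.norm_sq_eq]
  simp [Expr.eval, ← List.sum_ofFn, List.ofFn_eq_map]

/-- The squared test: the current approximation is too coarse to compare the distance from `x` with
the radius if this is less than `coarse₂`. -/
def coarse₁ (d : ℕ) : Expr := powExpr (.sub (.reg (d + 19)) (powExpr (.reg (d + 18)) 2)) 2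

/-- The squared tolerance. -/
def coarse₂ (d : ℕ) : Expr :=
  powExpr (.mul (.reg (d + 17)) (.add (.mul (.const 2) (.reg (d + 18))) (.reg (d + 17)))) 2

/-- Refines the approximation until the distance from `x` can be compared with the radius. -/
def refineCmd (d : ℕ) : Cmd d :=
  .seq (sqDistCmd d) (.loop (coarse₁ d) (coarse₂ d)
    (.seq .sharpen (.seq (.assign (d + 17) (.div (.reg (d + 17)) (.const 2))) (sqDistCmd d))))

/-- `|D'² - r²| ≥ e(2r + e)` means that `D'²` is at least `(r + e)²` or at most `r² - 2re - e² < (r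
- e)²`. In either case `D'` is at least `e` away from `r`, so an error of `e` cannot reverse the
comparison. Squares are used throughout because the program has no square roots. -/
theorem lt_radius_iff {D D' e r : ℝ} (hD' : 0 ≤ D') (hr : 0 < r) (he : 0 < e)
    (h : |D' - D| ≤ e) (htest : ¬ (D' ^ 2 - r ^ 2) ^ 2 < (e * (2 * r + e)) ^ 2) :
    D' ^ 2 < r ^ 2 ↔ D < r := by
  rw [not_lt, sq_le_sq, abs_of_pos (show 0 < e * (2 * r + e) by positivity), le_abs] at htest
  rw [abs_le] at h
  rcases htest with h1 | h1
  · have h2 : (r + e) ^ 2 ≤ D' ^ 2 := by nlinarith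
    have h3 : r + e ≤ D' := by
      exact (sq_le_sq₀ (by positivity) hD').1 h2
    constructor
    · intro h4; nlinarith
    · intro h4; linarith
  -- `0 ≤ D'² ≤ r² - 2re - e²` excludes `e ≥ r`; the positivity of `r - e` then allows the square
  -- roots to be compared.
  · have h2 : e < r := by nlinarith [sq_nonneg D', sq_nonneg e]
    have h3 : D' ^ 2 < (r - e) ^ 2 := by nlinarith
    have h4 : D' < r - e := (sq_lt_sq₀ hD' (by linarith)).1 h3
    constructor
    · intro _; linarith
    · intro _; nlinarith

/-- As `N` grows, the squared tolerance tends to zero while the left side tends to `(‖ξ - x‖² -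
r²)²`, which is positive off the sphere. -/
theorem exists_fine {d : ℕ} {y : ℕ → E d} {ξ x : E d} {r : ℝ}
    (hy : ∀ k, ‖y k - ξ‖ ≤ (1 / 2 : ℝ) ^ (k + 1)) (hr : 0 < r) (hne : ‖ξ - x‖ ≠ r) :
    ∃ K, ∀ N, K ≤ N → ¬ ((‖y N - x‖ ^ 2 - r ^ 2) ^ 2 <
      ((1 / 2 : ℝ) ^ (N + 1) * (2 * r + (1 / 2 : ℝ) ^ (N + 1))) ^ 2) := by
  have hp : Filter.Tendsto (fun N : ℕ => (1 / 2 : ℝ) ^ (N + 1)) Filter.atTop (nhds 0) :=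
    (tendsto_pow_atTop_nhds_zero_of_lt_one (by norm_num) (by norm_num)).comp
      (Filter.tendsto_add_atTop_nat 1)
  have hy' : Filter.Tendsto y Filter.atTop (nhds ξ) := by
    rw [tendsto_iff_norm_sub_tendsto_zero]
    exact squeeze_zero (fun _ => norm_nonneg _) hy hp
  have h1 : Filter.Tendsto (fun N => (‖y N - x‖ ^ 2 - r ^ 2) ^ 2) Filter.atTop
      (nhds ((‖ξ - x‖ ^ 2 - r ^ 2) ^ 2)) :=
    ((((hy'.sub_const x).norm).pow 2).sub_const _).pow 2
  have h2 : Filter.Tendsto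
      (fun N : ℕ => ((1 / 2 : ℝ) ^ (N + 1) * (2 * r + (1 / 2 : ℝ) ^ (N + 1))) ^ 2)
      Filter.atTop (nhds ((0 * (2 * r + 0)) ^ 2)) :=
    (hp.mul (hp.const_add _)).pow 2
  have h3 : (0 * (2 * r + 0)) ^ 2 < (‖ξ - x‖ ^ 2 - r ^ 2) ^ 2 := by
    have : ‖ξ - x‖ ^ 2 - r ^ 2 ≠ 0 := by
      intro h
      exact hne ((sq_eq_sq₀ (norm_nonneg _) hr.le).1 (by linarith))
    rw [zero_mul, zero_pow two_ne_zero]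
    positivity
  obtain ⟨K, hK⟩ := Filter.eventually_atTop.1 (h2.eventually_lt h1 h3)
  exact ⟨K, fun N hN => (hK N hN).not_gt⟩

/-- `N₀` counts the refinements already made: one copy of the random vector serves all levels, and
its approximations cannot be rewound between levels. -/
theorem runsTo_refineCmd {d n : ℕ} {δ C : ℝ} {x : E d} {y : ℕ → E d} {ξ : E d} (s : State d)
    (hs : Inputs n δ C x s.1) (N₀ : ℕ) (hy : ∀ k, ‖y k - ξ‖ ≤ (1 / 2 : ℝ) ^ (k + 1))
    (hr : 0 < s.1 (d + 18)) (hne : ‖ξ - x‖ ≠ s.1 (d + 18))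
    (he : s.1 (d + 17) = (1 / 2 : ℝ) ^ (N₀ + 1)) (hsy : s.2 = fun k => y (N₀ + k)) :
    RunsTo (refineCmd d) s fun t => Agree (d + 17) t.1 s.1 ∧ t.1 (d + 18) = s.1 (d + 18) ∧
      (∃ N, t.1 (d + 17) = (1 / 2 : ℝ) ^ (N + 1) ∧ t.2 = fun k => y (N + k)) ∧
      (t.1 (d + 19) < s.1 (d + 18) ^ 2 ↔ ‖ξ - x‖ < s.1 (d + 18)) := by
  -- `K` bounds the index of the approximation, and therefore also the number of rounds, whatever
  -- `N₀` is.
  obtain ⟨K, hK⟩ := exists_fine hy hr hne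
  have hloop : ∀ t : State d, (t.2 = s.2 ∧ Agree (d + 19) t.1 s.1 ∧
      t.1 (d + 19) = ‖s.2 0 - x‖ ^ 2) →
      RunsTo (.loop (coarse₁ d) (coarse₂ d)
        (.seq .sharpen (.seq (.assign (d + 17) (.div (.reg (d + 17)) (.const 2))) (sqDistCmd d)))) t
      fun u => ∃ k, (Agree (d + 17) u.1 s.1 ∧ u.1 (d + 18) = s.1 (d + 18) ∧
        u.1 (d + 17) = (1 / 2 : ℝ) ^ (N₀ + k + 1) ∧ (u.2 = fun j => y (N₀ + k + j)) ∧
        u.1 (d + 19) = ‖y (N₀ + k) - x‖ ^ 2) ∧ ¬ (coarse₁ d).eval u.1 < (coarse₂ d).eval u.1 := by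
    rintro t ⟨h1, h2, h3⟩
    refine runsTo_loop (fun k (u : State d) => Agree (d + 17) u.1 s.1 ∧
      u.1 (d + 18) = s.1 (d + 18) ∧ u.1 (d + 17) = (1 / 2 : ℝ) ^ (N₀ + k + 1) ∧
      (u.2 = fun j => y (N₀ + k + j)) ∧ u.1 (d + 19) = ‖y (N₀ + k) - x‖ ^ 2) K ?_ ?_
    · rintro k u ⟨a1, a2, a3, a4, a5⟩ htest
      constructor
      · by_contra hk
        refine hK (N₀ + k) (by omega) ?_
        simpa [coarse₁, coarse₂, Expr.eval, a2, a3, a5] using htest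
      · refine (runsTo_sharpen (P := fun t => t = _) rfl).seq fun v hv => ?_
        subst hv
        refine runsTo_assign_seq ?_
        have hag : Agree (d + 17) (Function.update u.1 (d + 17)
            ((Expr.div (.reg (d + 17)) (.const 2)).eval u.1)) u.1 :=
          (Agree.refl _ _).update (by omega) _
        refine (runsTo_sqDistCmd _ (hs.of_agree (N := d + 17) (by omega) (hag.trans a1))).mono ?_
        rintro w ⟨b1, b2, b3⟩
        refine ⟨(b2.mono (by omega)).trans (hag.trans a1), ?_, ?_, ?_, ?_⟩
        · rw [b2 _ (by omega)]
          simpa using a2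
        · rw [b2 _ (by omega)]
          simp [Expr.eval, a3]
          ring
        · rw [b1]
          funext j
          simp only [a4]
          congr 1; omega
        · rw [b3]
          simp only [a4]
          rfl
    · exact ⟨h2.mono (by omega), h2 _ (by omega), by rw [h2 _ (by omega), he, add_zero],
        by rw [h1, hsy]; rfl, by rw [h3, hsy]⟩
  refine ((runsTo_sqDistCmd s hs).seq hloop).mono ?_
  rintro u ⟨k, ⟨a1, a2, a3, a4, a5⟩, htest⟩
  refine ⟨a1, a2, ⟨N₀ + k, a3, a4⟩, ?_⟩
  rw [a5]
  refine lt_radius_iff (norm_nonneg _) hr (e := (1 / 2 : ℝ) ^ (N₀ + k + 1))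
    (by positivity) ?_ ?_
  · refine (abs_norm_sub_norm_le _ _).trans ?_
    simpa using hy (N₀ + k)
  · simpa [coarse₁, coarse₂, Expr.eval, a2, a3, a5] using htest

/-- One summand of `Λ_n(x)`: the level is in the register `d + 15`, the preceding `p̂` in `d + 16`. -/
def levelCmd (d : ℕ) : Cmd d :=
  .seq (.assign (d + 18) (radiusExpr (.add (.reg (d + 15)) (.const 1))))
    (.seq (refineCmd d)
    (.seq (.ite (.reg (d + 19)) (powExpr (.reg (d + 18)) 2)
      (.assign (d + 19) (.div (.const 1) (volumeExpr d (d + 18))))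
      (.assign (d + 19) (.const 0)))
    (.seq (.ite (.reg (d + 15)) (.const 1)
      (.assign (d + 14) (.add (.reg (d + 14)) (.sub (.reg (d + 19)) (.reg (d + 16)))))
      (.assign (d + 14) (.add (.reg (d + 14))
        (.mul (.reg (d + 15)) (.sub (.reg (d + 19)) (.reg (d + 16)))))))
    (.seq (.assign (d + 16) (.reg (d + 19)))
      (.assign (d + 15) (.add (.reg (d + 15)) (.const 1)))))))

/-- Computes `Λ_n(x)` from the current copy of the random vector, in the register `d + 14`. -/
def levelSumCmd (d : ℕ) : Cmd d :=
  .seq (.assign (d + 17) (.const (1 / 2)))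
    (.seq (.assign (d + 15) (.const 0))
    (.seq (.assign (d + 16) (.const 0))
    (.seq (.assign (d + 14) (.const 0))
      (.loop (.reg (d + 15)) (.add (.reg 0) (.const 1)) (levelCmd d)))))

/-- The invariant of the loop of `levelSumCmd`. -/
def LevelInv {d : ℕ} (δ C : ℝ) (x : E d) (y : ℕ → E d) (ξ : E d) (r₀ : ℕ → ℝ) (k : ℕ)
    (s : State d) : Prop :=
  Agree (d + 14) s.1 r₀ ∧ s.1 (d + 15) = k ∧ s.1 (d + 16) = pHat δ C k x ξ ∧
    s.1 (d + 14) = ∑ j ∈ Finset.range k, (pHat δ C (j + 1) x ξ - pHat δ C j x ξ) / levelTail j ∧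
    ∃ N, s.1 (d + 17) = (1 / 2 : ℝ) ^ (N + 1) ∧ s.2 = fun k => y (N + k)

theorem pHat_succ {d : ℕ} (δ C : ℝ) (k : ℕ) (x ξ : E d) [Decidable (‖ξ - x‖ < radius δ C (k + 1))] :
    pHat δ C (k + 1) x ξ =
      if ‖ξ - x‖ < radius δ C (k + 1) then (ballVolume d (radius δ C (k + 1)))⁻¹ else 0 := by
  classical
  simp only [pHat, Set.indicator, mem_ball_iff_norm]
  split_ifs <;> simp_all

theorem runsTo_levelCmd {d n : ℕ} (hd : 1 ≤ d) {δ C : ℝ} {x : E d} {y : ℕ → E d} {ξ : E d}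
    (hδ : 0 < δ) (hC : 0 < C) {r₀ : ℕ → ℝ} (h₀ : Inputs n δ C x r₀)
    (hy : ∀ k, ‖y k - ξ‖ ≤ (1 / 2 : ℝ) ^ (k + 1)) (hne : ∀ k, ‖ξ - x‖ ≠ radius δ C (k + 1))
    (k : ℕ) (s : State d) (hs : LevelInv δ C x y ξ r₀ k s) :
    RunsTo (levelCmd d) s (LevelInv δ C x y ξ r₀ (k + 1)) := by
  classical
  obtain ⟨a1, a2, a3, a4, N, a5, a6⟩ := hs
  have hin : Inputs n δ C x s.1 := h₀.of_agree (by omega) a1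
  have hrad : (radiusExpr (.add (.reg (d + 15)) (.const 1))).eval s.1 = radius δ C (k + 1) := by
    rw [eval_radiusExpr _ _ (k + 1) (by simp [Expr.eval, a2]), hin.delta, hin.lipschitz]
  have hpos : 0 < radius δ C (k + 1) := radius_pos hδ hC (by omega)
  refine runsTo_assign_seq ?_
  rw [hrad]
  have hag : Agree (d + 18) (Function.update s.1 (d + 18) (radius δ C (k + 1))) s.1 :=
    (Agree.refl _ _).update le_rfl _
  refine (runsTo_refineCmd (n := n) (δ := δ) (C := C) (x := x) (y := y) (ξ := ξ)
    (Function.update s.1 (d + 18) (radius δ C (k + 1)), s.2)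
    (hin.of_agree (N := d + 18) (by omega) hag) N hy ?_ ?_ ?_ a6).seq ?_
  · simpa using hpos
  · simpa using hne k
  · simpa using a5
  rintro t ⟨b1, b2, ⟨N', b3, b4⟩, b5⟩
  simp only [Function.update_self] at b2 b5
  have hc1 : Agree (d + 17) t.1 s.1 := b1.trans (hag.mono (by omega))
  refine RunsTo.seq (P := fun u => u = (Function.update t.1 (d + 19) (pHat δ C (k + 1) x ξ), t.2))
    ?_ fun u hu => ?_
  · refine runsTo_ite (fun h => runsTo_assign ?_) (fun h => runsTo_assign ?_)
    · rw [show (Expr.reg (d + 19)).eval t.1 = t.1 (d + 19) from rfl, eval_powExpr,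
        show (Expr.reg (d + 18)).eval t.1 = t.1 (d + 18) from rfl, b2, b5] at h
      rw [pHat_succ, if_pos h, Expr.eval, eval_volumeExpr hd _ _ (by rw [b2]; exact hpos.le), b2]
      simp [Expr.eval]
    · rw [show (Expr.reg (d + 19)).eval t.1 = t.1 (d + 19) from rfl, eval_powExpr,
        show (Expr.reg (d + 18)).eval t.1 = t.1 (d + 18) from rfl, b2, b5] at h
      rw [pHat_succ, if_neg h]
      simp [Expr.eval]
  subst hu
  have e14 : t.1 (d + 14) = s.1 (d + 14) := hc1 _ (by omega)
  have e15 : t.1 (d + 15) = k := by rw [hc1 _ (by omega), a2]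
  have e16 : t.1 (d + 16) = pHat δ C k x ξ := by rw [hc1 _ (by omega), a3]
  refine RunsTo.seq (P := fun u => u = (Function.update (Function.update t.1 (d + 19)
    (pHat δ C (k + 1) x ξ)) (d + 14) (∑ j ∈ Finset.range (k + 1),
      (pHat δ C (j + 1) x ξ - pHat δ C j x ξ) / levelTail j), t.2)) ?_ fun u hu => ?_
  · rw [Finset.sum_range_succ, ← a4]
    refine runsTo_ite (fun h => runsTo_assign ?_) (fun h => runsTo_assign ?_)
    -- Level zero has its own branch, since `P(N ≥ 0) = 1`, whereas `1 / P(N ≥ k) = k` for `k ≥ 1`.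
    · have hk : k = 0 := by
        simp only [Expr.eval] at h
        rw [Function.update_of_ne (by omega), e15] at h
        exact_mod_cast Nat.lt_one_iff.1 (by exact_mod_cast h)
      subst hk
      simp [Expr.eval, e14, e16, levelTail_zero]
    · obtain ⟨j, rfl⟩ : ∃ j, k = j + 1 := by
        refine Nat.exists_eq_succ_of_ne_zero fun hk => h ?_
        simp [Expr.eval, e15, hk]
      simp [Expr.eval, e14, e15, e16, levelTail_succ, mul_comm]
  subst hu
  refine runsTo_assign_seq (runsTo_assign ?_)
  refine ⟨?_, ?_, ?_, ?_, N', ?_, b4⟩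
  · exact ((((((hc1.mono (by omega)).trans a1).update (by omega) _).update le_rfl _).update
      (by omega) _).update (by omega) _)
  · simp [Expr.eval, e15]
  · simp [Expr.eval]
  · simp
  · simpa using b3

theorem runsTo_levelSumCmd {d n : ℕ} (hd : 1 ≤ d) {δ C : ℝ} {x : E d} {y : ℕ → E d} {ξ : E d}
    (hδ : 0 < δ) (hC : 0 < C) (hy : ∀ k, ‖y k - ξ‖ ≤ (1 / 2 : ℝ) ^ (k + 1))
    (hne : ∀ k, ‖ξ - x‖ ≠ radius δ C (k + 1)) (r : ℕ → ℝ) (hr : Inputs n δ C x r) :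
    RunsTo (levelSumCmd d) (r, y) fun t =>
      Agree (d + 14) t.1 r ∧ t.1 (d + 14) = levelSum δ C n x ξ := by
  unfold levelSumCmd
  iterate 4 refine runsTo_assign_seq ?_
  have htest : ∀ (k : ℕ) (s : State d), LevelInv δ C x y ξ r k s →
      ((Expr.reg (d + 15)).eval s.1 < (Expr.add (.reg 0) (.const 1)).eval s.1 ↔ k < n + 1) := by
    rintro k s ⟨a1, a2, -⟩
    simp only [Expr.eval]
    rw [a2, a1 0 (by omega), hr.level]
    norm_cast
  refine (runsTo_loop (fun k s => LevelInv δ C x y ξ r k s ∧ k ≤ n + 1) (n + 1) ?_ ?_).mono ?_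
  · rintro k s ⟨hI, hk⟩ ht
    rw [htest k s hI] at ht
    exact ⟨ht, (runsTo_levelCmd hd hδ hC hr hy hne k s hI).mono fun t h => ⟨h, ht⟩⟩
  · refine ⟨⟨?_, ?_, ?_, ?_, 0, ?_, ?_⟩, by omega⟩
    · exact (((((Agree.refl _ _).update (by omega) _).update (by omega) _).update
        (by omega) _).update (by omega) _)
    · simp [Expr.eval]
    · simp [Expr.eval, pHat]
    · simp [Expr.eval]
    · simp [Expr.eval]
    · simp
  · rintro t ⟨k, ⟨hI, hk⟩, ht⟩
    rw [htest k t hI] at ht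
    obtain rfl : k = n + 1 := by omega
    exact ⟨hI.1, hI.2.2.2.1⟩

/-- Computes `m_n` in the register `d + 3`. -/
def levelBoundCmd (d : ℕ) : Cmd d :=
  .seq (.assign (d + 15) (.const 1))
    (.seq (.assign (d + 18) (radiusExpr (.reg (d + 15))))
    (.seq (.assign (d + 3) (.div (.const 1) (volumeExpr d (d + 18))))
    (.loop (.reg (d + 15)) (.add (.reg 0) (.const 1))
      (.seq (.assign (d + 18) (radiusExpr (.reg (d + 15))))
      (.seq (.assign (d + 19) (.div (.reg (d + 15)) (volumeExpr d (d + 18))))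
      (.seq (.assign (d + 18) (radiusExpr (.add (.reg (d + 15)) (.const 1))))
      (.seq (.assign (d + 19)
        (.add (.div (.reg (d + 15)) (volumeExpr d (d + 18))) (.reg (d + 19))))
      (.seq (.assign (d + 3) (.add (.reg (d + 3)) (.reg (d + 19))))
        (.assign (d + 15) (.add (.reg (d + 15)) (.const 1)))))))))))

theorem runsTo_levelBoundCmd {d n : ℕ} (hd : 1 ≤ d) {δ C : ℝ} {x : E d} (hδ : 0 < δ) (hC : 0 < C)
    (s : State d) (hs : Inputs n δ C x s.1) :
    RunsTo (levelBoundCmd d) s fun t =>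
      Agree (d + 3) t.1 s.1 ∧ t.1 (d + 3) = levelBound d δ C n := by
  have hrad : ∀ (e : Expr) (k : ℕ) (r : ℕ → ℝ), Agree (d + 3) r s.1 → e.eval r = k →
      (radiusExpr e).eval r = radius δ C k := by
    intro e k r ht hk
    rw [eval_radiusExpr _ _ k hk, (hs.of_agree le_rfl ht).delta, (hs.of_agree le_rfl ht).lipschitz]
  have hvol : ∀ (r : ℕ → ℝ) (k : ℕ), r (d + 18) = radius δ C k →
      (volumeExpr d (d + 18)).eval r = ballVolume d (radius δ C k) := by
    intro r k hk
    rw [eval_volumeExpr hd _ _ (by rw [hk]; exact radius_nonneg hδ hC k), hk]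
  -- The counter `d + 15` holds the index of the next summand, hence `j + 1` after `j` rounds.
  let I : ℕ → State d → Prop := fun j t => Agree (d + 3) t.1 s.1 ∧ t.1 (d + 15) = (j : ℝ) + 1 ∧
    j ≤ n ∧ t.1 (d + 3) = (ballVolume d (radius δ C 1))⁻¹ + ∑ k ∈ Finset.Icc 1 j,
      ((k : ℝ) * (ballVolume d (radius δ C (k + 1)))⁻¹ + (k : ℝ) * (ballVolume d (radius δ C k))⁻¹)
  have htest : ∀ (k : ℕ) (t : State d), I k t →
      ((Expr.reg (d + 15)).eval t.1 < (Expr.add (.reg 0) (.const 1)).eval t.1 ↔ k < n) := by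
    rintro k t ⟨a1, a2, -⟩
    simp only [Expr.eval]
    rw [a2, a1 0 (by omega), hs.level]
    norm_cast
    omega
  refine runsTo_assign_seq (runsTo_assign_seq (runsTo_assign_seq ?_))
  refine (runsTo_loop I n ?_ ?_).mono ?_
  · intro k t hI ht
    rw [htest k t hI] at ht
    obtain ⟨a1, a2, a3, a4⟩ := hI
    refine ⟨ht, ?_⟩
    refine runsTo_assign_seq ?_
    rw [hrad (.reg (d + 15)) (k + 1) t.1 a1 (by simp [Expr.eval, a2])]
    refine runsTo_assign_seq ?_
    rw [Expr.eval, hvol _ (k + 1) (by simp)]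
    refine runsTo_assign_seq ?_
    rw [hrad (.add (.reg (d + 15)) (.const 1)) (k + 2)]
    rotate_left
    · exact (a1.update (by omega) _).update (by omega) _
    · simp only [Expr.eval, ne_eq, Nat.add_left_cancel_iff, Nat.reduceEqDiff,
        not_false_eq_true, Function.update_of_ne, a2]
      push_cast
      ring
    refine runsTo_assign_seq ?_
    simp only [Expr.eval]
    rw [hvol _ (k + 2) (by simp)]
    refine runsTo_assign_seq (runsTo_assign ?_)
    refine ⟨?_, ?_, by omega, ?_⟩
    · exact ((((((a1.update (by omega) _).update (by omega) _).update (by omega) _).update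
        (by omega) _).update (by omega) _).update (by omega) _)
    · simp [Expr.eval, a2]
    · rw [Finset.sum_Icc_succ_top (by omega), ← add_assoc, ← a4]
      simp [Expr.eval, a2, div_eq_mul_inv]
  · refine ⟨?_, ?_, by omega, ?_⟩
    · exact (((Agree.refl _ _).update (by omega) _).update (by omega) _).update (by omega) _
    · simp [Expr.eval]
    · rw [hrad (.reg (d + 15)) 1]
      rotate_left
      · exact (Agree.refl _ _).update (by omega) _
      · simp [Expr.eval]
      simp only [Expr.eval]
      rw [hvol _ 1 (by simp)]
      simp
  · rintro t ⟨k, hI, ht⟩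
    rw [htest k t hI] at ht
    obtain ⟨a1, a2, a3, a4⟩ := hI
    obtain rfl : k = n := by omega
    exact ⟨a1, a4⟩

/-- Stores in the register `d + 8` the power of `1 - η` (`η` in `d + 7`) with the exponent in
`d + 5`. -/
def powerCmd (d : ℕ) : Cmd d :=
  .seq (.assign (d + 8) (.const 1))
    (.seq (.assign (d + 9) (.const 0))
    (.loop (.reg (d + 9)) (.reg (d + 5))
      (.seq (.assign (d + 8) (.mul (.reg (d + 8)) (.sub (.const 1) (.reg (d + 7)))))
        (.assign (d + 9) (.add (.reg (d + 9)) (.const 1))))))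

theorem runsTo_powerCmd {d : ℕ} (s : State d) (k : ℕ) (hk : s.1 (d + 5) = k) :
    RunsTo (powerCmd d) s fun t => Agree (d + 8) t.1 s.1 ∧ t.1 (d + 8) = (1 - s.1 (d + 7)) ^ k := by
  let I : ℕ → State d → Prop := fun j t => Agree (d + 8) t.1 s.1 ∧ t.1 (d + 9) = j ∧ j ≤ k ∧
    t.1 (d + 8) = (1 - s.1 (d + 7)) ^ j
  have htest : ∀ (j : ℕ) (t : State d), I j t →
      ((Expr.reg (d + 9)).eval t.1 < (Expr.reg (d + 5)).eval t.1 ↔ j < k) := by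
    rintro j t ⟨a1, a2, -⟩
    simp only [Expr.eval]
    rw [a2, a1 _ (by omega), hk]
    norm_cast
  refine runsTo_assign_seq (runsTo_assign_seq ?_)
  refine (runsTo_loop I k ?_ ?_).mono ?_
  · intro j t hI ht
    rw [htest j t hI] at ht
    obtain ⟨a1, a2, a3, a4⟩ := hI
    refine ⟨ht, runsTo_assign_seq (runsTo_assign ⟨?_, ?_, by omega, ?_⟩)⟩
    · exact (a1.update le_rfl _).update (by omega) _
    · simp [Expr.eval, a2]
    · simp [Expr.eval, a4, a1 (d + 7) (by omega), pow_succ]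
  · refine ⟨?_, ?_, by omega, ?_⟩
    · exact ((Agree.refl _ _).update le_rfl _).update (by omega) _
    · simp [Expr.eval]
    · simp [Expr.eval]
  · rintro t ⟨j, hI, ht⟩
    rw [htest j t hI] at ht
    obtain ⟨a1, a2, a3, a4⟩ := hI
    obtain rfl : j = k := by omega
    exact ⟨a1, a4⟩

/-! ### The stopped random walk -/

/-- No partial sum of index in `[1, k]` is nonnegative: `τ > k`. -/
def notStopped (k : ℕ) : Set (ℕ → ℝ) := {l | ∀ j, 1 ≤ j → j ≤ k → partialSum l j < 0}

theorem measurable_partialSum (k : ℕ) : Measurable fun l : ℕ → ℝ => partialSum l k :=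
  Finset.measurable_fun_sum _ fun j _ => measurable_pi_apply j

theorem measurableSet_notStopped (k : ℕ) : MeasurableSet (notStopped k) := by
  have : notStopped k = ⋂ j : ℕ, ⋂ _ : 1 ≤ j, ⋂ _ : j ≤ k, {l | partialSum l j < 0} := by
    ext l; simp [notStopped]
  rw [this]
  exact MeasurableSet.iInter fun j => MeasurableSet.iInter fun _ => MeasurableSet.iInter fun _ =>
    measurableSet_lt (measurable_partialSum j) measurable_const

theorem partialSum_congr {l l' : ℕ → ℝ} {k j : ℕ} (h : ∀ i < k, l i = l' i) (hj : j ≤ k) :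
    partialSum l j = partialSum l' j :=
  Finset.sum_congr rfl fun i hi => h i ((Finset.mem_range.1 hi).trans_le hj)

/-- The event `τ > k` is decided by the first `k` terms; this is what makes it independent of `l k`.
-/
theorem mem_notStopped_congr {l l' : ℕ → ℝ} {k : ℕ} (h : ∀ i < k, l i = l' i) :
    l ∈ notStopped k ↔ l' ∈ notStopped k := by
  refine forall_congr' fun j => forall_congr' fun _ => forall_congr' fun hj => ?_
  rw [partialSum_congr h hj]

theorem partialSum_nonpos_of_notStopped {l : ℕ → ℝ} {k : ℕ} (h : l ∈ notStopped k) :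
    partialSum l k ≤ 0 := by
  rcases Nat.eq_zero_or_pos k with rfl | hk
  · simp [partialSum]
  · exact (h k hk le_rfl).le

/-- The walk reaches the nonnegative half-line. -/
def Stops (l : ℕ → ℝ) : Prop := ∃ k, 1 ≤ k ∧ 0 ≤ partialSum l k

theorem Stops.spec {l : ℕ → ℝ} (h : Stops l) :
    1 ≤ stopIndex l ∧ 0 ≤ partialSum l (stopIndex l) :=
  Nat.sInf_mem (s := {k | 1 ≤ k ∧ 0 ≤ partialSum l k}) h

theorem partialSum_neg_of_lt_stopIndex {l : ℕ → ℝ} {j : ℕ} (h1 : 1 ≤ j) (h : j < stopIndex l) :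
    partialSum l j < 0 := by
  have := Nat.notMem_of_lt_sInf h
  by_contra h'
  exact this ⟨h1, not_lt.1 h'⟩

theorem Stops.mem_notStopped {l : ℕ → ℝ} (h : Stops l) (k : ℕ) :
    l ∈ notStopped k ↔ k < stopIndex l := by
  constructor
  · intro hk
    by_contra hlt
    exact (hk _ h.spec.1 (not_lt.1 hlt)).not_ge h.spec.2
  · intro hk j h1 hj
    exact partialSum_neg_of_lt_stopIndex h1 (hj.trans_lt hk)

theorem stopIndex_of_not_stops {l : ℕ → ℝ} (h : ¬ Stops l) : stopIndex l = 0 := by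
  have : {k | 1 ≤ k ∧ 0 ≤ partialSum l k} = ∅ :=
    Set.eq_empty_of_forall_notMem fun k hk => h ⟨k, hk⟩
  rw [stopIndex, this, Nat.sInf_empty]

/-- `S_τ`. -/
def stoppedSum (l : ℕ → ℝ) : ℝ := partialSum l (stopIndex l)

/-- This holds even for sequences that never stop: there `stopIndex` is `sInf ∅ = 0` and the sum is
empty. The bounds on `Λ⁺` are thus valid everywhere, not merely almost surely. -/
theorem stoppedSum_nonneg (l : ℕ → ℝ) : 0 ≤ stoppedSum l := by
  by_cases h : Stops l
  · exact h.spec.2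
  · simp [stoppedSum, stopIndex_of_not_stops h, partialSum]

/-- Just before stopping the sum is nonpositive, and the last term adds at most `m`. -/
theorem stoppedSum_le {l : ℕ → ℝ} {m : ℝ} (hm : 0 ≤ m) (hl : ∀ k, |l k| ≤ m) :
    stoppedSum l ≤ m := by
  rw [stoppedSum]
  rcases h : stopIndex l with _ | t
  · simpa [partialSum] using hm
  · rw [partialSum, Finset.sum_range_succ]
    have h1 : partialSum l t ≤ 0 := by
      rcases Nat.eq_zero_or_pos t with rfl | ht
      · simp [partialSum]
      · exact (partialSum_neg_of_lt_stopIndex ht (by omega)).le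
    have h2 := (abs_le.1 (hl t)).2
    rw [partialSum] at h1
    linarith

/-- Either `τ = 1` and both sides agree, or `l 0 < 0 ≤ S_τ`. This makes the excess `S_τ - l 0`
usable as the bias of a coin. -/
theorem Stops.head_le_stoppedSum {l : ℕ → ℝ} (h : Stops l) : l 0 ≤ stoppedSum l := by
  have h1 : partialSum l 1 = l 0 := by simp [partialSum]
  rcases h.spec.1.eq_or_lt with h2 | h2
  · rw [stoppedSum, ← h2, h1]
  · have := partialSum_neg_of_lt_stopIndex le_rfl h2
    rw [h1] at this
    exact this.le.trans (stoppedSum_nonneg l)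

theorem measurable_stopIndex : Measurable stopIndex := by
  have hset : ∀ k, MeasurableSet {l : ℕ → ℝ | 1 ≤ k ∧ 0 ≤ partialSum l k} := fun k => by
    by_cases hk : 1 ≤ k
    · simpa [hk] using measurableSet_le measurable_const (measurable_partialSum k)
    · simp [hk]
  have h_set : MeasurableSet {l | Stops l} := by
    have : {l | Stops l} = ⋃ k, {l : ℕ → ℝ | 1 ≤ k ∧ 0 ≤ partialSum l k} := by
      ext l; simp [Stops]
    rw [this]
    exact MeasurableSet.iUnion hset
  refine measurable_to_countable' fun k => ?_
  -- On stopping sequences `{τ = k}` is `{τ > k - 1}` minus `{τ > k}`; the non-stopping ones all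
  -- have index `0`, a value that no stopping sequence takes.
  have : stopIndex ⁻¹' {k} =
      ({l | Stops l} ∩ ((if k = 0 then ∅ else notStopped (k - 1)) \ notStopped k)) ∪
        (if k = 0 then {l | Stops l}ᶜ else ∅) := by
    ext l
    simp only [Set.mem_preimage, Set.mem_singleton_iff, Set.mem_union, Set.mem_inter_iff,
      Set.mem_ofPred_eq, Set.mem_sdiff]
    by_cases h : Stops l
    · have := h.spec.1
      split_ifs with hk
      · simp [h, hk]; omega
      · simp only [h, h.mem_notStopped]
        simp
        omega
    · rw [stopIndex_of_not_stops h]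
      split_ifs with hk
      · simp [h, hk]
      · simp [h, Ne.symm hk]
  rw [this]
  refine (h_set.inter (MeasurableSet.diff ?_ (measurableSet_notStopped k))).union ?_
  · split_ifs
    · exact MeasurableSet.empty
    · exact measurableSet_notStopped _
  · split_ifs
    · exact h_set.compl
    · exact MeasurableSet.empty

theorem measurable_stoppedSum : Measurable stoppedSum := by
  have h : Measurable fun p : (ℕ → ℝ) × ℕ => partialSum p.1 p.2 :=
    measurable_from_prod_countable_left fun k => measurable_partialSum k
  exact h.comp (measurable_id.prodMk measurable_stopIndex)

/-! ### The law of an i.i.d. sequence. -/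

section Law

variable (ν : Measure ℝ) [IsProbabilityMeasure ν]

/-- The law of an i.i.d. sequence. -/
abbrev iidLaw : Measure (ℕ → ℝ) := Measure.infinitePi fun _ => ν

/-- Prepending an independent term of law `ν` to an i.i.d. sequence preserves its law. This one-step
decomposition is what matches the sequence with successive rounds of a loop. -/
theorem lintegral_iidLaw_shift {Φ : ℝ × (ℕ → ℝ) → ℝ≥0∞} (hΦ : Measurable Φ) :
    ∫⁻ l, Φ (l 0, fun k => l (k + 1)) ∂(iidLaw ν) = ∫⁻ v, ∫⁻ l, Φ (v, l) ∂(iidLaw ν) ∂ν := by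
  let cons : ℝ × (ℕ → ℝ) → ℕ → ℝ := fun p k => Nat.casesOn k p.1 p.2
  have hcons : Measurable cons := by
    refine measurable_pi_lambda _ fun k => ?_
    cases k with
    | zero => exact measurable_fst
    | succ k => exact (measurable_pi_apply k).comp measurable_snd
  have hmap : (ν.prod (iidLaw ν)).map cons = iidLaw ν := by
    classical
    refine Measure.eq_infinitePi _ fun s t ht => ?_
    rw [Measure.map_apply hcons (.pi s.countable_toSet fun _ _ => ht _)]
    -- Padding with `univ` turns the box over `s` into one over an initial segment, which splits
    -- into its factor at `0` and the shifted rest.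
    let t' : ℕ → Set ℝ := fun i => if i ∈ s then t i else Set.univ
    have ht' : ∀ i, MeasurableSet (t' i) := fun i => by
      by_cases h : i ∈ s
      · simpa [t', h] using ht i
      · simp [t', h]
    obtain ⟨N, hN⟩ := s.exists_nat_subset_range
    have hpre : cons ⁻¹' (Set.pi s t) =
        t' 0 ×ˢ Set.pi (Finset.range N : Set ℕ) (fun i => t' (i + 1)) := by
      ext ⟨v, l⟩
      simp only [Set.mem_preimage, Set.mem_pi, Set.mem_prod, Finset.mem_coe]
      constructor
      · intro h
        refine ⟨?_, fun i _ => ?_⟩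
        · by_cases h0 : 0 ∈ s
          · simpa [t', h0, cons] using h 0 h0
          · simp [t', h0]
        · by_cases h0 : i + 1 ∈ s
          · simpa [t', h0] using h (i + 1) h0
          · simp [t', h0]
      · rintro ⟨h0, h1⟩ i hi
        cases i with
        | zero => simpa [t', hi, cons] using h0
        | succ i =>
          have := h1 i (by have := Finset.mem_range.1 (hN hi); simp; omega)
          simpa [t', hi] using this
    rw [hpre, Measure.prod_prod, Measure.infinitePi_pi _ fun i _ => ht' (i + 1)]
    rw [mul_comm, ← Finset.prod_range_succ' fun i => ν (t' i)]
    have hsub : s ⊆ Finset.range (N + 1) := hN.trans (Finset.range_mono (by omega))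
    rw [← Finset.prod_subset hsub]
    · exact Finset.prod_congr rfl fun i hi => by simp [t', hi]
    · intro i _ hi
      simp [t', hi]
  have hm : Measurable fun l : ℕ → ℝ => Φ (l 0, fun k => l (k + 1)) := by fun_prop
  rw [← hmap, lintegral_map hm hcons, lintegral_prod _ ?_]
  · simp only [hmap]
    rfl
  · exact (hm.comp hcons).aemeasurable

variable {ν}

theorem ae_iidLaw_bound {m : ℝ} (hν : ∀ᵐ v ∂ν, |v| ≤ m) : ∀ᵐ l ∂(iidLaw ν), ∀ k, |l k| ≤ m := by
  rw [ae_all_iff]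
  intro k
  exact (measurePreserving_eval_infinitePi (fun _ : ℕ => ν) k).quasiMeasurePreserving.ae hν

end Law

/-! ### Wald's identity -/

section Wald

variable {ν : Measure ℝ} [IsProbabilityMeasure ν] {m : ℝ}

theorem integrable_eval_iidLaw (hν : ∀ᵐ v ∂ν, |v| ≤ m) (k : ℕ) :
    Integrable (fun l : ℕ → ℝ => l k) (iidLaw ν) := by
  refine Integrable.of_bound (measurable_pi_apply k).aestronglyMeasurable m ?_
  filter_upwards [ae_iidLaw_bound hν] with l hl using hl k

theorem integral_eval_iidLaw (k : ℕ) : ∫ l : ℕ → ℝ, l k ∂(iidLaw ν) = ∫ v, v ∂ν := by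
  have h := (measurePreserving_eval_infinitePi (fun _ : ℕ => ν) k)
  have h2 := integral_map (μ := iidLaw ν) h.measurable.aemeasurable
    (f := fun v : ℝ => v) (by fun_prop)
  rw [h.map_eq] at h2
  exact h2.symm

/-- `{τ > k}` depends on the terms before `l k` only, so the expectation of the product factorizes.
-/
theorem integral_notStopped_mul (k : ℕ) :
    ∫ l, (notStopped k).indicator 1 l * l k ∂(iidLaw ν) =
      (iidLaw ν).real (notStopped k) * ∫ v, v ∂ν := by
  classical
  -- Extending the first `k` terms by zeros exhibits the indicator as a function of those terms
  -- alone.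
  let ext : (↥(Finset.range k) → ℝ) → ℕ → ℝ := fun g i =>
    if h : i ∈ Finset.range k then g ⟨i, h⟩ else 0
  have hext : Measurable ext := by
    refine measurable_pi_lambda _ fun i => ?_
    by_cases h : i ∈ Finset.range k
    · simp only [ext, h, dite_true]
      exact measurable_pi_apply (⟨i, h⟩ : ↥(Finset.range k))
    · simp only [ext, h, dite_false]
      exact measurable_const
  have hm : Measurable ((notStopped k).indicator (1 : (ℕ → ℝ) → ℝ)) :=
    measurable_one.indicator (measurableSet_notStopped k)
  have hind : iIndepFun (fun (i : ℕ) (l : ℕ → ℝ) => l i) (iidLaw ν) :=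
    iIndepFun_infinitePi (X := fun _ v => v) (by fun_prop)
  have h1 : IndepFun (((notStopped k).indicator (1 : (ℕ → ℝ) → ℝ) ∘ ext) ∘
      (fun (a : ℕ → ℝ) (i : ↥(Finset.range k)) => a i)) (fun l => l k) (iidLaw ν) :=
    (hind.indepFun_finset (Finset.range k) {k} (by simp) (by fun_prop)).comp
    (hm.comp hext) (measurable_pi_apply (⟨k, by simp⟩ : ↥({k} : Finset ℕ)))
  have h2 : ((notStopped k).indicator (1 : (ℕ → ℝ) → ℝ) ∘ ext) ∘
      (fun (a : ℕ → ℝ) (i : ↥(Finset.range k)) => a i) = (notStopped k).indicator 1 := by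
    funext l
    have : ext (fun i : ↥(Finset.range k) => l i) ∈ notStopped k ↔ l ∈ notStopped k :=
      mem_notStopped_congr fun i hi => by simp [ext, hi]
    simp only [Function.comp, Set.indicator, this]
    rfl
  rw [h2] at h1
  have h3 := h1.integral_fun_mul_eq_mul_integral hm.aestronglyMeasurable
    (measurable_pi_apply k).aestronglyMeasurable
  rw [integral_indicator_one (measurableSet_notStopped k)] at h3
  rw [← integral_eval_iidLaw (ν := ν) k]
  exact h3

/-- `S_{min(τ, k)}`. -/
def truncatedSum (k : ℕ) (l : ℕ → ℝ) : ℝ :=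
  ∑ j ∈ Finset.range k, (notStopped j).indicator 1 l * l j

/-- Before stopping, the sum is nonpositive and one more term adds at most `m`; after stopping it is
frozen. The first conjunct carries the induction. -/
theorem truncatedSum_le {l : ℕ → ℝ} (hm : 0 ≤ m) (hl : ∀ k, |l k| ≤ m) (k : ℕ) :
    (l ∈ notStopped k → truncatedSum k l = partialSum l k) ∧ truncatedSum k l ≤ m := by
  induction k with
  | zero => simp [truncatedSum, partialSum, hm]
  | succ k ih =>
    have hs : truncatedSum (k + 1) l = truncatedSum k l + (notStopped k).indicator 1 l * l k :=
      Finset.sum_range_succ _ _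
    have hp : partialSum l (k + 1) = partialSum l k + l k := Finset.sum_range_succ _ _
    by_cases h : l ∈ notStopped k
    · have h1 : truncatedSum (k + 1) l = partialSum l (k + 1) := by
        rw [hs, hp, ih.1 h]; simp [h]
      refine ⟨fun _ => h1, ?_⟩
      rw [h1, hp]
      have := partialSum_nonpos_of_notStopped h
      linarith [(abs_le.1 (hl k)).2]
    · refine ⟨fun h' => absurd (fun j h1 h2 => h' j h1 (by omega)) h, ?_⟩
      rw [hs]
      simpa [h] using ih.2

theorem integrable_notStopped_mul (hν : ∀ᵐ v ∂ν, |v| ≤ m) (k : ℕ) :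
    Integrable (fun l => (notStopped k).indicator 1 l * l k) (iidLaw ν) := by
  have : (fun l : ℕ → ℝ => (notStopped k).indicator 1 l * l k) =
      (notStopped k).indicator fun l => l k := by
    funext l
    by_cases h : l ∈ notStopped k <;> simp [h]
  rw [this]
  exact (integrable_eval_iidLaw hν k).indicator (measurableSet_notStopped k)

theorem bound_nonneg (hν : ∀ᵐ v ∂ν, |v| ≤ m) : 0 ≤ m := by
  obtain ⟨v, hv⟩ := hν.exists
  exact (abs_nonneg v).trans hv

/-- Taking means in `S_{min(τ, k)} ≤ m` gives `(∑_{j<k} P(τ > j)) · E Λ ≤ m`, a bound uniform in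
`k`. -/
theorem summable_notStopped (hν : ∀ᵐ v ∂ν, |v| ≤ m) (hpos : 0 < ∫ v, v ∂ν) :
    Summable fun k => (iidLaw ν).real (notStopped k) := by
  refine summable_of_sum_range_le (c := m / ∫ v, v ∂ν) (fun _ => measureReal_nonneg) fun k => ?_
  rw [le_div_iff₀ hpos, Finset.sum_mul]
  have h1 : ∫ l, truncatedSum k l ∂(iidLaw ν) =
      ∑ j ∈ Finset.range k, (iidLaw ν).real (notStopped j) * ∫ v, v ∂ν := by
    simp only [truncatedSum]
    rw [integral_finsetSum _ fun j _ => integrable_notStopped_mul hν j]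
    exact Finset.sum_congr rfl fun j _ => integral_notStopped_mul j
  rw [← h1]
  calc ∫ l, truncatedSum k l ∂(iidLaw ν) ≤ ∫ _, m ∂(iidLaw ν) := by
        refine integral_mono_ae (integrable_finsetSum _ fun j _ => integrable_notStopped_mul hν j)
          (integrable_const _) ?_
        filter_upwards [ae_iidLaw_bound hν] with l hl
        exact (truncatedSum_le (bound_nonneg hν) hl k).2
    _ = m := by simp

theorem ae_stops (hν : ∀ᵐ v ∂ν, |v| ≤ m) (hpos : 0 < ∫ v, v ∂ν) :
    ∀ᵐ l ∂(iidLaw ν), Stops l := by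
  have h0 := (summable_notStopped hν hpos).tendsto_atTop_zero
  have hz : (iidLaw ν).real {l | ¬ Stops l} = 0 := by
    refine le_antisymm (ge_of_tendsto' h0 fun k => ?_) measureReal_nonneg
    refine measureReal_mono fun l hl j h1 _ => ?_
    by_contra h
    exact hl ⟨j, h1, not_lt.1 h⟩
  rw [ae_iff]
  rwa [measureReal_eq_zero_iff] at hz

/-- Almost surely `τ = ∑_k 1{k < τ}`; the summability of `P(τ > k)` permits integration term by
term. -/
theorem hasSum_integral_stopIndex (hν : ∀ᵐ v ∂ν, |v| ≤ m) (hpos : 0 < ∫ v, v ∂ν) :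
    HasSum (fun k => (iidLaw ν).real (notStopped k)) (∫ l, (stopIndex l : ℝ) ∂(iidLaw ν)) := by
  have h := hasSum_integral_of_summable_integral_norm (μ := iidLaw ν)
    (F := fun k => (notStopped k).indicator (1 : (ℕ → ℝ) → ℝ))
    (fun k => (integrable_const (1 : ℝ)).indicator (measurableSet_notStopped k)) (by
      refine (summable_notStopped hν hpos).congr fun k => ?_
      rw [← integral_indicator_one (measurableSet_notStopped k)]
      refine integral_congr_ae (Filter.Eventually.of_forall fun l => ?_)
      by_cases h : l ∈ notStopped k <;> simp [h])
  simp only [integral_indicator_one (measurableSet_notStopped _)] at h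
  have hτ : ∫ l, (stopIndex l : ℝ) ∂(iidLaw ν) =
      ∫ l, ∑' k, (notStopped k).indicator (1 : (ℕ → ℝ) → ℝ) l ∂(iidLaw ν) := ?_
  · rwa [hτ]
  refine integral_congr_ae ?_
  filter_upwards [ae_stops hν hpos] with l hl
  rw [tsum_eq_sum (s := Finset.range (stopIndex l))]
  · rw [Finset.sum_congr rfl fun k hk => Set.indicator_of_mem
      ((hl.mem_notStopped k).2 (Finset.mem_range.1 hk)) _]
    simp
  · intro k hk
    exact Set.indicator_of_notMem (fun h => hk (Finset.mem_range.2 ((hl.mem_notStopped k).1 h))) _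

/-- Wald's identity: write `S_τ = ∑_k 1{τ > k} l k`, integrate term by term (the norms are dominated
by `m P(τ > k)`), and factor each term by independence. -/
theorem integral_stoppedSum (hν : ∀ᵐ v ∂ν, |v| ≤ m) (hpos : 0 < ∫ v, v ∂ν) :
    ∫ l, stoppedSum l ∂(iidLaw ν) =
    (∫ l, (stopIndex l : ℝ) ∂(iidLaw ν)) * ∫ v, v ∂ν := by
  have hm := bound_nonneg hν
  have h := hasSum_integral_of_summable_integral_norm (μ := iidLaw ν)
    (F := fun k l => (notStopped k).indicator 1 l * l k)
    (fun k => integrable_notStopped_mul hν k) (by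
      refine Summable.of_nonneg_of_le (fun k => integral_nonneg fun l => norm_nonneg _) (fun k => ?_)
        ((summable_notStopped hν hpos).mul_left m)
      rw [← integral_indicator_one (measurableSet_notStopped k), ← integral_const_mul]
      refine integral_mono_ae (integrable_notStopped_mul hν k).norm
        (((integrable_const (1 : ℝ)).indicator (measurableSet_notStopped k)).const_mul m) ?_
      filter_upwards [ae_iidLaw_bound hν] with l hl
      by_cases h : l ∈ notStopped k
      · simpa [h] using hl k
      · simp [h])
  simp only [integral_notStopped_mul] at h
  have h2 := (hasSum_integral_stopIndex hν hpos).mul_right (∫ v, v ∂ν)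
  rw [← h.unique h2]
  refine integral_congr_ae ?_
  filter_upwards [ae_stops hν hpos] with l hl
  rw [tsum_eq_sum (s := Finset.range (stopIndex l))]
  · rw [stoppedSum, partialSum]
    refine Finset.sum_congr rfl fun k hk => ?_
    rw [Set.indicator_of_mem ((hl.mem_notStopped k).2 (Finset.mem_range.1 hk))]
    simp
  · intro k hk
    rw [Set.indicator_of_notMem
      (fun h => hk (Finset.mem_range.2 ((hl.mem_notStopped k).1 h))), zero_mul]

theorem one_le_integral_stopIndex (hν : ∀ᵐ v ∂ν, |v| ≤ m) (hpos : 0 < ∫ v, v ∂ν) :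
    1 ≤ ∫ l, (stopIndex l : ℝ) ∂(iidLaw ν) := by
  have h := (hasSum_integral_stopIndex hν hpos).summable.le_tsum 0
    fun _ _ => measureReal_nonneg
  rw [(hasSum_integral_stopIndex hν hpos).tsum_eq] at h
  have h0 : notStopped 0 = Set.univ := by
    ext l; simp only [notStopped, Set.mem_ofPred_eq, Set.mem_univ, iff_true]; intro j; omega
  simpa [h0] using h

theorem integrable_stopIndex (hν : ∀ᵐ v ∂ν, |v| ≤ m) (hpos : 0 < ∫ v, v ∂ν) :
    Integrable (fun l => (stopIndex l : ℝ)) (iidLaw ν) := by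
  -- A non-integrable function has Bochner integral zero by convention, which contradicts the lower
  -- bound one.
  by_contra h
  have := one_le_integral_stopIndex hν hpos
  rw [integral_undef h] at this
  norm_num at this

theorem integrable_stoppedSum (hν : ∀ᵐ v ∂ν, |v| ≤ m) : Integrable stoppedSum (iidLaw ν) := by
  refine Integrable.of_bound measurable_stoppedSum.aestronglyMeasurable m ?_
  filter_upwards [ae_iidLaw_bound hν] with l hl
  rw [Real.norm_eq_abs, abs_of_nonneg (stoppedSum_nonneg l)]
  exact stoppedSum_le (bound_nonneg hν) hl

theorem mean_le_integral_stoppedSum (hν : ∀ᵐ v ∂ν, |v| ≤ m) (hpos : 0 < ∫ v, v ∂ν) :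
    ∫ v, v ∂ν ≤ ∫ l, stoppedSum l ∂(iidLaw ν) := by
  rw [integral_stoppedSum hν hpos]
  exact le_mul_of_one_le_left hpos.le (one_le_integral_stopIndex hν hpos)

end Wald

/-! ### Sampling the stopped sum -/

section Stopped

variable {d : ℕ}

/-- On the states with base registers `r₀`, `f` depends on the registers below `N` only. -/
def Low (r₀ : ℕ → ℝ) (N : ℕ) (f : State d → ℝ≥0∞) : Prop :=
  ∀ s t : State d, Agree (d + 4) s.1 r₀ → Agree N s.1 t.1 → f s = f t

theorem Low.mono {r₀ : ℕ → ℝ} {N M : ℕ} {f : State d → ℝ≥0∞} (h : Low r₀ N f) (hNM : N ≤ M) :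
    Low r₀ M f :=
  fun s t hs hst => h s t hs (hst.mono hNM)

theorem wp_of_runsTo (Q : Measure (ℕ → E d)) [IsProbabilityMeasure Q] {c : Cmd d} {s : State d}
    {P : State d → Prop} (h : RunsTo c s P) {f : State d → ℝ≥0∞} (hf : Measurable f) (v : ℝ≥0∞)
    (hv : ∀ t, P t → f t = v) : wp Q c f s = v := by
  obtain ⟨t, ht, h⟩ := h
  rw [h Q f hf, hv t ht]

/-- Draws a copy of the random vector and computes `Λ_n(x)` in the register `d + 14`. -/
def sampleCmd (d : ℕ) : Cmd d := .seq .draw (levelSumCmd d)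

/-- The base registers `r₀` hold the input and the bound `m`, and `sampleCmd` samples from `ν`. -/
structure Samples (Q : Measure (ℕ → E d)) [IsProbabilityMeasure Q] (r₀ : ℕ → ℝ) (ν : Measure ℝ) :
    Prop where
  bound : ∀ᵐ v ∂ν, |v| ≤ r₀ (d + 3)
  delta_pos : 0 < r₀ 1
  delta_le_mean : r₀ 1 / 2 ≤ ∫ v, v ∂ν
  delta_le_bound : r₀ 1 ≤ r₀ (d + 3)
  wp_sample : ∀ s : State d, Agree (d + 4) s.1 r₀ → ∀ f : State d → ℝ≥0∞, Measurable f →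
    (∀ t u : State d, Agree (d + 14) t.1 s.1 → Agree (d + 15) t.1 u.1 → f t = f u) →
      wp Q (sampleCmd d) f s = ∫⁻ v, f (Function.update s.1 (d + 14) v, s.2) ∂ν

theorem Samples.mean_pos {Q : Measure (ℕ → E d)} [IsProbabilityMeasure Q] {r₀ : ℕ → ℝ}
    {ν : Measure ℝ} (h : Samples Q r₀ ν) : 0 < ∫ v, v ∂ν := by
  linarith [h.delta_pos, h.delta_le_mean]

theorem Samples.bound_pos {Q : Measure (ℕ → E d)} [IsProbabilityMeasure Q] {r₀ : ℕ → ℝ}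
    {ν : Measure ℝ} (h : Samples Q r₀ ν) : 0 < r₀ (d + 3) :=
  h.delta_pos.trans_le h.delta_le_bound

/-- `f` is bounded on the states with base registers `r₀`. -/
def BoundedOn (r₀ : ℕ → ℝ) (f : State d → ℝ≥0∞) : Prop :=
  ∃ M : ℝ≥0∞, M ≠ ∞ ∧ ∀ s : State d, Agree (d + 4) s.1 r₀ → f s ≤ M

open Classical in
/-- The value of `F` at the first partial sum of `a + l 0, a + l 0 + l 1, …` that is nonnegative
(zero if there is none). -/
def firstValue (F : ℝ → ℝ≥0∞) (a : ℝ) (l : ℕ → ℝ) : ℝ≥0∞ :=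
  ∑' k : ℕ,
    if 0 ≤ a + partialSum l (k + 1) ∧ ∀ j < k, a + partialSum l (j + 1) < 0 then
      F (a + partialSum l (k + 1)) else 0

theorem partialSum_succ' (l : ℕ → ℝ) (k : ℕ) :
    partialSum l (k + 1) = l 0 + partialSum (fun j => l (j + 1)) k := by
  rw [partialSum, Finset.sum_range_succ', add_comm]
  rfl

open Classical in
-- The recursion along the first step. The starting value `a` is there because the sampling loop
-- resumes from an arbitrary negative partial sum.
theorem firstValue_eq (F : ℝ → ℝ≥0∞) (a : ℝ) (l : ℕ → ℝ) :
    firstValue F a l =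
      if a + l 0 < 0 then firstValue F (a + l 0) (fun k => l (k + 1)) else F (a + l 0) := by
  have h1 : ∀ (l : ℕ → ℝ), partialSum l 0 = 0 := fun l => by simp [partialSum]
  have hcond : ∀ k : ℕ, (∀ j < k + 1, a + partialSum l (j + 1) < 0) ↔
      (a + l 0 < 0 ∧ ∀ j < k, a + l 0 + partialSum (fun i => l (i + 1)) (j + 1) < 0) := by
    intro k
    rw [Nat.forall_lt_succ_left']
    simp only [partialSum_succ' l, h1, add_zero, ← add_assoc]
  rw [firstValue, tsum_eq_zero_add' ENNReal.summable]
  simp only [hcond]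
  rw [partialSum_succ' l 0, h1]
  split_ifs with h2 h3 h3
  · simp at h2; linarith
  · simp [h3]
  · rw [zero_add, firstValue]
    refine tsum_congr fun k => ?_
    rw [partialSum_succ' l (k + 1), ← add_assoc]
    simp [h3]
  · simp at h2; linarith

theorem firstValue_le {F : ℝ → ℝ≥0∞} {M : ℝ≥0∞} (hF : ∀ v, F v ≤ M) (a : ℝ) (l : ℕ → ℝ) :
    firstValue F a l ≤ M := by
  classical
  by_cases h : ∃ k, 0 ≤ a + partialSum l (k + 1)
  · rw [firstValue, tsum_eq_single (Nat.find h)]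
    · split_ifs
      · exact hF _
      · exact zero_le
    · intro k hk
      rw [if_neg]
      rintro ⟨h1, h2⟩
      rcases lt_or_gt_of_ne hk with hlt | hgt
      · exact Nat.find_min h hlt h1
      · exact (h2 _ hgt).not_ge (Nat.find_spec h)
  · rw [firstValue]
    have : ∀ k, ¬ (0 ≤ a + partialSum l (k + 1) ∧ ∀ j < k, a + partialSum l (j + 1) < 0) :=
      fun k hk => h ⟨k, hk.1⟩
    simp [this]

theorem firstValue_zero_of_stops (F : ℝ → ℝ≥0∞) {l : ℕ → ℝ} (h : Stops l) :
    firstValue F 0 l = F (stoppedSum l) := by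
  classical
  obtain ⟨t, ht⟩ : ∃ t, stopIndex l = t + 1 := ⟨stopIndex l - 1, by have := h.spec.1; omega⟩
  have h0 := h.spec.2
  rw [ht] at h0
  rw [firstValue, tsum_eq_single t]
  · rw [if_pos, stoppedSum, ht, zero_add]
    refine ⟨by simpa using h0, fun j hj => ?_⟩
    simpa using partialSum_neg_of_lt_stopIndex (l := l) (j := j + 1) (by omega) (by omega)
  · intro k hk
    rw [if_neg]
    simp only [zero_add]
    rintro ⟨h1, h2⟩
    rcases lt_or_gt_of_ne hk with hlt | hgt
    · exact (partialSum_neg_of_lt_stopIndex (l := l) (j := k + 1) (by omega) (by omega)).not_ge h1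
    · exact (h2 _ hgt).not_ge h0

theorem measurable_firstValue {β : Type*} [MeasurableSpace β] {F : β × ℝ → ℝ≥0∞}
    (hF : Measurable F) {a : β → ℝ} (ha : Measurable a) :
    Measurable fun p : β × (ℕ → ℝ) => firstValue (fun v => F (p.1, v)) (a p.1) p.2 := by
  classical
  unfold firstValue
  refine Measurable.tsum fun k => ?_
  have hS : ∀ j, Measurable fun p : β × (ℕ → ℝ) => a p.1 + partialSum p.2 j := fun j =>
    (ha.comp measurable_fst).add ((measurable_partialSum j).comp measurable_snd)
  refine Measurable.ite ?_ (hF.comp (measurable_fst.prodMk (hS _))) measurable_const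
  refine (measurableSet_le measurable_const (hS _)).inter ?_
  have hset : {p : β × (ℕ → ℝ) | ∀ j < k, a p.1 + partialSum p.2 (j + 1) < 0} =
      ⋂ j : ℕ, ⋂ _ : j < k, {p | a p.1 + partialSum p.2 (j + 1) < 0} := by
    ext p; simp
  change MeasurableSet {p : β × (ℕ → ℝ) | ∀ j < k, a p.1 + partialSum p.2 (j + 1) < 0}
  rw [hset]
  exact MeasurableSet.iInter fun j => MeasurableSet.iInter fun _ =>
    measurableSet_lt (hS _) measurable_const

/-- Stores `S_τ` in the register `d + 10`, and the first summand in `d + 11`. -/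
def stoppedSumCmd (d : ℕ) : Cmd d :=
  .seq (sampleCmd d)
    (.seq (.assign (d + 11) (.reg (d + 14)))
    (.seq (.assign (d + 10) (.reg (d + 14)))
    (.loop (.reg (d + 10)) (.const 0)
      (.seq (sampleCmd d) (.assign (d + 10) (.add (.reg (d + 10)) (.reg (d + 14))))))))

variable {Q : Measure (ℕ → E d)} [IsProbabilityMeasure Q] {r₀ : ℕ → ℝ} {ν : Measure ℝ}
  [IsProbabilityMeasure ν]

theorem measurable_update_reg (i : ℕ) :
    Measurable fun p : State d × ℝ => ((Function.update p.1.1 i p.2, p.1.2) : State d) :=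
  measurable_uniform_update d i

theorem measurableSet_agree (N : ℕ) (r₀ : ℕ → ℝ) :
    MeasurableSet {s : State d | Agree N s.1 r₀} := by
  have : {s : State d | Agree N s.1 r₀} = ⋂ i : ℕ, ⋂ _ : i < N, {s | s.1 i = r₀ i} := by
    ext s; simp [Agree]
  rw [this]
  exact MeasurableSet.iInter fun i => MeasurableSet.iInter fun _ =>
    measurableSet_eq_fun ((measurable_pi_apply i).comp measurable_fst) measurable_const

theorem Low.update_congr {N : ℕ} {f : State d → ℝ≥0∞} (h : Low r₀ N f) {r r' : ℕ → ℝ}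
    (hb : Agree (d + 4) r r₀) {y y' : ℕ → E d} {i : ℕ} (hi : d + 4 ≤ i) (v : ℝ)
    (hr : ∀ j < N, j ≠ i → r j = r' j) :
    f (Function.update r i v, y) = f (Function.update r' i v, y') := by
  refine h _ _ (hb.update hi v) fun j hj => ?_
  by_cases hji : j = i
  · subst hji; simp
  · simp only [Function.update_of_ne hji]
    exact hr j hj hji

open Classical in
/-- The harmonic function for the loop of `stoppedSumCmd`. -/
def stoppedValue (ν : Measure ℝ) [IsProbabilityMeasure ν] (f : State d → ℝ≥0∞) (s : State d) :
    ℝ≥0∞ :=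
  if s.1 (d + 10) < 0 then
    ∫⁻ l, firstValue (fun v => f (Function.update s.1 (d + 10) v, s.2)) (s.1 (d + 10)) l ∂(iidLaw ν)
    else f s

theorem measurable_stoppedValue {f : State d → ℝ≥0∞} (hf : Measurable f) :
    Measurable (stoppedValue ν f) := by
  classical
  have hreg : Measurable fun s : State d => s.1 (d + 10) :=
    (measurable_pi_apply _).comp measurable_fst
  refine Measurable.ite (measurableSet_lt hreg measurable_const) ?_ hf
  exact (measurable_firstValue (hf.comp (measurable_update_reg (d + 10))) hreg).lintegral_prod_right'

theorem low_stoppedValue {N : ℕ} (hN : d + 11 ≤ N) {f : State d → ℝ≥0∞} (hf : Low r₀ N f) :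
    Low r₀ N (stoppedValue ν f) := by
  intro s t hs hst
  have h10 : s.1 (d + 10) = t.1 (d + 10) := hst _ (by omega)
  simp only [stoppedValue, h10, hf s t hs hst]
  congr 1
  have : (fun v => f (Function.update s.1 (d + 10) v, s.2)) =
      fun v => f (Function.update t.1 (d + 10) v, t.2) :=
    funext fun v => hf.update_congr hs (by omega) _ fun j hj _ => hst j hj
  rw [this]

open Classical in
/-- `V` for the loop of `stoppedSumCmd`: the distance of `S` from its maximum. -/
def stoppedRank (r₀ : ℕ → ℝ) (s : State d) : ℝ≥0∞ :=
  if Agree (d + 4) s.1 r₀ then ENNReal.ofReal (r₀ (d + 3) - s.1 (d + 10)) else ∞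

theorem measurable_stoppedRank (r₀ : ℕ → ℝ) : Measurable (stoppedRank (d := d) r₀) := by
  classical
  refine Measurable.ite (measurableSet_agree _ _) ?_ measurable_const
  exact (measurable_const.sub ((measurable_pi_apply _).comp measurable_fst)).ennreal_ofReal

theorem low_stoppedRank (r₀ : ℕ → ℝ) : Low r₀ (d + 11) (stoppedRank (d := d) r₀) := by
  intro s t _ hst
  have h1 : Agree (d + 4) s.1 r₀ ↔ Agree (d + 4) t.1 r₀ :=
    ⟨fun h => (hst.mono (by omega)).symm.trans h, fun h => (hst.mono (by omega)).trans h⟩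
  simp only [stoppedRank, hst (d + 10) (by omega)]
  split_ifs <;> first | rfl | tauto

theorem stoppedRank_ne_top {s : State d} :
    stoppedRank r₀ s ≠ ∞ ↔ Agree (d + 4) s.1 r₀ := by
  simp only [stoppedRank]
  split_ifs with h <;> simp [h]

theorem wp_stoppedBody (hS : Samples Q r₀ ν) {s : State d} (hs : Agree (d + 4) s.1 r₀)
    {f : State d → ℝ≥0∞} (hf : Measurable f) (hlow : Low r₀ (d + 14) f) :
    wp Q (.seq (sampleCmd d) (.assign (d + 10) (.add (.reg (d + 10)) (.reg (d + 14))))) f s =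
      ∫⁻ v, f (Function.update s.1 (d + 10) (s.1 (d + 10) + v), s.2) ∂ν := by
  have hm := measurable_wp Q (.assign (d + 10) (.add (.reg (d + 10)) (.reg (d + 14)))) hf
  rw [wp_seq Q hf, hS.wp_sample s hs _ hm]
  · refine lintegral_congr fun v => ?_
    rw [wp_assign Q hf]
    simp only [Expr.eval]
    rw [Function.update_self, Function.update_of_ne (by omega)]
    refine hlow.update_congr (hs.update (by omega) _) (by omega) _ fun j hj _ => ?_
    rw [Function.update_of_ne (by omega)]
  · intro s t hs' hst
    replace hs := (hs'.mono (by omega)).trans hs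
    rw [wp_assign Q hf, wp_assign Q hf]
    simp only [Expr.eval, hst (d + 10) (by omega), hst (d + 14) (by omega)]
    exact hlow.update_congr hs (by omega) _ fun j hj _ => hst j (by omega)

theorem mean_le_bound {m : ℝ} (hν : ∀ᵐ v ∂ν, |v| ≤ m) : ∫ v, v ∂ν ≤ m := by
  have hint : Integrable (fun v : ℝ => v) ν :=
    Integrable.of_bound (by fun_prop) m hν
  calc ∫ v, v ∂ν ≤ ∫ _, m ∂ν := by
        refine integral_mono_ae hint (integrable_const _) ?_
        filter_upwards [hν] with v hv using (abs_le.1 hv).2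
    _ = m := by simp

/-- The rank `m - S` drops in mean by `E Λ > 0` per round. The harmonic function is the mean of `f`
at the first nonnegative sum, and its one-step equation is `firstValue_eq` integrated with
`lintegral_iidLaw_shift`. -/
theorem wp_stoppedLoop (hS : Samples Q r₀ ν) {s : State d} (hs : Agree (d + 4) s.1 r₀)
    {f : State d → ℝ≥0∞} (hf : Measurable f) (hlow : Low r₀ (d + 12) f) (hbd : BoundedOn r₀ f) :
    wp Q (.loop (.reg (d + 10)) (.const 0)
      (.seq (sampleCmd d) (.assign (d + 10) (.add (.reg (d + 10)) (.reg (d + 14)))))) f s =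
      stoppedValue ν f s := by
  classical
  obtain ⟨M, hM, hfM⟩ := hbd
  have hupd : ∀ {s : State d}, Agree (d + 4) s.1 r₀ → ∀ v,
      Agree (d + 4) (Function.update s.1 (d + 10) v) r₀ := fun h v => h.update (by omega) v
  have hint : Integrable (fun v : ℝ => v) ν :=
    Integrable.of_bound (by fun_prop) _ hS.bound
  refine wp_loop_eq Q hf (h := stoppedValue ν f) (measurable_stoppedRank r₀)
    (c := ENNReal.ofReal (∫ v, v ∂ν)) (M := M) ?_ ENNReal.ofReal_ne_top hM ?_ ?_ ?_ ?_ s ?_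
  · simpa using hS.mean_pos
  · intro s hs ht
    rw [stoppedRank_ne_top] at hs
    have ht' : s.1 (d + 10) < 0 := by simpa [Expr.eval] using ht
    constructor
    · rw [wp_stoppedBody hS hs measurable_const fun _ _ _ _ => rfl]
      simp
    · rw [wp_stoppedBody hS hs (measurable_stoppedRank r₀) ((low_stoppedRank r₀).mono (by omega))]
      simp only [stoppedRank, hupd hs, hs, if_true, Function.update_self, ← sub_sub]
      have hi : Integrable (fun v => r₀ (d + 3) - s.1 (d + 10) - v) ν :=
        (integrable_const _).sub hint
      rw [← ofReal_integral_eq_lintegral_ofReal hi]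
      · have := mean_le_bound hS.bound
        rw [integral_sub (integrable_const _) hint, ← ENNReal.ofReal_add _ hS.mean_pos.le]
        · simp
        · simp only [integral_const, probReal_univ, smul_eq_mul, one_mul]
          linarith
      -- Inside the loop `S < 0` and `v ≤ m`, so `m - S - v ≥ 0` and `ENNReal.ofReal` truncates
      -- nothing.
      · filter_upwards [hS.bound] with v hv
        have := (abs_le.1 hv).2
        simp only [Pi.zero_apply]
        linarith
  · intro s hs
    rw [stoppedRank_ne_top] at hs
    simp only [stoppedValue]
    split_ifs
    · calc _ ≤ ∫⁻ _, M ∂(iidLaw ν) :=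
            lintegral_mono fun l => firstValue_le (fun v => hfM _ (hupd hs v)) _ _
        _ = M := by simp
    · exact hfM s hs
  · intro s hs ht
    rw [stoppedRank_ne_top] at hs
    have ht' : s.1 (d + 10) < 0 := by simpa [Expr.eval] using ht
    rw [wp_stoppedBody hS hs (measurable_stoppedValue hf)
      (low_stoppedValue (by omega) (hlow.mono (by omega)))]
    conv_rhs => rw [stoppedValue, if_pos ht']
    simp only [firstValue_eq _ (s.1 (d + 10))]
    have hΦ : Measurable fun p : ℝ × (ℕ → ℝ) => if s.1 (d + 10) + p.1 < 0 then
        firstValue (fun v => f (Function.update s.1 (d + 10) v, s.2)) (s.1 (d + 10) + p.1) p.2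
        else f (Function.update s.1 (d + 10) (s.1 (d + 10) + p.1), s.2) := by
      have hu : Measurable fun v : ℝ => f (Function.update s.1 (d + 10) v, s.2) :=
        hf.comp ((measurable_update_reg (d + 10)).comp (measurable_const.prodMk measurable_id))
      refine Measurable.ite (measurableSet_lt (by fun_prop) measurable_const) ?_ (by fun_prop)
      exact measurable_firstValue (F := fun p : ℝ × ℝ => f (Function.update s.1 (d + 10) p.2, s.2))
        (hu.comp measurable_snd) (by fun_prop)
    rw [lintegral_iidLaw_shift ν hΦ]
    refine lintegral_congr fun v => ?_
    simp only [stoppedValue, Function.update_self, Function.update_idem]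
    split_ifs with h
    · rfl
    · simp
  · intro s hs ht
    have ht' : ¬ s.1 (d + 10) < 0 := by simpa [Expr.eval] using ht
    simp [stoppedValue, ht']
  · exact stoppedRank_ne_top.2 hs

theorem wp_stoppedSumCmd (hS : Samples Q r₀ ν) {s : State d} (hs : Agree (d + 4) s.1 r₀)
    {f : State d → ℝ≥0∞} (hf : Measurable f) (hlow : Low r₀ (d + 12) f) (hbd : BoundedOn r₀ f) :
    wp Q (stoppedSumCmd d) f s = ∫⁻ l, f (Function.update (Function.update s.1 (d + 11) (l 0))
      (d + 10) (stoppedSum l), s.2) ∂(iidLaw ν) := by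
  set loop : Cmd d := .loop (.reg (d + 10)) (.const 0)
      (.seq (sampleCmd d) (.assign (d + 10) (.add (.reg (d + 10)) (.reg (d + 14))))) with hloop
  have hm := measurable_wp Q loop hf
  have hm1 := measurable_wp Q (.assign (d + 10) (.reg (d + 14))) hm
  have hm2 := measurable_wp Q (.assign (d + 11) (.reg (d + 14))) hm1
  have key : ∀ t : State d, Agree (d + 4) t.1 r₀ →
      wp Q (.assign (d + 11) (.reg (d + 14))) (wp Q (.assign (d + 10) (.reg (d + 14)))
        (wp Q loop f)) t = stoppedValue ν f (Function.update (Function.update t.1 (d + 11)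
          (t.1 (d + 14))) (d + 10) (t.1 (d + 14)), t.2) := by
    intro t ht
    rw [wp_assign Q hm1, wp_assign Q hm, hloop,
      wp_stoppedLoop hS ((ht.update (by omega) _).update (by omega) _) hf hlow hbd]
    simp [Expr.eval]
  rw [stoppedSumCmd, wp_seq Q hf]
  have hfun : wp Q (.seq (.assign (d + 11) (.reg (d + 14)))
      (.seq (.assign (d + 10) (.reg (d + 14))) loop)) f =
      wp Q (.assign (d + 11) (.reg (d + 14))) (wp Q (.assign (d + 10) (.reg (d + 14)))
        (wp Q loop f)) := by
    funext t
    rw [wp_seq Q hf]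
    congr 1
    funext t
    rw [wp_seq Q hf]
  rw [hfun, hS.wp_sample s hs _ hm2]
  · have hΦ : Measurable fun p : ℝ × (ℕ → ℝ) => if p.1 < 0 then
        firstValue (fun v => f (Function.update (Function.update s.1 (d + 11) p.1) (d + 10) v, s.2))
          p.1 p.2
        else f (Function.update (Function.update s.1 (d + 11) p.1) (d + 10) p.1, s.2) := by
      have h1 : Measurable fun q : ℝ × ℝ =>
          f (Function.update (Function.update s.1 (d + 11) q.1) (d + 10) q.2, s.2) := by
        refine hf.comp (Measurable.prodMk ?_ measurable_const)
        exact measurable_store _ (measurable_store _ measurable_const measurable_fst) measurable_snd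
      refine Measurable.ite (measurableSet_lt measurable_fst measurable_const)
        (measurable_firstValue h1 measurable_id)
        (h1.comp (measurable_fst.prodMk measurable_fst))
    -- The sample drawn ahead of the loop is the first step of the walk from `0`; almost sure
    -- stopping identifies `firstValue` with the value at `S_τ`.
    have hstep : ∀ᵐ l ∂(iidLaw ν),
        f (Function.update (Function.update s.1 (d + 11) (l 0)) (d + 10) (stoppedSum l), s.2) =
        (fun p : ℝ × (ℕ → ℝ) => if p.1 < 0 then
        firstValue (fun v => f (Function.update (Function.update s.1 (d + 11) p.1) (d + 10) v, s.2))
          p.1 p.2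
        else f (Function.update (Function.update s.1 (d + 11) p.1) (d + 10) p.1, s.2))
          (l 0, fun k => l (k + 1)) := by
      filter_upwards [ae_stops hS.bound hS.mean_pos] with l hl
      rw [← firstValue_zero_of_stops
        (fun v => f (Function.update (Function.update s.1 (d + 11) (l 0)) (d + 10) v, s.2)) hl,
        firstValue_eq]
      simp
    rw [lintegral_congr_ae hstep, lintegral_iidLaw_shift ν hΦ]
    refine lintegral_congr fun v => ?_
    rw [key _ (hs.update (by omega) _)]
    have hag : ∀ w, f (Function.update (Function.update (Function.update s.1 (d + 14) v) (d + 11) v)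
        (d + 10) w, s.2) = f (Function.update (Function.update s.1 (d + 11) v) (d + 10) w, s.2) := by
      intro w
      refine hlow.update_congr ((hs.update (by omega) _).update (by omega) _) (by omega) _
        fun j hj _ => ?_
      by_cases h : j = d + 11
      · subst h; simp
      · rw [Function.update_of_ne h, Function.update_of_ne (by omega), Function.update_of_ne h]
    simp only [stoppedValue, Function.update_self, Function.update_idem, hag]
    split_ifs <;> simp
  · intro t u ht htu
    replace ht := (ht.mono (by omega : d + 4 ≤ d + 14)).trans hs
    have hu : Agree (d + 4) u.1 r₀ := (htu.mono (by omega)).symm.trans ht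
    rw [key t ht, key u hu, htu (d + 14) (by omega)]
    refine low_stoppedValue (N := d + 12) (by omega) hlow _ _
      ((ht.update (by omega) _).update (by omega) _) fun j hj => ?_
    simp only [Function.update_apply]
    split_ifs <;> first | rfl | exact htu j (by omega)

end Stopped

/-! ### Coins -/

/-- The mixture `t A + (1 - t) B`. -/
def coin (t : ℝ) (A B : ℝ≥0∞) : ℝ≥0∞ := ENNReal.ofReal t * A + ENNReal.ofReal (1 - t) * B

theorem coin_one (A B : ℝ≥0∞) : coin 1 A B = A := by simp [coin]

theorem coin_zero (A B : ℝ≥0∞) : coin 0 A B = B := by simp [coin]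

theorem coin_symm (t : ℝ) (A B : ℝ≥0∞) : coin t A B = coin (1 - t) B A := by
  simp [coin, add_comm]

theorem coin_self {t : ℝ} (h0 : 0 ≤ t) (h1 : t ≤ 1) (A : ℝ≥0∞) : coin t A A = A := by
  rw [coin, ← add_mul, ← ENNReal.ofReal_add h0 (by linarith)]
  simp

theorem coin_coin {t u v : ℝ} (ht : 0 ≤ t) (ht' : t ≤ 1) (hu : 0 ≤ u) (hu' : u ≤ 1) (hv : 0 ≤ v)
    (hv' : v ≤ 1) (A B : ℝ≥0∞) :
    coin t (coin u A B) (coin v A B) = coin (t * u + (1 - t) * v) A B := by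
  have ht1 : 0 ≤ 1 - t := by linarith
  have hu1 : 0 ≤ 1 - u := by linarith
  have hv1 : 0 ≤ 1 - v := by linarith
  have e : 1 - (t * u + (1 - t) * v) = t * (1 - u) + (1 - t) * (1 - v) := by ring
  simp only [coin]
  rw [e, ENNReal.ofReal_add (by positivity) (by positivity),
    ENNReal.ofReal_add (by positivity) (by positivity), ENNReal.ofReal_mul ht, ENNReal.ofReal_mul ht,
    ENNReal.ofReal_mul ht1, ENNReal.ofReal_mul ht1]
  ring

theorem coin_ofReal {t a b : ℝ} (ht : 0 ≤ t) (ht' : t ≤ 1) (ha : 0 ≤ a) (hb : 0 ≤ b) :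
    coin t (ENNReal.ofReal a) (ENNReal.ofReal b) = ENNReal.ofReal (t * a + (1 - t) * b) := by
  have ht1 : 0 ≤ 1 - t := by linarith
  rw [coin, ← ENNReal.ofReal_mul ht, ← ENNReal.ofReal_mul ht1,
    ← ENNReal.ofReal_add (by positivity) (by positivity)]

theorem coin_mono {t : ℝ} {A A' B B' : ℝ≥0∞} (hA : A ≤ A') (hB : B ≤ B') :
    coin t A B ≤ coin t A' B' := by
  unfold coin; gcongr

theorem coin_le {t : ℝ} (h0 : 0 ≤ t) (h1 : t ≤ 1) {A B M : ℝ≥0∞} (hA : A ≤ M) (hB : B ≤ M) :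
    coin t A B ≤ M := (coin_mono hA hB).trans (coin_self h0 h1 M).le

open Classical in
theorem lintegral_uniformLaw_ite {t : ℝ} (h0 : 0 ≤ t) (h1 : t ≤ 1) (A B : ℝ≥0∞) :
    ∫⁻ u, (if u < t then A else B) ∂uniformLaw = coin t A B := by
  have e : (fun u : ℝ => if u < t then A else B) =
      fun u => (Set.Iio t).indicator (fun _ => A) u + (Set.Iio t)ᶜ.indicator (fun _ => B) u := by
    funext u
    by_cases h : u < t
    · simp [Set.indicator, h, not_le.2 h]
    · simp [Set.indicator, h, not_lt.1 h]
  rw [e, lintegral_add_left (measurable_const.indicator measurableSet_Iio),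
    lintegral_indicator measurableSet_Iio, lintegral_indicator measurableSet_Iio.compl]
  simp only [lintegral_const, Measure.restrict_apply_univ]
  have hA : uniformLaw (Set.Iio t) = ENNReal.ofReal t := by
    rw [uniformLaw, Measure.restrict_apply measurableSet_Iio]
    have : Set.Iio t ∩ Set.Icc 0 1 = Set.Ico 0 t := by
      ext u
      simp only [Set.mem_inter_iff, Set.mem_Iio, Set.mem_Icc, Set.mem_Ico]
      constructor
      · rintro ⟨a, b, c⟩; exact ⟨b, a⟩
      · rintro ⟨a, b⟩; exact ⟨b, a, by linarith⟩
    rw [this, Real.volume_Ico, sub_zero]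
  have hB : uniformLaw (Set.Iio t)ᶜ = ENNReal.ofReal (1 - t) := by
    rw [prob_compl_eq_one_sub measurableSet_Iio, hA, ENNReal.ofReal_sub _ h0, ENNReal.ofReal_one]
  rw [hA, hB, coin, mul_comm A, mul_comm B]

/-- A mixture is affine in its weight, so a coin with random bias acts like a coin whose bias is the
mean. This is how unknown expectations become coin parameters. -/
theorem lintegral_coin {α : Type*} [MeasurableSpace α] {μ : Measure α} [IsProbabilityMeasure μ]
    {φ : α → ℝ} (hφ : Measurable φ) (h : ∀ᵐ a ∂μ, 0 ≤ φ a ∧ φ a ≤ 1) (A B : ℝ≥0∞) :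
    ∫⁻ a, coin (φ a) A B ∂μ = coin (∫ a, φ a ∂μ) A B := by
  have hi : Integrable φ μ := by
    refine Integrable.of_bound hφ.aestronglyMeasurable 1 ?_
    filter_upwards [h] with a ha
    rw [Real.norm_eq_abs, abs_of_nonneg ha.1]
    exact ha.2
  have hi' : Integrable (fun a => 1 - φ a) μ := (integrable_const _).sub hi
  have hm' : Measurable fun a => ENNReal.ofReal (1 - φ a) := (measurable_const.sub hφ).ennreal_ofReal
  simp only [coin]
  rw [lintegral_add_left (hφ.ennreal_ofReal.mul_const _), lintegral_mul_const _ hφ.ennreal_ofReal,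
    lintegral_mul_const _ hm', ← ofReal_integral_eq_lintegral_ofReal hi,
    ← ofReal_integral_eq_lintegral_ofReal hi', integral_sub (integrable_const _) hi]
  · simp
  · filter_upwards [h] with a ha
    simpa using ha.2
  · filter_upwards [h] with a ha using ha.1

section Factory

variable {d : ℕ} {Q : Measure (ℕ → E d)} [IsProbabilityMeasure Q] {r₀ : ℕ → ℝ} {ν : Measure ℝ}
  [IsProbabilityMeasure ν]

/-- With probability `t`, the value of `e`, does `a`, otherwise `b`. -/
def coinCmd (e : Expr) (a b : Cmd d) : Cmd d :=
  .seq (.uniform (d + 13)) (.ite (.reg (d + 13)) e a b)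

theorem wp_coinCmd {e : Expr} {a b : Cmd d} {f : State d → ℝ≥0∞} (hf : Measurable f)
    {s : State d} {t : ℝ} {A B : ℝ≥0∞} (h0 : 0 ≤ t) (h1 : t ≤ 1)
    (he : ∀ u, e.eval (Function.update s.1 (d + 13) u) = t)
    (hA : ∀ u, wp Q a f (Function.update s.1 (d + 13) u, s.2) = A)
    (hB : ∀ u, wp Q b f (Function.update s.1 (d + 13) u, s.2) = B) :
    wp Q (coinCmd e a b) f s = coin t A B := by
  classical
  rw [coinCmd, wp_seq Q hf, wp_uniform Q (measurable_wp Q _ hf)]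
  simp only [wp_ite, he, hA, hB]
  simp only [Expr.eval, Function.update_self]
  exact lintegral_uniformLaw_ite h0 h1 A B

/-- Stores in the register `d + 12` a Bernoulli variable with parameter `(1 + E Λ / m) / 2`. -/
def flipCmd (d : ℕ) : Cmd d :=
  .seq (sampleCmd d)
    (coinCmd (.div (.add (.reg (d + 3)) (.reg (d + 14))) (.mul (.const 2) (.reg (d + 3))))
      (.assign (d + 12) (.const 1)) (.assign (d + 12) (.const 0)))

/-- `E Λ / m`. -/
def relMean (d : ℕ) (r₀ : ℕ → ℝ) (ν : Measure ℝ) : ℝ := (∫ v, v ∂ν) / r₀ (d + 3)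

/-- Since `|Λ| ≤ m`, the quantity `(m + Λ)/(2m)` lies in `[0, 1]` and can be compared with a uniform
variable; its mean is `(1 + E Λ / m)/2`. -/
theorem wp_flipCmd (hS : Samples Q r₀ ν) {s : State d} (hs : Agree (d + 4) s.1 r₀)
    {f : State d → ℝ≥0∞} (hf : Measurable f)
    (hlow : ∀ t u : State d, Agree (d + 12) t.1 s.1 → Agree (d + 13) t.1 u.1 → f t = f u) :
    wp Q (flipCmd d) f s = coin ((1 + relMean d r₀ ν) / 2) (f (Function.update s.1 (d + 12) 1, s.2))
      (f (Function.update s.1 (d + 12) 0, s.2)) := by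
  have hm := hS.bound_pos
  rw [flipCmd, wp_seq Q hf, hS.wp_sample s hs _ (measurable_wp Q _ hf)]
  · have h1 : ∀ᵐ v ∂ν, wp Q (coinCmd (.div (.add (.reg (d + 3)) (.reg (d + 14)))
        (.mul (.const 2) (.reg (d + 3)))) (.assign (d + 12) (.const 1))
        (.assign (d + 12) (.const 0))) f (Function.update s.1 (d + 14) v, s.2) =
        coin ((r₀ (d + 3) + v) / (2 * r₀ (d + 3))) (f (Function.update s.1 (d + 12) 1, s.2))
          (f (Function.update s.1 (d + 12) 0, s.2)) := by
      filter_upwards [hS.bound] with v hv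
      rw [abs_le] at hv
      have hval : ∀ u (c : ℚ), wp Q (.assign (d + 12) (.const c)) f
          (Function.update (Function.update s.1 (d + 14) v) (d + 13) u, s.2) =
          f (Function.update s.1 (d + 12) c, s.2) := by
        intro u c
        rw [wp_assign Q hf]
        refine hlow _ _ ((((Agree.refl _ _).update (by omega) _).update (by omega) _).update
          le_rfl _) fun j hj => ?_
        simp only [Function.update_apply]
        split_ifs <;> first | rfl | omega
      refine wp_coinCmd hf (div_nonneg (by linarith) (by linarith)) ?_ ?_
        (fun u => (hval u 1).trans (by simp)) (fun u => (hval u 0).trans (by simp))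
      · rw [div_le_one (by linarith)]
        linarith
      · intro u
        simp only [Expr.eval, hs (d + 3) (by omega), Function.update_self, ne_eq,
          Nat.add_left_cancel_iff, Nat.reduceEqDiff, not_false_eq_true, Function.update_of_ne]
        simp
    have hint : Integrable (fun v : ℝ => v) ν := Integrable.of_bound (by fun_prop) _ hS.bound
    rw [lintegral_congr_ae h1, lintegral_coin (by fun_prop)]
    · rw [integral_div, integral_add (integrable_const _) hint, relMean]
      simp only [integral_const, probReal_univ, smul_eq_mul, one_mul]
      congr 1
      field_simp
    · filter_upwards [hS.bound] with v hv
      rw [abs_le] at hv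
      exact ⟨div_nonneg (by linarith) (by linarith), by rw [div_le_one (by linarith)]; linarith⟩
  · intro t u ht htu
    rw [coinCmd, wp_seq Q hf, wp_seq Q hf, wp_uniform Q (measurable_wp Q _ hf),
      wp_uniform Q (measurable_wp Q _ hf)]
    refine lintegral_congr fun w => ?_
    have hval : ∀ c : ℝ, f (Function.update (Function.update t.1 (d + 13) w) (d + 12) c, t.2) =
        f (Function.update (Function.update u.1 (d + 13) w) (d + 12) c, u.2) := by
      intro c
      refine hlow _ _ ((((ht.mono (by omega)).update (by omega) _)).update le_rfl _)
        fun j hj => ?_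
      simp only [Function.update_apply]
      split_ifs <;> first | rfl | exact htu j (by omega)
    simp only [wp_ite, wp_assign Q hf, Expr.eval, hval]
    simp [htu (d + 3) (by omega), htu (d + 14) (by omega)]

/-- The program cannot compute `E Λ / m`, but it can compute the lower bound `ε = δ/(2m)`, which is
all that the Bernoulli factory needs. -/
theorem relMean_bounds (hS : Samples Q r₀ ν) :
    r₀ 1 / (2 * r₀ (d + 3)) ≤ relMean d r₀ ν ∧ relMean d r₀ ν ≤ 1 ∧
      0 < r₀ 1 / (2 * r₀ (d + 3)) ∧ r₀ 1 / (2 * r₀ (d + 3)) ≤ 1 / 2 := by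
  have hm := hS.bound_pos
  have hδ := hS.delta_pos
  refine ⟨?_, ?_, by positivity, ?_⟩
  · rw [relMean, div_le_div_iff₀ (by positivity) hm]
    nlinarith [hS.delta_le_mean]
  · rw [relMean, div_le_one hm]
    exact mean_le_bound hS.bound
  · rw [div_le_div_iff₀ (by positivity) (by norm_num)]
    linarith [hS.delta_le_bound]

/-! ### The linear Bernoulli factory -/

/-- One step of the walk: the position is in `d + 5`, the probability of accepting an upward step in
`d + 6`. -/
def stepCmd (d : ℕ) : Cmd d :=
  .ite (.reg (d + 12)) (.const (1 / 2)) (.assign (d + 5) (.sub (.reg (d + 5)) (.const 1)))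
    (coinCmd (.reg (d + 6)) (.assign (d + 5) (.add (.reg (d + 5)) (.const 1))) .skip)

/-- At high positions, lowers the acceptance probability by the factor `1 - η`, at the price of
ending the walk with probability `1 - (1 - η) ^ i`. -/
def tiltCmd (d : ℕ) : Cmd d :=
  .ite (.mul (.reg (d + 5)) (.reg (d + 7))) (.const 3) .skip
    (.seq (powerCmd d)
      (coinCmd (.reg (d + 8))
        (.seq (.assign (d + 6) (.mul (.reg (d + 6)) (.sub (.const 1) (.reg (d + 7)))))
          (.assign (d + 7) (.div (.reg (d + 7)) (.const 2))))
        (.seq (.assign (d + 4) (.const 1)) (.assign (d + 5) (.const 0)))))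

/-- One round of the walk. -/
def walkCmd (d : ℕ) : Cmd d := .seq (flipCmd d) (.seq (stepCmd d) (tiltCmd d))

/-- The state with the contents `g, i, β, η` in the registers `d + 4, …, d + 7`. -/
def setWalk (s : State d) (g i β η : ℝ) : State d :=
  (Function.update (Function.update (Function.update (Function.update s.1 (d + 4) g) (d + 5) i)
    (d + 6) β) (d + 7) η, s.2)

theorem agree_setWalk {s : State d} (hs : Agree (d + 4) s.1 r₀) (g i β η : ℝ) :
    Agree (d + 4) (setWalk s g i β η).1 r₀ :=
  (((hs.update (by omega) _).update (by omega) _).update (by omega) _).update (by omega) _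

/-- A postcondition of this kind sees only the base and the four walk registers, so scratch
registers can be normalized away. -/
theorem Low.eq_setWalk {f : State d → ℝ≥0∞} (hf : Low r₀ (d + 8) f) {s t : State d}
    (hs : Agree (d + 4) s.1 r₀) (ht : Agree (d + 4) t.1 r₀) {g i β η : ℝ} (hg : t.1 (d + 4) = g)
    (hi : t.1 (d + 5) = i) (hβ : t.1 (d + 6) = β) (hη : t.1 (d + 7) = η) :
    f t = f (setWalk s g i β η) := by
  refine hf _ _ ht fun j hj => ?_
  by_cases h4 : j < d + 4
  · rw [ht j h4, agree_setWalk hs g i β η j h4]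
  · obtain rfl | rfl | rfl | rfl : j = d + 4 ∨ j = d + 5 ∨ j = d + 6 ∨ j = d + 7 := by omega
    all_goals simp [setWalk, hg, hi, hβ, hη]

open Classical in
/-- The value of `tiltCmd`. -/
def tiltValue (f : State d → ℝ≥0∞) (s : State d) (g : ℝ) (k : ℕ) (β η : ℝ) : ℝ≥0∞ :=
  if (k : ℝ) * η < 3 then f (setWalk s g k β η)
  else coin ((1 - η) ^ k) (f (setWalk s g k (β * (1 - η)) (η / 2))) (f (setWalk s 1 0 β η))

theorem wp_tiltCmd {f : State d → ℝ≥0∞} (hf : Measurable f) (hlow : Low r₀ (d + 8) f)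
    {s t : State d} (hs : Agree (d + 4) s.1 r₀) (ht : Agree (d + 4) t.1 r₀) {g β η : ℝ} {k : ℕ}
    (hg : t.1 (d + 4) = g) (hi : t.1 (d + 5) = k) (hβ : t.1 (d + 6) = β) (hη : t.1 (d + 7) = η)
    (h0 : 0 ≤ η) (h1 : η ≤ 1) : wp Q (tiltCmd d) f t = tiltValue f s g k β η := by
  classical
  rw [tiltCmd, wp_ite]
  simp only [Expr.eval, hi, hη, tiltValue]
  have h3 : ((3 : ℚ) : ℝ) = 3 := by norm_num
  rw [h3]
  split_ifs with h
  · rw [wp_skip Q hf]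
    exact hlow.eq_setWalk hs ht hg hi hβ hη
  · rw [wp_seq Q hf]
    refine wp_of_runsTo Q (runsTo_powerCmd t k hi) (measurable_wp Q _ hf) _ ?_
    rintro u ⟨hu, hw⟩
    have hu0 : Agree (d + 4) u.1 r₀ := (hu.mono (by omega)).trans ht
    have hu4 : u.1 (d + 4) = g := by rw [hu _ (by omega), hg]
    have hu5 : u.1 (d + 5) = k := by rw [hu _ (by omega), hi]
    have hu6 : u.1 (d + 6) = β := by rw [hu _ (by omega), hβ]
    have hu7 : u.1 (d + 7) = η := by rw [hu _ (by omega), hη]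
    rw [hη] at hw
    refine wp_coinCmd hf (pow_nonneg (by linarith) _) (pow_le_one₀ (by linarith) (by linarith))
      ?_ ?_ ?_
    · intro v
      simp [Expr.eval, hw]
    · intro v
      rw [wp_seq Q hf, wp_assign Q (measurable_wp Q _ hf), wp_assign Q hf]
      refine hlow.eq_setWalk hs (((hu0.update (by omega) _).update (by omega) _).update
        (by omega) _) ?_ ?_ ?_ ?_ <;> simp [Expr.eval, hu4, hu5, hu6, hu7]
    · intro v
      rw [wp_seq Q hf, wp_assign Q (measurable_wp Q _ hf), wp_assign Q hf]
      refine hlow.eq_setWalk hs (((hu0.update (by omega) _).update (by omega) _).update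
        (by omega) _) ?_ ?_ ?_ ?_ <;> simp [Expr.eval, hu6, hu7]

theorem wp_walkCmd (hS : Samples Q r₀ ν) {f : State d → ℝ≥0∞} (hf : Measurable f)
    (hlow : Low r₀ (d + 8) f) {s : State d} (hs : Agree (d + 4) s.1 r₀) {g β η : ℝ} {k : ℕ}
    (hg : s.1 (d + 4) = g) (hi : s.1 (d + 5) = (k + 1 : ℕ)) (hβ : s.1 (d + 6) = β)
    (hη : s.1 (d + 7) = η) (h0 : 0 ≤ η) (h1 : η ≤ 1) (hβ0 : 0 ≤ β) (hβ1 : β ≤ 1) :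
    wp Q (walkCmd d) f s = coin ((1 + relMean d r₀ ν) / 2)
      (coin β (tiltValue f s g (k + 2) β η) (tiltValue f s g (k + 1) β η))
      (tiltValue f s g k β η) := by
  classical
  have hm := measurable_wp Q (tiltCmd d) hf
  have hm2 := measurable_wp Q (stepCmd d) hm
  have hfun : wp Q (.seq (stepCmd d) (tiltCmd d)) f = wp Q (stepCmd d) (wp Q (tiltCmd d) f) :=
    funext fun t => wp_seq Q hf _ _ t
  have hdown : ∀ t : State d, Agree (d + 4) t.1 r₀ → t.1 (d + 4) = g →
      t.1 (d + 5) = (k + 1 : ℕ) → t.1 (d + 6) = β → t.1 (d + 7) = η → t.1 (d + 12) < 1 / 2 →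
      wp Q (stepCmd d) (wp Q (tiltCmd d) f) t = tiltValue f s g k β η := by
    intro t ht h4 h5 h6 h7 h12
    rw [stepCmd, wp_ite, if_pos (by simpa [Expr.eval] using h12), wp_assign Q hm]
    refine wp_tiltCmd hf hlow hs (ht.update (by omega) _) ?_ ?_ ?_ ?_ h0 h1 <;>
      simp [Expr.eval, h4, h5, h6, h7]
  have hup : ∀ t : State d, Agree (d + 4) t.1 r₀ → t.1 (d + 4) = g →
      t.1 (d + 5) = (k + 1 : ℕ) → t.1 (d + 6) = β → t.1 (d + 7) = η → ¬ t.1 (d + 12) < 1 / 2 →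
      wp Q (stepCmd d) (wp Q (tiltCmd d) f) t =
        coin β (tiltValue f s g (k + 2) β η) (tiltValue f s g (k + 1) β η) := by
    intro t ht h4 h5 h6 h7 h12
    rw [stepCmd, wp_ite, if_neg (by simpa [Expr.eval] using h12)]
    refine wp_coinCmd hm hβ0 hβ1 ?_ ?_ ?_
    · intro u
      simp [Expr.eval, h6]
    · intro u
      rw [wp_assign Q hm]
      refine wp_tiltCmd hf hlow hs ((ht.update (by omega) _).update (by omega) _) ?_ ?_ ?_ ?_ h0 h1
        <;> simp [Expr.eval, h4, h5, h6, h7]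
      ring
    · intro u
      rw [wp_skip Q hm]
      refine wp_tiltCmd hf hlow hs (ht.update (by omega) _) ?_ ?_ ?_ ?_ h0 h1 <;>
        simp [h4, h5, h6, h7]
  rw [walkCmd, wp_seq Q hf, hfun, wp_flipCmd hS hs hm2]
  · rw [hup, hdown]
    all_goals first
      | exact hs.update (by omega) _
      | (simp [hg, hi, hβ, hη] <;> norm_num)
  · intro t u ht htu
    have ht' : ∀ j, d + 4 ≤ j → j < d + 8 → t.1 j = s.1 j := fun j _ hj => ht j (by omega)
    have hu' : ∀ j, d + 4 ≤ j → j < d + 8 → u.1 j = s.1 j := fun j _ hj => by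
      rw [← htu j (by omega), ht j (by omega)]
    have ht0 : Agree (d + 4) t.1 r₀ := (ht.mono (by omega)).trans hs
    have hu0 : Agree (d + 4) u.1 r₀ := (htu.mono (by omega)).symm.trans ht0
    have h12 := htu (d + 12) (by omega)
    by_cases h : t.1 (d + 12) < 1 / 2
    · rw [hdown t ht0 _ _ _ _ h, hdown u hu0 _ _ _ _ (h12 ▸ h)]
      all_goals first
        | (rw [ht' _ (by omega) (by omega)]; assumption)
        | (rw [hu' _ (by omega) (by omega)]; assumption)
    · rw [hup t ht0 _ _ _ _ h, hup u hu0 _ _ _ _ (h12 ▸ h)]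
      all_goals first
        | (rw [ht' _ (by omega) (by omega)]; assumption)
        | (rw [hu' _ (by omega) (by omega)]; assumption)

end Factory

/-! ### Hitting probability and termination of the tilted walk. -/

section Walk

variable {d : ℕ} {Q : Measure (ℕ → E d)} [IsProbabilityMeasure Q] {r₀ : ℕ → ℝ} {ν : Measure ℝ}
  [IsProbabilityMeasure ν]

@[simp] theorem setWalk_g (s : State d) (g i β η : ℝ) : (setWalk s g i β η).1 (d + 4) = g := by
  simp [setWalk]

@[simp] theorem setWalk_i (s : State d) (g i β η : ℝ) : (setWalk s g i β η).1 (d + 5) = i := by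
  simp [setWalk]

@[simp] theorem setWalk_beta (s : State d) (g i β η : ℝ) : (setWalk s g i β η).1 (d + 6) = β := by
  simp [setWalk]

@[simp] theorem setWalk_eta (s : State d) (g i β η : ℝ) : (setWalk s g i β η).1 (d + 7) = η := by
  simp [setWalk]

theorem Low.eq_update {f : State d → ℝ≥0∞} (hf : Low r₀ (d + 5) f) {s t : State d}
    (hs : Agree (d + 4) s.1 r₀) (ht : Agree (d + 4) t.1 r₀) {g : ℝ} (hg : t.1 (d + 4) = g) :
    f t = f (Function.update s.1 (d + 4) g, s.2) := by
  refine hf _ _ ht fun j hj => ?_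
  rcases (show j < d + 4 ∨ j = d + 4 by omega) with h | rfl
  · exact (ht j h).trans (hs.update le_rfl g j h).symm
  · simp [hg]

open Classical in
/-- The value of the walk: it hits zero with probability `(r / β) ^ i`. -/
def walkValue (r : ℝ) (f : State d → ℝ≥0∞) (s : State d) : ℝ≥0∞ :=
  if 0 < s.1 (d + 5) then
    coin ((r / s.1 (d + 6)) ^ ⌊s.1 (d + 5)⌋₊) (f (Function.update s.1 (d + 4) 2, s.2))
      (f (Function.update s.1 (d + 4) 1, s.2))
  else f s

theorem measurable_reg (i : ℕ) : Measurable fun s : State d => s.1 i :=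
  (measurable_pi_apply i).comp measurable_fst

theorem measurable_walkValue (r : ℝ) {f : State d → ℝ≥0∞} (hf : Measurable f) :
    Measurable (walkValue r f) := by
  have hu : ∀ c : ℝ, Measurable fun s : State d => f (Function.update s.1 (d + 4) c, s.2) :=
    fun c => hf.comp ((measurable_update_reg (d + 4)).comp (measurable_id.prodMk measurable_const))
  have hp : Measurable fun s : State d => (r / s.1 (d + 6)) ^ ⌊s.1 (d + 5)⌋₊ :=
    (measurable_const.div (measurable_reg _)).pow (Nat.measurable_floor.comp (measurable_reg _))
  refine Measurable.ite (measurableSet_lt measurable_const (measurable_reg _)) ?_ hf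
  exact (hp.ennreal_ofReal.mul (hu 2)).add ((measurable_const.sub hp).ennreal_ofReal.mul (hu 1))

theorem low_walkValue (r : ℝ) {f : State d → ℝ≥0∞} (hf : Low r₀ (d + 5) f) :
    Low r₀ (d + 8) (walkValue r f) := by
  intro s t hs hst
  have ht : Agree (d + 4) t.1 r₀ := (hst.mono (by omega)).symm.trans hs
  have hu : ∀ c : ℝ, f (Function.update s.1 (d + 4) c, s.2) =
      f (Function.update t.1 (d + 4) c, t.2) := fun c =>
    hf.eq_update ht (hs.update le_rfl c) (by simp)
  simp only [walkValue, hst (d + 5) (by omega), hst (d + 6) (by omega), hu,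
    hf s t hs (hst.mono (by omega))]

/-- The invariant of the walk. -/
def WalkInv (ε : ℝ) (s : State d) : Prop :=
  s.1 (d + 5) = 0 ∨ (s.1 (d + 4) = 2 ∧ s.1 (d + 5) ∈ Set.range ((↑) : ℕ → ℝ) ∧ 0 < s.1 (d + 7) ∧
    s.1 (d + 7) ≤ ε / 2 ∧ 1 - ε + 2 * s.1 (d + 7) ≤ s.1 (d + 6) ∧ s.1 (d + 6) ≤ 1 ∧
    s.1 (d + 5) * s.1 (d + 7) < 3)

theorem measurableSet_walkInv (ε : ℝ) : MeasurableSet {s : State d | WalkInv ε s} := by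
  have hr := fun i => measurable_reg (d := d) i
  refine (measurableSet_eq_fun (hr _) measurable_const).union ?_
  refine (measurableSet_eq_fun (hr _) measurable_const).inter ?_
  refine ((hr _) (Set.countable_range _).measurableSet).inter ?_
  refine (measurableSet_lt measurable_const (hr _)).inter ?_
  refine (measurableSet_le (hr _) measurable_const).inter ?_
  refine (measurableSet_le (((hr _).const_mul _).const_add _) (hr _)).inter ?_
  refine (measurableSet_le (hr _) measurable_const).inter ?_
  exact measurableSet_lt ((hr _).mul (hr _)) measurable_const

open Classical in
/-- The ranking function of the walk. -/
def walkRank (r₀ : ℕ → ℝ) (ε : ℝ) (s : State d) : ℝ≥0∞ :=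
  if Agree (d + 4) s.1 r₀ ∧ WalkInv ε s then
    if 0 < s.1 (d + 5) then ENNReal.ofReal (6 / s.1 (d + 7) - s.1 (d + 5)) else 0
  else ∞

theorem measurable_walkRank (r₀ : ℕ → ℝ) (ε : ℝ) : Measurable (walkRank (d := d) r₀ ε) := by
  refine Measurable.ite ((measurableSet_agree _ _).inter (measurableSet_walkInv ε)) ?_
    measurable_const
  refine Measurable.ite (measurableSet_lt measurable_const (measurable_reg _)) ?_ measurable_const
  exact ((measurable_const.div (measurable_reg _)).sub (measurable_reg _)).ennreal_ofReal

theorem walkRank_ne_top {ε : ℝ} {s : State d} :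
    walkRank r₀ ε s ≠ ∞ ↔ Agree (d + 4) s.1 r₀ ∧ WalkInv ε s := by
  simp only [walkRank]
  split_ifs with h <;> simp [h]

theorem low_walkRank (ε : ℝ) : Low r₀ (d + 8) (walkRank (d := d) r₀ ε) := by
  intro s t hs hst
  have ht : Agree (d + 4) t.1 r₀ := (hst.mono (by omega)).symm.trans hs
  have hiff : (Agree (d + 4) s.1 r₀ ∧ WalkInv ε s) ↔ (Agree (d + 4) t.1 r₀ ∧ WalkInv ε t) := by
    simp only [WalkInv, hs, ht, hst (d + 4) (by omega), hst (d + 5) (by omega),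
      hst (d + 6) (by omega), hst (d + 7) (by omega)]
  by_cases h : Agree (d + 4) s.1 r₀ ∧ WalkInv ε s
  · rw [walkRank, walkRank, if_pos h, if_pos (hiff.1 h), hst (d + 5) (by omega),
      hst (d + 7) (by omega)]
  · rw [walkRank, walkRank, if_neg h, if_neg fun h' => h (hiff.2 h')]

/-- Bernoulli's inequality gives `(1 + η)^k ≥ 1 + kη ≥ 4`, while `(1 - η²)^k ≤ 1`. -/
theorem pow_one_sub_le {η : ℝ} (h0 : 0 ≤ η) (h1 : η ≤ 1) {k : ℕ} (hk : 3 ≤ k * η) :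
    (1 - η) ^ k ≤ 1 / 4 := by
  have hb : 4 ≤ (1 + η) ^ k := by
    have := one_add_mul_le_pow (show (-2 : ℝ) ≤ η by linarith) k
    linarith
  have hp : (1 - η) ^ k * (1 + η) ^ k ≤ 1 := by
    rw [← mul_pow]
    exact pow_le_one₀ (by nlinarith) (by nlinarith)
  have h2 : 0 ≤ (1 - η) ^ k := pow_nonneg (by linarith) _
  nlinarith

/-- Tilting does not raise the mean rank. Halving `η` changes the rank from `6/η - k` to `12/η - k`,
but the walk survives with probability at most `1/4` and an ended walk has rank zero. The invariant
persists because `β(1 - η) ≥ β - η ≥ 1 - ε + 2(η/2)`. -/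
theorem tiltValue_walkRank_le {ε β η : ℝ} {k : ℕ} {s : State d} (hs : Agree (d + 4) s.1 r₀)
    (hε : ε ≤ 1 / 2) (h0 : 0 < η) (h1 : η ≤ ε / 2) (hβ : 1 - ε + 2 * η ≤ β) (hβ1 : β ≤ 1)
    (hk : k * η ≤ 4) :
    tiltValue (walkRank r₀ ε) s 2 k β η ≤ ENNReal.ofReal (6 / η - k) := by
  have hk6 : (k : ℝ) ≤ 4 / η := by rwa [le_div_iff₀ h0]
  have hle : 6 / η = 4 / η + 2 / η := by ring
  have h2η : 0 < 2 / η := by positivity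
  have hk0 : (0 : ℝ) ≤ k := Nat.cast_nonneg k
  rw [tiltValue]
  split_ifs with h
  · have hinv : WalkInv ε (setWalk s 2 k β η) :=
      Or.inr (by simp only [setWalk_g, setWalk_i, setWalk_beta, setWalk_eta]
                 exact ⟨trivial, ⟨k, rfl⟩, h0, h1, hβ, hβ1, h⟩)
    rw [walkRank, if_pos ⟨agree_setWalk hs _ _ _ _, hinv⟩]
    simp only [setWalk_i, setWalk_eta]
    split_ifs
    · exact le_rfl
    · exact zero_le
  · rw [not_lt] at h
    have hinv : WalkInv ε (setWalk s 2 k (β * (1 - η)) (η / 2)) := by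
      refine Or.inr ?_
      simp only [setWalk_g, setWalk_i, setWalk_beta, setWalk_eta]
      refine ⟨trivial, ⟨k, rfl⟩, by linarith, by linarith, by nlinarith, by nlinarith, by linarith⟩
    have hinv0 : WalkInv ε (setWalk s 1 0 β η) := Or.inl (by simp)
    have hw := pow_one_sub_le h0.le (by linarith) h
    have hw0 : 0 ≤ (1 - η) ^ k := pow_nonneg (by linarith) _
    have e1 : walkRank r₀ ε (setWalk s 2 k (β * (1 - η)) (η / 2)) ≤
        ENNReal.ofReal (6 / (η / 2) - k) := by
      rw [walkRank, if_pos ⟨agree_setWalk hs _ _ _ _, hinv⟩]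
      simp only [setWalk_i, setWalk_eta]
      split_ifs
      · exact le_rfl
      · exact zero_le
    have e2 : walkRank r₀ ε (setWalk s 1 0 β η) = ENNReal.ofReal 0 := by
      rw [walkRank, if_pos ⟨agree_setWalk hs _ _ _ _, hinv0⟩]
      simp
    have e3 : 6 / (η / 2) = 12 / η := by field_simp; norm_num
    have e4 : 12 / η = 4 / η + 4 / η + 2 / η + 2 / η := by ring
    have e5 : 4 / η = 2 / η + 2 / η := by ring
    rw [e2]
    refine (coin_mono e1 le_rfl).trans ?_
    rw [coin_ofReal hw0 (by linarith) (by rw [e3]; linarith) le_rfl, e3]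
    refine ENNReal.ofReal_le_ofReal ?_
    -- The inequality reduces to `(12/η - k)/4 ≤ 6/η - k`, that is, `k ≤ 4/η`.
    nlinarith

/-- Tilting leaves the value unchanged, because `(1 - η)^k (r / (β(1 - η)))^k = (r/β)^k`. The lower
bound on `β` keeps the new ratio at most one, so that it still gives a probability. -/
theorem tiltValue_walkValue {r ε β η : ℝ} {k : ℕ} {s : State d} (hs : Agree (d + 4) s.1 r₀)
    {f : State d → ℝ≥0∞} (hf : Low r₀ (d + 5) f) (hr0 : 0 ≤ r) (hr : r ≤ 1 - ε)
    (hε : ε ≤ 1 / 2) (h0 : 0 < η) (h1 : η ≤ ε / 2) (hβ : 1 - ε + 2 * η ≤ β) :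
    tiltValue (walkValue r f) s 2 k β η =
      coin ((r / β) ^ k) (f (Function.update s.1 (d + 4) 2, s.2))
        (f (Function.update s.1 (d + 4) 1, s.2)) := by
  have hβ0 : 0 < β := by linarith
  have hset : ∀ (g β η : ℝ), walkValue r f (setWalk s g 0 β η) =
      f (Function.update s.1 (d + 4) g, s.2) := by
    intro g β η
    simp only [walkValue, setWalk_i, lt_irrefl, if_false]
    exact hf.eq_update hs (agree_setWalk hs _ _ _ _) (by simp)
  have hset' : ∀ (β η : ℝ), walkValue r f (setWalk s 2 k β η) =
      coin ((r / β) ^ k) (f (Function.update s.1 (d + 4) 2, s.2))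
        (f (Function.update s.1 (d + 4) 1, s.2)) := by
    intro β η
    rcases Nat.eq_zero_or_pos k with rfl | hk
    · simp only [Nat.cast_zero, pow_zero, coin_one, hset]
    · have hk' : (0 : ℝ) < k := by exact_mod_cast hk
      simp only [walkValue, setWalk_i, setWalk_beta, hk', if_true, Nat.floor_natCast]
      rw [hf.eq_update (s := s) (t := (Function.update (setWalk s 2 k β η).1 (d + 4) 2, _)) hs
          ((agree_setWalk hs _ _ _ _).update le_rfl _) (g := 2) (by simp),
        hf.eq_update (s := s) (t := (Function.update (setWalk s 2 k β η).1 (d + 4) 1, _)) hs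
          ((agree_setWalk hs _ _ _ _).update le_rfl _) (g := 1) (by simp)]
  rw [tiltValue]
  split_ifs with h
  · exact hset' β η
  · rw [hset, hset']
    have hη1 : 0 < 1 - η := by linarith
    have hq : r / (β * (1 - η)) ≤ 1 := by
      rw [div_le_one (by positivity)]
      nlinarith
    have hq0 : 0 ≤ r / (β * (1 - η)) := by positivity
    have key := coin_coin (t := (1 - η) ^ k) (u := (r / (β * (1 - η))) ^ k) (v := 0)
      (pow_nonneg hη1.le k) (pow_le_one₀ hη1.le (by linarith)) (pow_nonneg hq0 k)
      (pow_le_one₀ hq0 hq) le_rfl zero_le_one (f (Function.update s.1 (d + 4) 2, s.2))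
        (f (Function.update s.1 (d + 4) 1, s.2))
    rw [coin_zero] at key
    rw [key, mul_zero, add_zero, ← mul_pow]
    congr 2
    field_simp

/-- The walk, run until it reaches zero (or is ended). -/
def walkLoopCmd (d : ℕ) : Cmd d := .loop (.const 0) (.reg (d + 5)) (walkCmd d)

/-- Between tilts `(r/β)^i` is harmonic for the walk with up-probability `β(1 + y)/2` and
down-probability `(1 - y)/2`, as `r` is the ratio of `1 - y` to `1 + y`. The upward drift is at
least `ε(1 - ε)/2`, which is the amount by which the mean rank drops. -/
theorem wp_walkLoopCmd (hS : Samples Q r₀ ν) {ε r : ℝ} (hε0 : 0 < ε) (hε : ε ≤ 1 / 2)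
    (hεy : ε ≤ relMean d r₀ ν) (hy : relMean d r₀ ν ≤ 1)
    (hrr : r = (1 - relMean d r₀ ν) / (1 + relMean d r₀ ν))
    {f : State d → ℝ≥0∞} (hf : Measurable f) (hlow : Low r₀ (d + 5) f) (hbd : BoundedOn r₀ f)
    {s : State d} (hs : Agree (d + 4) s.1 r₀) (hinv : WalkInv ε s) :
    wp Q (walkLoopCmd d) f s = walkValue r f s := by
  set y := relMean d r₀ ν with hydef
  have hr0 : 0 ≤ r := by rw [hrr]; exact div_nonneg (by linarith) (by linarith)
  -- After clearing the denominator this is `ε(1 + y) ≤ 2y`, which follows from `ε ≤ y ≤ 1`.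
  have hr1 : r ≤ 1 - ε := by
    rw [hrr, div_le_iff₀ (by linarith)]
    nlinarith
  have htest : ∀ s : State d, (Expr.const 0).eval s.1 < (Expr.reg (d + 5)).eval s.1 ↔
      0 < s.1 (d + 5) := fun s => by simp [Expr.eval]
  have hnat : ∀ s : State d, 0 < s.1 (d + 5) → s.1 (d + 5) ∈ Set.range ((↑) : ℕ → ℝ) →
      ∃ k : ℕ, s.1 (d + 5) = (k + 1 : ℕ) := by
    rintro s h ⟨k, hk⟩
    rw [← hk] at h
    have : 0 < k := by exact_mod_cast h
    exact ⟨k - 1, by rw [← hk]; congr 1; omega⟩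
  obtain ⟨M, hM, hfM⟩ := hbd
  refine wp_loop_eq Q hf (h := walkValue r f) (measurable_walkRank r₀ ε)
    (c := ENNReal.ofReal (ε * (1 - ε) / 2)) (M := M) ?_ ENNReal.ofReal_ne_top hM ?_ ?_ ?_ ?_ s
    (walkRank_ne_top.2 ⟨hs, hinv⟩)
  · have : 0 < ε * (1 - ε) / 2 := by nlinarith
    simpa using this
  · intro s hV ht
    obtain ⟨hs, hinv⟩ := walkRank_ne_top.1 hV
    rw [htest] at ht
    obtain ⟨h4, h5, h7, h7', h6, h6', h57⟩ := hinv.resolve_left ht.ne'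
    obtain ⟨k, hk⟩ := hnat s ht h5
    constructor
    · rw [wp_walkCmd hS measurable_const (fun _ _ _ _ => rfl) hs rfl hk rfl rfl h7.le (by linarith)
        (by linarith) h6']
      have hone : ∀ j, tiltValue (fun _ => 1) s (s.1 (d + 4)) j (s.1 (d + 6)) (s.1 (d + 7)) = 1 := by
        intro j
        rw [tiltValue]
        split_ifs
        · rfl
        · exact coin_self (pow_nonneg (by linarith) _) (pow_le_one₀ (by linarith) (by linarith)) 1
      rw [hone, hone, hone, coin_self (by linarith) h6', coin_self (by linarith) (by linarith)]
    · rw [wp_walkCmd hS (measurable_walkRank r₀ ε) (low_walkRank ε) hs h4 hk rfl rfl h7.le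
        (by linarith) (by linarith) h6']
      rw [hk] at h57
      set η := s.1 (d + 7) with hη
      set β := s.1 (d + 6) with hβ
      -- The position `k + 1` has `(k + 1) η < 3`, and one step up adds at most `η ≤ 1/4`.
      have hb : ∀ j : ℕ, j ≤ k + 2 → (j : ℝ) * η ≤ 4 := by
        intro j hj
        have hj' : (j : ℝ) ≤ k + 2 := by exact_mod_cast hj
        push_cast at h57
        nlinarith
      have hpos : ∀ j : ℕ, j ≤ k + 2 → 0 ≤ 6 / η - j := by
        intro j hj
        have : (j : ℝ) ≤ 4 / η := by rw [le_div_iff₀ h7]; exact hb j hj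
        have h2 : 6 / η = 4 / η + 2 / η := by ring
        have : 0 < 2 / η := by positivity
        linarith
      have hT : ∀ j : ℕ, j ≤ k + 2 → tiltValue (walkRank r₀ ε) s 2 j β η ≤
          ENNReal.ofReal (6 / η - j) := fun j hj =>
        tiltValue_walkRank_le hs hε h7 h7' h6 h6' (hb j hj)
      have hβ0 : 0 ≤ β := by linarith
      have hcomb : 0 ≤ β * (6 / η - (k + 2 : ℕ)) + (1 - β) * (6 / η - (k + 1 : ℕ)) :=
        add_nonneg (mul_nonneg hβ0 (hpos _ le_rfl)) (mul_nonneg (by linarith) (hpos _ (by omega)))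
      calc _ ≤ coin ((1 + y) / 2) (coin β (ENNReal.ofReal (6 / η - (k + 2 : ℕ)))
              (ENNReal.ofReal (6 / η - (k + 1 : ℕ)))) (ENNReal.ofReal (6 / η - k)) +
              ENNReal.ofReal (ε * (1 - ε) / 2) := by
            gcongr
            exact coin_mono (coin_mono (hT _ le_rfl) (hT _ (by omega))) (hT _ (by omega))
        _ = ENNReal.ofReal ((1 + y) / 2 * (β * (6 / η - (k + 2 : ℕ)) +
              (1 - β) * (6 / η - (k + 1 : ℕ))) + (1 - (1 + y) / 2) * (6 / η - k) +
              ε * (1 - ε) / 2) := by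
            rw [coin_ofReal hβ0 h6' (hpos _ le_rfl) (hpos _ (by omega)),
              coin_ofReal (by linarith) (by linarith) hcomb (hpos _ (by omega)),
              ← ENNReal.ofReal_add _ (by nlinarith)]
            exact add_nonneg (mul_nonneg (by linarith) hcomb)
              (mul_nonneg (by linarith) (hpos _ (by omega)))
        _ ≤ ENNReal.ofReal (6 / η - (k + 1 : ℕ)) := by
            refine ENNReal.ofReal_le_ofReal ?_
            push_cast
            -- The claim is `β(1 + y)/2 - (1 - y)/2 ≥ ε(1 - ε)/2`; the left side is smallest at `β =
            -- 1 - ε`, `y = ε`, where equality holds.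
            nlinarith [mul_nonneg (show 0 ≤ 1 + y by linarith) (show 0 ≤ β - (1 - ε) by linarith),
              mul_nonneg (show 0 ≤ y - ε by linarith) (show 0 ≤ 2 - ε by linarith)]
        _ = walkRank r₀ ε s := by
            rw [walkRank, if_pos ⟨hs, hinv⟩, if_pos ht, hk]
  · intro s hV
    obtain ⟨hs, hinv⟩ := walkRank_ne_top.1 hV
    simp only [walkValue]
    split_ifs with ht
    · obtain ⟨h4, h5, h7, h7', h6, h6', h57⟩ := hinv.resolve_left ht.ne'
      have h0 : 0 ≤ r / s.1 (d + 6) := div_nonneg hr0 (by linarith)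
      have h1 : r / s.1 (d + 6) ≤ 1 := by rw [div_le_one (by linarith)]; linarith
      exact coin_le (pow_nonneg h0 _) (pow_le_one₀ h0 h1) (hfM _ (hs.update le_rfl _))
        (hfM _ (hs.update le_rfl _))
    · exact hfM s hs
  · intro s hV ht
    obtain ⟨hs, hinv⟩ := walkRank_ne_top.1 hV
    rw [htest] at ht
    obtain ⟨h4, h5, h7, h7', h6, h6', h57⟩ := hinv.resolve_left ht.ne'
    obtain ⟨k, hk⟩ := hnat s ht h5
    rw [wp_walkCmd hS (measurable_walkValue r hf) (low_walkValue r hlow) hs h4 hk rfl rfl h7.le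
        (by linarith) (by linarith) h6',
      tiltValue_walkValue hs hlow hr0 hr1 hε h7 h7' h6,
      tiltValue_walkValue hs hlow hr0 hr1 hε h7 h7' h6,
      tiltValue_walkValue hs hlow hr0 hr1 hε h7 h7' h6, walkValue, if_pos ht, hk, Nat.floor_natCast]
    set β := s.1 (d + 6) with hβ
    have hβ0 : 0 < β := by linarith
    have h0 : 0 ≤ r / β := div_nonneg hr0 hβ0.le
    have h1 : r / β ≤ 1 := by rw [div_le_one hβ0]; linarith
    have hp0 : ∀ j : ℕ, 0 ≤ (r / β) ^ j := fun j => pow_nonneg h0 j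
    have hp1 : ∀ j : ℕ, (r / β) ^ j ≤ 1 := fun j => pow_le_one₀ h0 h1
    have hc1 := mul_nonneg hβ0.le (hp0 (k + 2))
    have hc2 := mul_nonneg (show 0 ≤ 1 - β by linarith) (hp0 (k + 1))
    have hc3 := mul_le_mul_of_nonneg_left (hp1 (k + 2)) hβ0.le
    have hc4 := mul_le_mul_of_nonneg_left (hp1 (k + 1)) (show 0 ≤ 1 - β by linarith)
    rw [coin_coin hβ0.le h6' (hp0 _) (hp1 _) (hp0 _) (hp1 _),
      coin_coin (by linarith) (by linarith) (by linarith) (by linarith) (hp0 _) (hp1 _)]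
    congr 1
    have hru : r = β * (r / β) := by field_simp
    have hr2 : r * (1 + y) = 1 - y := by
      rw [hrr, div_mul_cancel₀ _ (show 1 + y ≠ 0 by linarith)]
    set u := r / β with hu
    have h5 : β * u * (1 + y) = 1 - y := by rw [← hru]; exact hr2
    -- With `u = r/β`, the defect of the harmonic equation factors as `u^k (u - 1)/2` times `βu(1 +
    -- y) - (1 - y)`.
    linear_combination (u ^ (k + 1) / 2 - u ^ k / 2) * h5
  · intro s hV ht
    rw [htest] at ht
    simp [walkValue, ht]

end Walk

/-! ### The program -/

section Program

variable {d : ℕ} {Q : Measure (ℕ → E d)} [IsProbabilityMeasure Q] {r₀ : ℕ → ℝ} {ν : Measure ℝ}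
  [IsProbabilityMeasure ν]

/-- Stores `1` in the register `d + 4` with probability `E Λ / m`, and `2` otherwise. -/
def meanCoinCmd (d : ℕ) : Cmd d :=
  .seq (.assign (d + 4) (.const 2)) (.seq (flipCmd d)
    (.ite (.reg (d + 12)) (.const (1 / 2)) .skip
      (.seq (.assign (d + 5) (.const 1)) (.seq (.assign (d + 6) (.const 1))
        (.seq (.assign (d + 7) (.div (.reg 1) (.mul (.const 4) (.reg (d + 3))))) (walkLoopCmd d))))))

/-- The outcome is `1` when the first toss succeeds and the walk from position one is ended before
hitting zero, which has probability `(1 + y)/2 · (1 - r) = y`. -/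
theorem wp_meanCoinCmd (hS : Samples Q r₀ ν) {s : State d} (hs : Agree (d + 4) s.1 r₀)
    {f : State d → ℝ≥0∞} (hf : Measurable f) (hlow : Low r₀ (d + 5) f) (hbd : BoundedOn r₀ f) :
    wp Q (meanCoinCmd d) f s = coin (relMean d r₀ ν) (f (Function.update s.1 (d + 4) 1, s.2))
      (f (Function.update s.1 (d + 4) 2, s.2)) := by
  classical
  obtain ⟨hεy, hy1, hε0, hε⟩ := relMean_bounds hS
  have hm0 := hS.bound_pos
  set y := relMean d r₀ ν with hy
  set ε := r₀ 1 / (2 * r₀ (d + 3)) with hεdef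
  set r := (1 - y) / (1 + y) with hr
  have hr0 : 0 ≤ r := div_nonneg (by linarith) (by linarith)
  have hr1 : r ≤ 1 := by rw [hr, div_le_one (by linarith)]; linarith
  set F₁ := f (Function.update s.1 (d + 4) 1, s.2) with hF₁
  set F₂ := f (Function.update s.1 (d + 4) 2, s.2) with hF₂
  set tail : Cmd d := .ite (.reg (d + 12)) (.const (1 / 2)) .skip
      (.seq (.assign (d + 5) (.const 1)) (.seq (.assign (d + 6) (.const 1))
        (.seq (.assign (d + 7) (.div (.reg 1) (.mul (.const 4) (.reg (d + 3)))))
          (walkLoopCmd d)))) with htail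
  have hm := measurable_wp Q tail hf
  have key : ∀ t : State d, Agree (d + 4) t.1 r₀ → t.1 (d + 4) = 2 →
      wp Q tail f t = if t.1 (d + 12) < 1 / 2 then F₂ else coin r F₂ F₁ := by
    intro t ht h4
    rw [htail, wp_ite]
    have hc : ((Expr.reg (d + 12)).eval t.1 < (Expr.const (1 / 2)).eval t.1) ↔
        t.1 (d + 12) < 1 / 2 := by simp [Expr.eval]
    simp only [hc]
    split_ifs with h
    · rw [wp_skip Q hf]
      exact hlow.eq_update hs ht h4
    · have hw := measurable_wp Q (walkLoopCmd d) hf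
      rw [wp_seq Q hf, wp_assign Q (measurable_wp Q _ hf), wp_seq Q hf,
        wp_assign Q (measurable_wp Q _ hf), wp_seq Q hf, wp_assign Q hw]
      -- With `β = 1` and `η = ε/2` the invariant `1 - ε + 2η ≤ β` starts with equality.
      have h7 : r₀ 1 / (4 * r₀ (d + 3)) = ε / 2 := by rw [hεdef]; ring
      have hu : Agree (d + 4) (Function.update (Function.update (Function.update t.1 (d + 5) 1)
          (d + 6) 1) (d + 7) (ε / 2)) r₀ :=
        ((ht.update (by omega) _).update (by omega) _).update (by omega) _
      have e : (Expr.div (.reg 1) (.mul (.const 4) (.reg (d + 3)))).eval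
          (Function.update (Function.update t.1 (d + 5) 1) (d + 6) 1) = ε / 2 := by
        have h1 : Agree (d + 4) (Function.update (Function.update t.1 (d + 5) 1) (d + 6) 1) r₀ :=
          (ht.update (by omega) _).update (by omega) _
        rw [← h7]
        simp only [Expr.eval, h1 1 (by omega), h1 (d + 3) (by omega)]
        norm_num
      have e1 : ∀ q : ℕ → ℝ, (Expr.const 1).eval q = 1 := fun q => by simp [Expr.eval]
      simp only [e1, e]
      rw [wp_walkLoopCmd hS hε0 hε hεy hy1 hr hf hlow hbd hu]
      · simp only [walkValue]
        rw [if_pos (by simp)]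
        have h6 : Function.update (Function.update (Function.update t.1 (d + 5) 1)
          (d + 6) 1) (d + 7) (ε / 2) (d + 6) = 1 := by simp
        have h5 : Function.update (Function.update (Function.update t.1 (d + 5) 1)
          (d + 6) 1) (d + 7) (ε / 2) (d + 5) = (1 : ℝ) := by simp
        rw [h6, h5, Nat.floor_one, pow_one, div_one]
        congr 1 <;> exact hlow.eq_update hs (hu.update le_rfl _) (by simp)
      · right
        simp [h4]
        exact ⟨hε0, by linarith, by linarith⟩
  have hfun : wp Q (.seq (flipCmd d) tail) f = wp Q (flipCmd d) (wp Q tail f) :=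
    funext fun t => wp_seq Q hf _ _ t
  have hs2 : Agree (d + 4) (Function.update s.1 (d + 4) 2) r₀ := hs.update le_rfl _
  have e2 : (Expr.const 2).eval s.1 = 2 := by simp [Expr.eval]
  rw [meanCoinCmd, wp_seq Q hf, wp_assign Q (measurable_wp Q _ hf), e2, hfun,
    wp_flipCmd hS hs2 hm]
  · rw [key _ (hs2.update (by omega) _) (by simp), key _ (hs2.update (by omega) _) (by simp)]
    simp only [Function.update_self]
    rw [if_neg (by norm_num), if_pos (by norm_num), coin_symm r, ← hy]
    nth_rw 2 [← coin_zero F₁ F₂]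
    rw [coin_coin (by linarith) (by linarith) (by linarith) (by linarith) le_rfl zero_le_one]
    congr 1
    rw [hr]
    have : 1 + y ≠ 0 := by linarith
    field_simp
    ring
  · intro t u ht htu
    have h4 : t.1 (d + 4) = 2 := by rw [ht _ (by omega)]; simp
    have ht0 : Agree (d + 4) t.1 r₀ := (ht.mono (by omega)).trans hs2
    rw [key t ht0 h4, key u ((htu.mono (by omega)).symm.trans ht0)
      (by rw [← htu _ (by omega), h4]), htu (d + 12) (by omega)]

/-- Stores `0` in the register `d + 4` with probability `(E S_τ - E Λ) / (2 m)`, and `2` otherwise. -/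
def excessCoinCmd (d : ℕ) : Cmd d :=
  .seq (stoppedSumCmd d)
    (coinCmd (.div (.sub (.reg (d + 10)) (.reg (d + 11))) (.mul (.const 2) (.reg (d + 3))))
      (.assign (d + 4) (.const 0)) (.assign (d + 4) (.const 2)))

/-- `(E S_τ - E Λ) / (2 m)`. -/
def relExcess (d : ℕ) (r₀ : ℕ → ℝ) (ν : Measure ℝ) [IsProbabilityMeasure ν] : ℝ :=
  ((∫ l, stoppedSum l ∂(iidLaw ν)) - ∫ v, v ∂ν) / (2 * r₀ (d + 3))

theorem ae_excess_bounds {m : ℝ} (hν : ∀ᵐ v ∂ν, |v| ≤ m) (hpos : 0 < ∫ v, v ∂ν) :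
    ∀ᵐ l ∂(iidLaw ν), 0 ≤ stoppedSum l - l 0 ∧ stoppedSum l - l 0 ≤ 2 * m := by
  filter_upwards [ae_stops hν hpos, ae_iidLaw_bound hν] with l h1 h2
  have h3 := h1.head_le_stoppedSum
  have h4 := stoppedSum_le (bound_nonneg hν) h2
  have h5 := abs_le.1 (h2 0)
  exact ⟨by linarith, by linarith⟩

theorem integral_excess {m : ℝ} (hν : ∀ᵐ v ∂ν, |v| ≤ m) :
    ∫ l, (stoppedSum l - l 0) / (2 * m) ∂(iidLaw ν) =
      ((∫ l, stoppedSum l ∂(iidLaw ν)) - ∫ v, v ∂ν) / (2 * m) := by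
  rw [integral_div, integral_sub (integrable_stoppedSum hν) (integrable_eval_iidLaw hν 0),
    integral_eval_iidLaw]

theorem relExcess_bounds (hS : Samples Q r₀ ν) :
    0 ≤ relExcess d r₀ ν ∧ relExcess d r₀ ν ≤ 1 := by
  have hm := hS.bound_pos
  have h := ae_excess_bounds hS.bound hS.mean_pos
  have hi : Integrable (fun l : ℕ → ℝ => (stoppedSum l - l 0) / (2 * r₀ (d + 3))) (iidLaw ν) :=
    ((integrable_stoppedSum hS.bound).sub (integrable_eval_iidLaw hS.bound 0)).div_const _
  rw [relExcess, ← integral_excess hS.bound]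
  constructor
  · refine integral_nonneg_of_ae ?_
    filter_upwards [h] with l hl
    exact div_nonneg hl.1 (by linarith)
  · calc _ ≤ ∫ _, (1 : ℝ) ∂(iidLaw ν) := by
          refine integral_mono_ae hi (integrable_const _) ?_
          filter_upwards [h] with l hl
          rw [div_le_one (by linarith)]
          exact hl.2
      _ = 1 := by simp

/-- Both terms of the excess come from the same run, so `(S_τ - l 0)/(2m)` is almost surely a
genuine bias in `[0, 1]`; one comparison with a uniform variable suffices, without a factory. -/
theorem wp_excessCoinCmd (hS : Samples Q r₀ ν) {s : State d} (hs : Agree (d + 4) s.1 r₀)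
    {f : State d → ℝ≥0∞} (hf : Measurable f) (hlow : Low r₀ (d + 5) f) (hbd : BoundedOn r₀ f) :
    wp Q (excessCoinCmd d) f s = coin (relExcess d r₀ ν) (f (Function.update s.1 (d + 4) 0, s.2))
      (f (Function.update s.1 (d + 4) 2, s.2)) := by
  classical
  have hm0 := hS.bound_pos
  obtain ⟨M, hM, hfM⟩ := hbd
  set a : Cmd d := coinCmd (.div (.sub (.reg (d + 10)) (.reg (d + 11)))
    (.mul (.const 2) (.reg (d + 3)))) (.assign (d + 4) (.const 0)) (.assign (d + 4) (.const 2))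
    with ha
  have hval : ∀ t : State d, Agree (d + 4) t.1 r₀ → ∀ u (c : ℚ), wp Q (.assign (d + 4) (.const c)) f
      (Function.update t.1 (d + 13) u, t.2) = f (Function.update t.1 (d + 4) c, t.2) := by
    intro t ht u c
    rw [wp_assign Q hf]
    refine hlow.eq_update ht ?_ (by simp [Expr.eval])
    exact (ht.update (by omega) _).update le_rfl _
  have key : ∀ t : State d, Agree (d + 4) t.1 r₀ → wp Q a f t = ∫⁻ u,
      (if u < (t.1 (d + 10) - t.1 (d + 11)) / (2 * r₀ (d + 3)) then
        f (Function.update t.1 (d + 4) 0, t.2) else f (Function.update t.1 (d + 4) 2, t.2))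
        ∂uniformLaw := by
    intro t ht
    rw [ha, coinCmd, wp_seq Q hf, wp_uniform Q (measurable_wp Q _ hf)]
    refine lintegral_congr fun u => ?_
    simp only [wp_ite, hval t ht]
    simp [Expr.eval, ht (d + 3) (by omega)]
  rw [excessCoinCmd, wp_seq Q hf, wp_stoppedSumCmd hS hs (measurable_wp Q _ hf)]
  · have h := ae_excess_bounds hS.bound hS.mean_pos
    have hl : ∀ᵐ l ∂(iidLaw ν), wp Q a f (Function.update (Function.update s.1 (d + 11) (l 0))
        (d + 10) (stoppedSum l), s.2) = coin ((stoppedSum l - l 0) / (2 * r₀ (d + 3)))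
        (f (Function.update s.1 (d + 4) 0, s.2)) (f (Function.update s.1 (d + 4) 2, s.2)) := by
      filter_upwards [h] with l hl
      have hu : Agree (d + 4) (Function.update (Function.update s.1 (d + 11) (l 0))
        (d + 10) (stoppedSum l)) r₀ := (hs.update (by omega) _).update (by omega) _
      have hv : ∀ c, f (Function.update (Function.update (Function.update s.1 (d + 11) (l 0))
          (d + 10) (stoppedSum l)) (d + 4) c, s.2) = f (Function.update s.1 (d + 4) c, s.2) :=
        fun c => hlow.eq_update hs (hu.update le_rfl _) (by simp)
      rw [key _ hu]
      simp only [hv]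
      rw [lintegral_uniformLaw_ite]
      · simp
      · simp only [Function.update_self]
        rw [Function.update_of_ne (by omega), Function.update_self]
        exact div_nonneg hl.1 (by linarith)
      · simp only [Function.update_self]
        rw [Function.update_of_ne (by omega), Function.update_self, div_le_one (by linarith)]
        exact hl.2
    have hmeas : Measurable fun l : ℕ → ℝ => (stoppedSum l - l 0) / (2 * r₀ (d + 3)) :=
      (measurable_stoppedSum.sub (measurable_pi_apply 0)).div_const _
    rw [lintegral_congr_ae hl, lintegral_coin hmeas, integral_excess hS.bound, relExcess]
    filter_upwards [h] with l hl
    exact ⟨div_nonneg hl.1 (by linarith), by rw [div_le_one (by linarith)]; exact hl.2⟩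
  · intro t u ht htu
    have hu : Agree (d + 4) u.1 r₀ := (htu.mono (by omega)).symm.trans ht
    rw [key t ht, key u hu]
    have hv : ∀ c, f (Function.update t.1 (d + 4) c, t.2) = f (Function.update u.1 (d + 4) c, u.2) :=
      fun c => hlow.eq_update hu (ht.update le_rfl _) (by simp)
    simp only [hv, htu (d + 10) (by omega), htu (d + 11) (by omega)]
  · refine ⟨M, hM, fun t ht => ?_⟩
    rw [key t ht]
    calc _ ≤ ∫⁻ _, M ∂uniformLaw := by
          refine lintegral_mono fun u => ?_
          split_ifs <;> exact hfM _ (ht.update le_rfl _)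
      _ = M := by simp

/-- One round of `gammaCmd`. -/
def gammaRoundCmd (d : ℕ) : Cmd d := coinCmd (.const (1 / 3)) (meanCoinCmd d) (excessCoinCmd d)

theorem wp_gammaRoundCmd (hS : Samples Q r₀ ν) {s : State d} (hs : Agree (d + 4) s.1 r₀)
    {f : State d → ℝ≥0∞} (hf : Measurable f) (hlow : Low r₀ (d + 5) f) (hbd : BoundedOn r₀ f) :
    wp Q (gammaRoundCmd d) f s = coin (1 / 3)
      (coin (relMean d r₀ ν) (f (Function.update s.1 (d + 4) 1, s.2))
        (f (Function.update s.1 (d + 4) 2, s.2)))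
      (coin (relExcess d r₀ ν) (f (Function.update s.1 (d + 4) 0, s.2))
        (f (Function.update s.1 (d + 4) 2, s.2))) := by
  have hu : ∀ u, Agree (d + 4) (Function.update s.1 (d + 13) u) r₀ :=
    fun u => hs.update (by omega) _
  have hv : ∀ u c, f (Function.update (Function.update s.1 (d + 13) u) (d + 4) c, s.2) =
      f (Function.update s.1 (d + 4) c, s.2) :=
    fun u c => hlow.eq_update hs ((hu u).update le_rfl _) (by simp)
  refine wp_coinCmd hf (by norm_num) (by norm_num) (fun u => by simp [Expr.eval]) ?_ ?_
  · intro u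
    rw [wp_meanCoinCmd hS (hu u) hf hlow hbd]
    simp only [hv]
  · intro u
    rw [wp_excessCoinCmd hS (hu u) hf hlow hbd]
    simp only [hv]

/-- Stores in the register `d + 4` a Bernoulli variable with parameter `E Λ / E S_τ`. -/
def gammaCmd (d : ℕ) : Cmd d :=
  .seq (.assign (d + 4) (.const 2)) (.loop (.const 1) (.reg (d + 4)) (gammaRoundCmd d))

open Classical in
/-- The harmonic function for the loop of `gammaCmd`. -/
def gammaValue (p : ℝ) (f : State d → ℝ≥0∞) (s : State d) : ℝ≥0∞ :=
  if 1 < s.1 (d + 4) then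
    coin p (f (Function.update s.1 (d + 4) 1, s.2)) (f (Function.update s.1 (d + 4) 0, s.2))
  else f s

theorem measurable_gammaValue (p : ℝ) {f : State d → ℝ≥0∞} (hf : Measurable f) :
    Measurable (gammaValue p f) := by
  have hu : ∀ c : ℝ, Measurable fun s : State d => f (Function.update s.1 (d + 4) c, s.2) :=
    fun c => hf.comp ((measurable_update_reg (d + 4)).comp (measurable_id.prodMk measurable_const))
  refine Measurable.ite (measurableSet_lt measurable_const (measurable_reg _)) ?_ hf
  exact ((hu 1).const_mul _).add ((hu 0).const_mul _)

theorem low_gammaValue (p : ℝ) {f : State d → ℝ≥0∞} (hf : Low r₀ (d + 5) f) :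
    Low r₀ (d + 5) (gammaValue p f) := by
  intro s t hs hst
  have ht : Agree (d + 4) t.1 r₀ := (hst.mono (by omega)).symm.trans hs
  have hu : ∀ c : ℝ, f (Function.update s.1 (d + 4) c, s.2) =
      f (Function.update t.1 (d + 4) c, t.2) := fun c =>
    hf.eq_update ht (hs.update le_rfl c) (by simp)
  simp only [gammaValue, hst (d + 4) (by omega), hu, hf s t hs hst]

open Classical in
/-- The ranking function for the loop of `gammaCmd`. -/
def gammaRank (r₀ : ℕ → ℝ) (s : State d) : ℝ≥0∞ :=
  if Agree (d + 4) s.1 r₀ then if 1 < s.1 (d + 4) then 1 else 0 else ∞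

theorem measurable_gammaRank (r₀ : ℕ → ℝ) : Measurable (gammaRank (d := d) r₀) :=
  Measurable.ite (measurableSet_agree _ _) (Measurable.ite
    (measurableSet_lt measurable_const (measurable_reg _)) measurable_const measurable_const)
    measurable_const

theorem gammaRank_ne_top {s : State d} : gammaRank r₀ s ≠ ∞ ↔ Agree (d + 4) s.1 r₀ := by
  simp only [gammaRank]
  split_ifs with h <;> simp [h]

theorem low_gammaRank : Low r₀ (d + 5) (gammaRank (d := d) r₀) := by
  intro s t hs hst
  have ht : Agree (d + 4) t.1 r₀ := (hst.mono (by omega)).symm.trans hs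
  simp only [gammaRank, hs, ht, hst (d + 4) (by omega)]

/-- A round outputs `1` with probability `y/3` and `0` with probability `2w/3`. The conditional
probability of `1` given a decision is `y/(y + 2w)`, and `y + 2w = E S_τ / m`. Each round decides
with probability `(y + 2w)/3 > 0`. -/
theorem wp_gammaCmd (hS : Samples Q r₀ ν) {s : State d} (hs : Agree (d + 4) s.1 r₀)
    {f : State d → ℝ≥0∞} (hf : Measurable f) (hlow : Low r₀ (d + 5) f) (hbd : BoundedOn r₀ f) :
    wp Q (gammaCmd d) f s = coin ((∫ v, v ∂ν) / ∫ l, stoppedSum l ∂(iidLaw ν))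
      (f (Function.update s.1 (d + 4) 1, s.2)) (f (Function.update s.1 (d + 4) 0, s.2)) := by
  classical
  have hm0 := hS.bound_pos
  have hx := hS.mean_pos
  have hxz := mean_le_integral_stoppedSum hS.bound hS.mean_pos
  obtain ⟨hεy, hy1, hε0, hε⟩ := relMean_bounds hS
  obtain ⟨hw0, hw1⟩ := relExcess_bounds hS
  set x := ∫ v, v ∂ν with hxdef
  set z := ∫ l, stoppedSum l ∂(iidLaw ν) with hzdef
  have hz : 0 < z := by linarith
  set p := x / z with hp
  have hp0 : 0 ≤ p := by positivity
  have hp1 : p ≤ 1 := by rw [hp, div_le_one hz]; exact hxz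
  have hpz : p * z = x := by rw [hp]; field_simp
  have hyw : relMean d r₀ ν + 2 * relExcess d r₀ ν = z / r₀ (d + 3) := by
    rw [relMean, relExcess]
    field_simp
    ring
  have hyp : relMean d r₀ ν = p * (z / r₀ (d + 3)) := by
    rw [← mul_div_assoc, hpz, relMean]
  rw [← hyw] at hyp
  set y := relMean d r₀ ν with hy
  set w := relExcess d r₀ ν with hw
  obtain ⟨M, hM, hfM⟩ := hbd
  have hvM : ∀ s, Agree (d + 4) s.1 r₀ → gammaValue p f s ≤ M := by
    intro s hs
    simp only [gammaValue]
    split_ifs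
    · exact coin_le hp0 hp1 (hfM _ (hs.update le_rfl _)) (hfM _ (hs.update le_rfl _))
    · exact hfM s hs
  have htest : ∀ s : State d, (Expr.const 1).eval s.1 < (Expr.reg (d + 4)).eval s.1 ↔
      1 < s.1 (d + 4) := fun s => by simp [Expr.eval]
  have hs2 : Agree (d + 4) (Function.update s.1 (d + 4) 2) r₀ := hs.update le_rfl _
  have e2 : (Expr.const 2).eval s.1 = 2 := by simp [Expr.eval]
  rw [gammaCmd, wp_seq Q hf, wp_assign Q (measurable_wp Q _ hf), e2]
  rw [wp_loop_eq Q hf (h := gammaValue p f) (measurable_gammaRank r₀)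
    (c := ENNReal.ofReal ((y + 2 * w) / 3)) (M := M) ?_ ENNReal.ofReal_ne_top hM ?_ ?_ ?_ ?_ _
    (gammaRank_ne_top.2 hs2)]
  · simp [gammaValue]
  · have : 0 < (y + 2 * w) / 3 := by linarith
    simpa using this
  · intro s hs ht
    rw [gammaRank_ne_top] at hs
    rw [htest] at ht
    constructor
    · rw [wp_gammaRoundCmd hS hs measurable_const (fun _ _ _ _ => rfl)
        ⟨1, ENNReal.one_ne_top, fun _ _ => le_rfl⟩, coin_self (by linarith) hy1,
        coin_self hw0 hw1, coin_self (by norm_num) (by norm_num)]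
    · rw [wp_gammaRoundCmd hS hs (measurable_gammaRank r₀) low_gammaRank]
      · have h0 : ∀ c : ℝ, c ≤ 1 → gammaRank r₀ (Function.update s.1 (d + 4) c, s.2) =
            ENNReal.ofReal 0 := fun c hc => by
          simp [gammaRank, hs.update le_rfl c, hc]
        have h2 : gammaRank r₀ (Function.update s.1 (d + 4) 2, s.2) = ENNReal.ofReal 1 := by
          simp [gammaRank, hs.update le_rfl 2]
        rw [h0 0 zero_le_one, h0 1 le_rfl, h2, coin_ofReal (by linarith) hy1 le_rfl zero_le_one,
          coin_ofReal hw0 hw1 le_rfl zero_le_one, coin_ofReal (by norm_num) (by norm_num)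
          (by linarith) (by linarith), ← ENNReal.ofReal_add (by linarith) (by linarith), gammaRank,
          if_pos hs, if_pos ht, ← ENNReal.ofReal_one]
        refine ENNReal.ofReal_le_ofReal ?_
        linarith
      · refine ⟨1, ENNReal.one_ne_top, fun s hs => ?_⟩
        rw [gammaRank, if_pos hs]
        split_ifs <;> simp
  · intro s hs
    exact hvM s (gammaRank_ne_top.1 hs)
  · intro s hs ht
    rw [gammaRank_ne_top] at hs
    rw [htest] at ht
    rw [wp_gammaRoundCmd hS hs (measurable_gammaValue p hf) (low_gammaValue p hlow) ⟨M, hM, hvM⟩]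
    simp only [gammaValue, Function.update_self, Function.update_idem, ht, if_true]
    rw [if_neg (by norm_num), if_pos (by norm_num), if_neg (by norm_num)]
    set F₁ := f (Function.update s.1 (d + 4) 1, s.2)
    set F₀ := f (Function.update s.1 (d + 4) 0, s.2)
    have h1 : F₁ = coin 1 F₁ F₀ := (coin_one _ _).symm
    have h2 : F₀ = coin 0 F₁ F₀ := (coin_zero _ _).symm
    have hA : coin y F₁ (coin p F₁ F₀) = coin (y * 1 + (1 - y) * p) F₁ F₀ := by
      rw [← coin_coin (by linarith) hy1 zero_le_one le_rfl hp0 hp1, coin_one]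
    have hB : coin w F₀ (coin p F₁ F₀) = coin (w * 0 + (1 - w) * p) F₁ F₀ := by
      rw [← coin_coin hw0 hw1 le_rfl zero_le_one hp0 hp1, coin_zero]
    have hy0 : 0 ≤ y := by linarith
    have hyp1 : (1 - y) * p ≤ 1 - y := mul_le_of_le_one_right (by linarith) hp1
    have hwp1 : (1 - w) * p ≤ 1 - w := mul_le_of_le_one_right (by linarith) hp1
    have hyp0 : 0 ≤ (1 - y) * p := mul_nonneg (by linarith) hp0
    have hwp0 : 0 ≤ (1 - w) * p := mul_nonneg (by linarith) hp0
    rw [hA, hB, coin_coin (by norm_num) (by norm_num) (by linarith) (by linarith) (by linarith)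
      (by linarith)]
    congr 1
    linear_combination hyp / 3
  · intro s hs ht
    rw [htest] at ht
    simp [gammaValue, ht]

/-- The program: a Bernoulli variable with parameter `1 / E τ`, then `S_τ` if it is one. -/
def mainCmd (d : ℕ) : Cmd d :=
  .seq (levelBoundCmd d) (.seq (gammaCmd d)
    (.ite (.reg (d + 4)) (.const (1 / 2)) (.assign 0 (.const 0))
      (.seq (stoppedSumCmd d) (.assign 0 (.reg (d + 10))))))

/-- The sum that is output is sampled afresh after the Bernoulli variable has been decided. This
gives the independence of the two factors, and hence a mixture of the law of `S_τ` and a unit mass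
at zero. -/
theorem wp_mainCmd {n : ℕ} {δ C : ℝ} {x : E d} (hd : 1 ≤ d) (hδ : 0 < δ) (hC : 0 < C)
    (hr₀ : r₀ = Function.update (inputState n δ C x).1 (d + 3) (levelBound d δ C n))
    (hS : Samples Q r₀ ν) {F : ℝ → ℝ≥0∞} (hF : Measurable F) {M : ℝ≥0∞} (hM : M ≠ ∞)
    (hFM : ∀ v, F v ≤ M) :
    wp Q (mainCmd d) (fun t => F (t.1 0)) (inputState n δ C x) =
      coin ((∫ v, v ∂ν) / ∫ l, stoppedSum l ∂(iidLaw ν))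
        (∫⁻ l, F (stoppedSum l) ∂(iidLaw ν)) (F 0) := by
  classical
  have hf : Measurable fun t : State d => F (t.1 0) := hF.comp (measurable_reg 0)
  set tail : Cmd d := .ite (.reg (d + 4)) (.const (1 / 2)) (.assign 0 (.const 0))
      (.seq (stoppedSumCmd d) (.assign 0 (.reg (d + 10)))) with htail
  have hm := measurable_wp Q tail hf
  set A := ∫⁻ l, F (stoppedSum l) ∂(iidLaw ν) with hA
  have hAM : A ≤ M := by
    calc A ≤ ∫⁻ _, M ∂(iidLaw ν) := lintegral_mono fun l => hFM _
      _ = M := by simp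
  have key : ∀ t : State d, Agree (d + 4) t.1 r₀ → wp Q tail (fun t => F (t.1 0)) t =
      if t.1 (d + 4) < 1 / 2 then F 0 else A := by
    intro t ht
    have hc : ((Expr.reg (d + 4)).eval t.1 < (Expr.const (1 / 2)).eval t.1) ↔
        t.1 (d + 4) < 1 / 2 := by simp [Expr.eval]
    rw [htail, wp_ite]
    simp only [hc]
    split_ifs
    · rw [wp_assign Q hf]
      simp [Expr.eval]
    · have hg : wp Q (.assign 0 (.reg (d + 10))) (fun t : State d => F (t.1 0)) =
          fun t : State d => F (t.1 (d + 10)) := by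
        funext t
        rw [wp_assign Q hf]
        simp [Expr.eval]
      have hf' : Measurable fun t : State d => F (t.1 (d + 10)) := hF.comp (measurable_reg _)
      rw [wp_seq Q hf, hg, wp_stoppedSumCmd hS ht hf']
      · simp [hA]
      · intro t u _ htu
        simp only [htu (d + 10) (by omega)]
      · exact ⟨M, hM, fun _ _ => hFM _⟩
  rw [mainCmd, wp_seq Q hf]
  refine wp_of_runsTo Q (runsTo_levelBoundCmd hd hδ hC _ (inputs_inputState n δ C x))
    (measurable_wp Q _ hf) _ ?_
  rintro t ⟨ht, ht3⟩
  have ht0 : Agree (d + 4) t.1 r₀ := by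
    intro j hj
    rw [hr₀]
    rcases (show j < d + 3 ∨ j = d + 3 by omega) with h | rfl
    · rw [Function.update_of_ne h.ne, ht j h]
    · rw [ht3, Function.update_self]
  rw [wp_seq Q hf, wp_gammaCmd hS ht0 hm, key _ (ht0.update le_rfl _),
    key _ (ht0.update le_rfl _)]
  · simp only [Function.update_self]
    rw [if_neg (by norm_num), if_pos (by norm_num)]
  · intro s u hs hsu
    rw [key s hs, key u ((hsu.mono (by omega)).symm.trans hs), hsu (d + 4) (by omega)]
  · refine ⟨M, hM, fun s hs => ?_⟩
    rw [key s hs]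
    split_ifs
    exacts [hFM _, hAM]

end Program

/-! ### The mean of the multilevel estimator -/

section Estimator

variable {d : ℕ} {δ C : ℝ} {x : E d}

theorem levelSum_zero (y : E d) : levelSum δ C 0 x y = pHat δ C 1 x y := by
  simp [levelSum, levelTail_zero, pHat]

theorem levelSum_succ (n : ℕ) (y : E d) : levelSum δ C (n + 1) x y =
    levelSum δ C n x y + ((n : ℝ) + 1) * (pHat δ C (n + 2) x y - pHat δ C (n + 1) x y) := by
  rw [levelSum, Finset.sum_range_succ, levelTail_succ, ← levelSum]
  have : (n : ℝ) + 1 ≠ 0 := by positivity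
  field_simp

theorem levelBound_zero : levelBound d δ C 0 = (ballVolume d (radius δ C 1))⁻¹ := by
  simp [levelBound]

theorem levelBound_succ (n : ℕ) : levelBound d δ C (n + 1) = levelBound d δ C n +
    (((n : ℝ) + 1) * (ballVolume d (radius δ C (n + 2)))⁻¹ +
      ((n : ℝ) + 1) * (ballVolume d (radius δ C (n + 1)))⁻¹) := by
  rw [levelBound, Finset.sum_Icc_succ_top (by omega), ← add_assoc, ← levelBound]
  push_cast
  rfl

theorem ballVolume_inv_nonneg (r : ℝ) : 0 ≤ (ballVolume d r)⁻¹ :=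
  inv_nonneg.2 ENNReal.toReal_nonneg

theorem pHat_mem (k : ℕ) (y : E d) :
    0 ≤ pHat δ C k x y ∧ pHat δ C k x y ≤ (ballVolume d (radius δ C k))⁻¹ := by
  have h := ballVolume_inv_nonneg (d := d) (radius δ C k)
  unfold pHat
  split_ifs
  · exact ⟨le_rfl, h⟩
  · by_cases hy : y ∈ Metric.ball x (radius δ C k)
    · simpa [hy] using h
    · simpa [hy] using h

/-- The level `k ≥ 1` has weight `k`, and each `p̂` lies between zero and its inverse volume; `m_n`
adds these bounds up. -/
theorem abs_levelSum_le (n : ℕ) (y : E d) : |levelSum δ C n x y| ≤ levelBound d δ C n := by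
  induction n with
  | zero =>
    rw [levelSum_zero, levelBound_zero, abs_of_nonneg (pHat_mem 1 y).1]
    exact (pHat_mem 1 y).2
  | succ n ih =>
    rw [levelSum_succ, levelBound_succ, ← mul_add]
    refine (abs_add_le _ _).trans (add_le_add ih ?_)
    have h1 := pHat_mem (δ := δ) (C := C) (x := x) (n + 1) y
    have h2 := pHat_mem (δ := δ) (C := C) (x := x) (n + 2) y
    rw [abs_mul, abs_of_nonneg (show (0 : ℝ) ≤ n + 1 by positivity)]
    refine mul_le_mul_of_nonneg_left ?_ (by positivity)
    rw [abs_le]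
    constructor <;> linarith

theorem le_levelBound (n : ℕ) : (ballVolume d (radius δ C 1))⁻¹ ≤ levelBound d δ C n := by
  induction n with
  | zero => rw [levelBound_zero]
  | succ n ih =>
    rw [levelBound_succ]
    have h1 := ballVolume_inv_nonneg (d := d) (radius δ C (n + 1))
    have h2 := ballVolume_inv_nonneg (d := d) (radius δ C (n + 2))
    have : 0 ≤ ((n : ℝ) + 1) * (ballVolume d (radius δ C (n + 2)))⁻¹ := by positivity
    have : 0 ≤ ((n : ℝ) + 1) * (ballVolume d (radius δ C (n + 1)))⁻¹ := by positivity
    linarith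

theorem measurable_pHat (k : ℕ) : Measurable (pHat δ C k x) := by
  unfold pHat
  by_cases h : k = 0
  · simp only [h, if_true]
    exact measurable_const
  · simp only [h, if_false]
    exact (measurable_const.indicator measurableSet_ball).const_mul _

theorem measurable_levelSum (n : ℕ) : Measurable (levelSum δ C n x) := by
  unfold levelSum
  exact Finset.measurable_fun_sum _ fun k _ =>
    ((measurable_pHat (k + 1)).sub (measurable_pHat k)).div_const _

variable {μ : Measure (E d)}

theorem integral_pHat {k : ℕ} (hk : 1 ≤ k) : ∫ y, pHat δ C k x y ∂μ =
    (ballVolume d (radius δ C k))⁻¹ * μ.real (Metric.ball x (radius δ C k)) := by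
  simp only [pHat, if_neg (show k ≠ 0 by omega)]
  rw [integral_const_mul, integral_indicator measurableSet_ball]
  simp

theorem volume_real_ball (x : E d) (r : ℝ) : volume.real (Metric.ball x r) = ballVolume d r := by
  rw [ballVolume, Measure.real, Measure.real, Measure.addHaar_ball_center]

variable {p : E d → ℝ}

theorem integral_pHat_le (hμ : μ = volume.withDensity fun y => ENNReal.ofReal (p y)) {k : ℕ}
    (hk : 1 ≤ k) (hr : 0 < radius δ C k) {a : ℝ} (h : 0 ≤ a)
    (ha : ∀ y ∈ Metric.ball x (radius δ C k), p y ≤ a) : ∫ y, pHat δ C k x y ∂μ ≤ a := by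
  have hV := ballVolume_pos (d := d) hr
  rw [integral_pHat hk, ← div_eq_inv_mul, div_le_iff₀ hV]
  have h1 : μ (Metric.ball x (radius δ C k)) ≤
      ENNReal.ofReal a * volume (Metric.ball x (radius δ C k)) := by
    rw [hμ, withDensity_apply _ measurableSet_ball, ← setLIntegral_const]
    exact setLIntegral_mono' measurableSet_ball fun y hy => ENNReal.ofReal_le_ofReal (ha y hy)
  have h2 := ENNReal.toReal_mono (ENNReal.mul_ne_top ENNReal.ofReal_ne_top measure_ball_lt_top.ne) h1
  rwa [ENNReal.toReal_mul, ENNReal.toReal_ofReal h, ← Measure.real, ← Measure.real,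
    volume_real_ball] at h2

variable [IsProbabilityMeasure μ]

theorem integrable_pHat (k : ℕ) : Integrable (pHat δ C k x) μ := by
  refine Integrable.of_bound (measurable_pHat k).aestronglyMeasurable
    (ballVolume d (radius δ C k))⁻¹ (.of_forall fun y => ?_)
  rw [Real.norm_eq_abs, abs_of_nonneg (pHat_mem k y).1]
  exact (pHat_mem k y).2

theorem integrable_levelSum (n : ℕ) : Integrable (levelSum δ C n x) μ :=
  Integrable.of_bound (measurable_levelSum n).aestronglyMeasurable _
    (.of_forall fun y => abs_levelSum_le n y)

theorem integral_levelSum_succ (n : ℕ) : ∫ y, levelSum δ C (n + 1) x y ∂μ =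
    (∫ y, levelSum δ C n x y ∂μ) +
      ((n : ℝ) + 1) * ((∫ y, pHat δ C (n + 2) x y ∂μ) - ∫ y, pHat δ C (n + 1) x y ∂μ) := by
  simp only [levelSum_succ]
  have h : Integrable (fun y => pHat δ C (n + 2) x y - pHat δ C (n + 1) x y) μ :=
    (integrable_pHat _).sub (integrable_pHat _)
  rw [integral_add (integrable_levelSum n) (h.const_mul _), integral_const_mul,
    integral_sub (integrable_pHat _) (integrable_pHat _)]

/-- The mean of `p̂_k` is the average of the density over the ball. No sign of `a` is required; for
`a ≤ 0` the bound is trivial. -/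
theorem le_integral_pHat (hμ : μ = volume.withDensity fun y => ENNReal.ofReal (p y)) {k : ℕ}
    (hk : 1 ≤ k) (hr : 0 < radius δ C k) {a : ℝ}
    (ha : ∀ y ∈ Metric.ball x (radius δ C k), a ≤ p y) : a ≤ ∫ y, pHat δ C k x y ∂μ := by
  have hV := ballVolume_pos (d := d) hr
  rw [integral_pHat hk, ← div_eq_inv_mul, le_div_iff₀ hV]
  rcases le_total a 0 with h | h
  · exact (mul_nonpos_of_nonpos_of_nonneg h hV.le).trans ENNReal.toReal_nonneg
  have h1 : ENNReal.ofReal a * volume (Metric.ball x (radius δ C k)) ≤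
      μ (Metric.ball x (radius δ C k)) := by
    rw [hμ, withDensity_apply _ measurableSet_ball, ← setLIntegral_const]
    exact setLIntegral_mono' measurableSet_ball fun y hy => ENNReal.ofReal_le_ofReal (ha y hy)
  have h2 := ENNReal.toReal_mono (measure_ne_top μ _) h1
  rwa [ENNReal.toReal_mul, ENNReal.toReal_ofReal h, ← Measure.real, volume_real_ball] at h2

theorem radius_anti (hδ : 0 < δ) (hC : 0 < C) {j k : ℕ} (hj : 1 ≤ j) (hjk : j ≤ k) :
    radius δ C k ≤ radius δ C j := by
  have hj' : (0 : ℝ) < j := by exact_mod_cast hj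
  have hjk' : (j : ℝ) ≤ k := by exact_mod_cast hjk
  have := Real.pi_pos
  unfold radius
  gcongr

/-- The purpose of the radii: the weighted bias of each level becomes a multiple of `1/k²`, and the
constant makes the total exactly `δ/2`. -/
theorem mul_radius (hC : 0 < C) (n : ℕ) : ((n : ℝ) + 1) * (2 * (C * radius δ C (n + 1))) =
    3 * δ / Real.pi ^ 2 * (1 / ((n : ℝ) + 1) ^ 2) := by
  have := Real.pi_pos
  unfold radius
  push_cast
  field_simp

theorem abs_integral_pHat_sub_le (hδ : 0 < δ) (hC : 0 < C)
    (hμ : μ = volume.withDensity fun y => ENNReal.ofReal (p y)) (hp : ∀ y, 0 ≤ p y)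
    (hlip : ∀ y ∈ Metric.ball x (radius δ C 1), |p y - p x| ≤ C * ‖y - x‖) {k : ℕ} (hk : 1 ≤ k) :
    |(∫ y, pHat δ C k x y ∂μ) - p x| ≤ C * radius δ C k := by
  have hr := radius_pos hδ hC hk
  have hball : ∀ y ∈ Metric.ball x (radius δ C k), |p y - p x| ≤ C * radius δ C k := by
    intro y hy
    refine (hlip y (Metric.ball_subset_ball (radius_anti hδ hC le_rfl hk) hy)).trans ?_
    rw [Metric.mem_ball, dist_eq_norm] at hy
    exact mul_le_mul_of_nonneg_left hy.le hC.le
  have h1 := le_integral_pHat (x := x) hμ hk hr (a := p x - C * radius δ C k) fun y hy => by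
    linarith [(abs_le.1 (hball y hy)).1]
  have h2 := integral_pHat_le (x := x) hμ hk hr (a := p x + C * radius δ C k)
    (add_nonneg (hp x) (by positivity)) fun y hy => by linarith [(abs_le.1 (hball y hy)).2]
  rw [abs_le]
  constructor <;> linarith

/-- The mean starts at `E p̂_1 ≥ δ`. Consecutive means of `p̂` both lie within `C r_k` of `p x`, so
the level `k` costs at most `2 k C r_k`, and `∑ 1/k² = π²/6` bounds the total loss by `δ/2`. -/
theorem half_le_integral_levelSum (hδ : 0 < δ) (hC : 0 < C)
    (hμ : μ = volume.withDensity fun y => ENNReal.ofReal (p y)) (hp : ∀ y, 0 ≤ p y)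
    (hlip : ∀ y ∈ Metric.ball x (radius δ C 1), |p y - p x| ≤ C * ‖y - x‖)
    (hlow : ∀ y ∈ Metric.ball x (radius δ C 1), δ ≤ p y) (n : ℕ) :
    δ / 2 ≤ ∫ y, levelSum δ C n x y ∂μ := by
  have hsum : ∀ n : ℕ, δ - ∑ k ∈ Finset.range n, 3 * δ / Real.pi ^ 2 * (1 / ((k : ℝ) + 1) ^ 2) ≤
      ∫ y, levelSum δ C n x y ∂μ := by
    intro n
    induction n with
    | zero =>
      simp only [levelSum_zero, Finset.range_zero, Finset.sum_empty, sub_zero]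
      exact le_integral_pHat hμ le_rfl (radius_pos hδ hC le_rfl) hlow
    | succ n ih =>
      rw [integral_levelSum_succ, Finset.sum_range_succ, ← mul_radius hC]
      have h1 := abs_le.1 (abs_integral_pHat_sub_le hδ hC hμ hp hlip (k := n + 1) (by omega))
      have h2 := abs_le.1 (abs_integral_pHat_sub_le hδ hC hμ hp hlip (k := n + 2) (by omega))
      have h3 : C * radius δ C (n + 2) ≤ C * radius δ C (n + 1) :=
        mul_le_mul_of_nonneg_left (radius_anti hδ hC (by omega) (by omega)) hC.le
      have h4 : ((n : ℝ) + 1) * (-(2 * (C * radius δ C (n + 1)))) ≤ ((n : ℝ) + 1) *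
          ((∫ y, pHat δ C (n + 2) x y ∂μ) - ∫ y, pHat δ C (n + 1) x y ∂μ) :=
        mul_le_mul_of_nonneg_left (by linarith) (by positivity)
      linarith
  have hz : HasSum (fun k : ℕ => 1 / ((k : ℝ) + 1) ^ 2) (Real.pi ^ 2 / 6) := by
    have h := hasSum_zeta_two
    rw [← hasSum_nat_add_iff' 1] at h
    simpa using h
  have hle := sum_le_hasSum (Finset.range n) (fun k _ => by positivity)
    (hz.mul_left (3 * δ / Real.pi ^ 2))
  have : 3 * δ / Real.pi ^ 2 * (Real.pi ^ 2 / 6) = δ / 2 := by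
    have := Real.pi_pos
    field_simp
    ring
  linarith [hsum n]

theorem le_levelBound_of_density (hδ : 0 < δ) (hC : 0 < C)
    (hμ : μ = volume.withDensity fun y => ENNReal.ofReal (p y))
    (hlow : ∀ y ∈ Metric.ball x (radius δ C 1), δ ≤ p y) (n : ℕ) : δ ≤ levelBound d δ C n := by
  refine ((le_integral_pHat hμ le_rfl (radius_pos hδ hC le_rfl) hlow).trans ?_).trans
    (le_levelBound n)
  calc ∫ y, pHat δ C 1 x y ∂μ ≤ ∫ _, (ballVolume d (radius δ C 1))⁻¹ ∂μ :=
        integral_mono (integrable_pHat 1) (integrable_const _) fun y => (pHat_mem 1 y).2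
    _ = _ := by simp

end Estimator

/-! ### Exact sampling of the estimator from approximations. -/

section Sampling

variable {d : ℕ} {Ω : Type*} [MeasurableSpace Ω] {P : Measure Ω} {X : Ω → E d}
  {Y : ℕ → Ω → E d} {δ C : ℝ} {x : E d}

/-- Spheres of nonzero radius are Lebesgue null. Membership of a ball can be decided from
approximations except on its boundary, so this is what makes refinement terminate. -/
theorem ae_norm_sub_ne (hδ : 0 < δ) (hC : 0 < C) (hX : Measurable X)
    (hac : P.map X ≪ volume) (x : E d) : ∀ᵐ ω ∂P, ∀ k, ‖X ω - x‖ ≠ radius δ C (k + 1) := by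
  rw [ae_all_iff]
  intro k
  have h0 : P.map X (Metric.sphere x (radius δ C (k + 1))) = 0 :=
    hac (Measure.addHaar_sphere_of_ne_zero _ _ (radius_pos hδ hC (by omega)).ne')
  rw [Measure.map_apply hX Metric.isClosed_sphere.measurableSet] at h0
  filter_upwards [compl_mem_ae_iff.2 h0] with ω hω
  simpa [dist_eq_norm] using hω

theorem samples [IsProbabilityMeasure P] {n : ℕ} {r₀ : ℕ → ℝ} {p : E d → ℝ}
    (hd : 1 ≤ d) (hδ : 0 < δ) (hC : 0 < C)
    (hr₀ : r₀ = Function.update (inputState n δ C x).1 (d + 3) (levelBound d δ C n))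
    (hX : Measurable X) (hY : ∀ k, Measurable (Y k))
    (hYX : ∀ᵐ ω ∂P, ∀ k, ‖Y k ω - X ω‖ ≤ (1 / 2 : ℝ) ^ (k + 1))
    (hμ : P.map X = volume.withDensity fun y => ENNReal.ofReal (p y)) (hp : ∀ y, 0 ≤ p y)
    (hlip : ∀ y ∈ Metric.ball x (radius δ C 1), |p y - p x| ≤ C * ‖y - x‖)
    (hlow : ∀ y ∈ Metric.ball x (radius δ C 1), δ ≤ p y)
    [IsProbabilityMeasure (P.map fun ω k => Y k ω)] :
    Samples (P.map fun ω k => Y k ω) r₀ (P.map fun ω => levelSum δ C n x (X ω)) := by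
  have hYm : Measurable fun ω k => Y k ω := measurable_pi_lambda _ hY
  have hΛ : Measurable fun ω => levelSum δ C n x (X ω) := (measurable_levelSum n).comp hX
  have : IsProbabilityMeasure (P.map X) := Measure.isProbabilityMeasure_map hX.aemeasurable
  have h1 : r₀ 1 = δ := by
    rw [hr₀, Function.update_of_ne (by omega), (inputs_inputState _ _ _ _).delta]
  have hm : r₀ (d + 3) = levelBound d δ C n := by rw [hr₀, Function.update_self]
  refine ⟨?_, ?_, ?_, ?_, ?_⟩
  · rw [ae_map_iff hΛ.aemeasurable (measurableSet_le (by fun_prop) measurable_const), hm]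
    exact .of_forall fun ω => abs_levelSum_le n _
  · rw [h1]
    exact hδ
  · rw [h1, integral_map hΛ.aemeasurable (by fun_prop),
      ← integral_map hX.aemeasurable (measurable_levelSum n).aestronglyMeasurable]
    exact half_le_integral_levelSum hδ hC hμ hp hlip hlow n
  · rw [h1, hm]
    exact le_levelBound_of_density hδ hC hμ hlow n
  · intro s hs f hf hcongr
    have hupd : Measurable fun v : ℝ => f (Function.update s.1 (d + 14) v, s.2) :=
      hf.comp ((measurable_update_reg (d + 14)).comp (measurable_const.prodMk measurable_id))
    have hw := measurable_wp (P.map fun ω k => Y k ω) (levelSumCmd d) hf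
    have hw' : Measurable fun y => wp (P.map fun ω k => Y k ω) (levelSumCmd d) f (s.1, y) :=
      hw.comp (measurable_const.prodMk measurable_id)
    rw [sampleCmd, wp_seq _ hf, wp_draw _ hw, lintegral_map hw' hYm,
      lintegral_map hupd hΛ]
    have hin : Inputs n δ C x s.1 := by
      refine (inputs_inputState n δ C x).of_agree (N := d + 3) le_rfl fun j hj => ?_
      rw [hs j (by omega), hr₀, Function.update_of_ne (by omega)]
    refine lintegral_congr_ae ?_
    filter_upwards [hYX, ae_norm_sub_ne hδ hC hX (hμ ▸ withDensity_absolutelyContinuous _ _) x]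
      with ω h2 h3
    refine wp_of_runsTo _ (runsTo_levelSumCmd hd hδ hC h2 h3 s.1 hin) hf _ ?_
    rintro t ⟨ht, hv⟩
    refine hcongr _ _ ht fun j hj => ?_
    rcases (show j < d + 14 ∨ j = d + 14 by omega) with h | rfl
    · simp only [Function.update_of_ne h.ne, ht j h]
    · simp only [Function.update_self, hv]

end Sampling

/-! ### The thinned stopped sum -/

section Thinned

open Classical in
/-- `Γ S_τ` for a sequence `l`, where `Γ` is the indicator of `u < t`. -/
def thinnedSum (t : ℝ) (l : ℕ → ℝ) (u : ℝ) : ℝ := if u < t then stoppedSum l else 0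

theorem measurable_thinnedSum (t : ℝ) :
    Measurable fun q : (ℕ → ℝ) × ℝ => thinnedSum t q.1 q.2 :=
  Measurable.ite (measurableSet_lt measurable_snd measurable_const)
    (measurable_stoppedSum.comp measurable_fst) measurable_const

theorem uniformLaw_Iio {t : ℝ} (h0 : 0 ≤ t) (h1 : t ≤ 1) : uniformLaw.real (Set.Iio t) = t := by
  classical
  have h := lintegral_uniformLaw_ite h0 h1 1 0
  have e : (fun u : ℝ => if u < t then (1 : ℝ≥0∞) else 0) = (Set.Iio t).indicator 1 := by
    funext u
    simp [Set.indicator_apply]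
  rw [e, lintegral_indicator_one measurableSet_Iio] at h
  rw [Measure.real, h]
  simp [coin, h0]

variable {Ω : Type*} [MeasurableSpace Ω] {P : Measure Ω} [IsProbabilityMeasure P]
  {ν : Measure ℝ} {L : Ω → ℕ → ℝ}

theorem lintegral_thinnedSum (hL : Measurable L) (hLν : P.map L = iidLaw ν) {t : ℝ} (h0 : 0 ≤ t)
    (h1 : t ≤ 1) {F : ℝ → ℝ≥0∞} (hF : Measurable F) :
    ∫⁻ ω, F (thinnedSum t (L ω.1) ω.2) ∂(P.prod uniformLaw) =
      coin t (∫⁻ l, F (stoppedSum l) ∂(iidLaw ν)) (F 0) := by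
  classical
  have hm : Measurable fun l => F (stoppedSum l) := hF.comp measurable_stoppedSum
  have hj : Measurable fun ω : Ω × ℝ => F (thinnedSum t (L ω.1) ω.2) :=
    hF.comp ((measurable_thinnedSum t).comp ((hL.comp measurable_fst).prodMk measurable_snd))
  rw [lintegral_prod _ hj.aemeasurable, ← hLν, lintegral_map hm hL]
  simp only [thinnedSum, apply_ite F, lintegral_uniformLaw_ite h0 h1]
  simp only [coin]
  have hm' : Measurable fun ω => F (stoppedSum (L ω)) := hm.comp hL
  rw [lintegral_add_right _ measurable_const, lintegral_const_mul _ hm']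
  simp

variable [IsProbabilityMeasure ν]

/-- On the product space the mean factors as `(1 / E τ) · E S_τ`, and Wald's identity cancels `E τ`.
-/
theorem integral_thinnedSum (hL : Measurable L) (hLν : P.map L = iidLaw ν) {m : ℝ}
    (hν : ∀ᵐ v ∂ν, |v| ≤ m) (hpos : 0 < ∫ v, v ∂ν) :
    ∫ ω, thinnedSum (∫ l, (stopIndex l : ℝ) ∂(iidLaw ν))⁻¹ (L ω.1) ω.2 ∂(P.prod uniformLaw) =
      ∫ v, v ∂ν := by
  classical
  have hτ := one_le_integral_stopIndex hν hpos
  set T := ∫ l, (stopIndex l : ℝ) ∂(iidLaw ν) with hT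
  have e : ∀ ω : Ω × ℝ, thinnedSum T⁻¹ (L ω.1) ω.2 =
      stoppedSum (L ω.1) * (Set.Iio T⁻¹).indicator (fun _ => 1) ω.2 := by
    intro ω
    by_cases h : ω.2 < T⁻¹ <;> simp [thinnedSum, h]
  simp only [e]
  rw [integral_prod_mul (fun ω => stoppedSum (L ω)), integral_indicator_const _ measurableSet_Iio,
    uniformLaw_Iio (inv_nonneg.2 (by linarith)) (inv_le_one_of_one_le₀ hτ),
    ← integral_map hL.aemeasurable measurable_stoppedSum.aestronglyMeasurable, hLν,
    integral_stoppedSum hν hpos, ← hT, smul_eq_mul, mul_one]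
  have : T ≠ 0 := by linarith
  field_simp

theorem isThinnedStoppedSum (hL : Measurable L) (hLν : P.map L = iidLaw ν) {m : ℝ}
    (hν : ∀ᵐ v ∂ν, |v| ≤ m) (hpos : 0 < ∫ v, v ∂ν) :
    IsThinnedStoppedSum (P.prod uniformLaw) ν
      fun ω => thinnedSum (∫ l, (stopIndex l : ℝ) ∂(iidLaw ν))⁻¹ (L ω.1) ω.2 := by
  classical
  have hτ := one_le_integral_stopIndex hν hpos
  set T := ∫ l, (stopIndex l : ℝ) ∂(iidLaw ν) with hT
  have hL1 : Measurable fun ω : Ω × ℝ => L ω.1 := hL.comp measurable_fst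
  have hmap : (P.prod uniformLaw).map (fun ω : Ω × ℝ => L ω.1) = iidLaw ν := by
    have h : (P.prod uniformLaw).map (L ∘ Prod.fst) = iidLaw ν := by
      rw [← Measure.map_map hL measurable_fst, Measure.map_fst_prod, measure_univ, one_smul, hLν]
    exact h
  have hLk : ∀ k, Measurable fun ω : Ω × ℝ => L ω.1 k :=
    fun k => (measurable_pi_apply k).comp hL1
  have hmapk : ∀ k, (P.prod uniformLaw).map (fun ω : Ω × ℝ => L ω.1 k) = ν := by
    intro k
    have h : (P.prod uniformLaw).map ((fun l : ℕ → ℝ => l k) ∘ fun ω : Ω × ℝ => L ω.1) = ν := by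
      rw [← Measure.map_map (measurable_pi_apply k) hL1, hmap, Measure.infinitePi_map_eval]
    exact h
  have hst : Measurable fun l : ℕ → ℝ => (stopIndex l : ℝ) :=
    (measurable_from_top (f := fun k : ℕ => (k : ℝ))).comp measurable_stopIndex
  have hint : ∫ ω, (stopIndex (L ω.1) : ℝ) ∂(P.prod uniformLaw) = T := by
    rw [hT, ← hmap, integral_map hL1.aemeasurable hst.aestronglyMeasurable]
  have hΓ : Measurable ((Set.Iio T⁻¹).indicator fun _ => (1 : ℝ)) :=
    measurable_const.indicator measurableSet_Iio
  refine ⟨fun k ω => L ω.1 k, fun ω => (Set.Iio T⁻¹).indicator (fun _ => 1) ω.2, hLk, hmapk, ?_, ?_,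
    ?_, hΓ.comp measurable_snd, ?_, ?_, ?_, ?_⟩
  · rw [iIndepFun_iff_map_fun_eq_infinitePi_map hLk]
    simp only [hmapk]
    exact hmap
  · have h := ae_stops hν hpos
    rw [← hmap] at h
    exact ae_of_ae_map hL1.aemeasurable h
  · have h := integrable_stopIndex hν hpos
    rw [← hmap] at h
    exact h.comp_measurable hL1
  · intro ω
    by_cases h : ω.2 < T⁻¹ <;> simp [h]
  · have e : {ω : Ω × ℝ | (Set.Iio T⁻¹).indicator (fun _ => (1 : ℝ)) ω.2 = 1} =
        Set.univ ×ˢ Set.Iio T⁻¹ := by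
      ext ω
      by_cases h : ω.2 < T⁻¹ <;> simp [h]
    rw [e, hint, measureReal_prod_prod, probReal_univ, one_mul,
      uniformLaw_Iio (inv_nonneg.2 (by linarith)) (inv_le_one_of_one_le₀ hτ)]
  · exact (indepFun_prod hL hΓ).symm
  · refine .of_forall fun ω => ?_
    by_cases h : ω.2 < T⁻¹ <;> simp [thinnedSum, stoppedSum, h]

end Thinned

/-! ### The law of the output, and a joint realization for all levels and points. -/

theorem simulates_mainCmd {Ω : Type*} [MeasurableSpace Ω] {P : Measure Ω} [IsProbabilityMeasure P]
    {ν : Measure ℝ} [IsProbabilityMeasure ν] {L : Ω → ℕ → ℝ} (hL : Measurable L)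
    (hLν : P.map L = iidLaw ν) {d n : ℕ} {Q : Measure (ℕ → E d)} [IsProbabilityMeasure Q]
    {δ C : ℝ} {x : E d} (hd : 1 ≤ d) (hδ : 0 < δ) (hC : 0 < C) {r₀ : ℕ → ℝ}
    (hr₀ : r₀ = Function.update (inputState n δ C x).1 (d + 3) (levelBound d δ C n))
    (hS : Samples Q r₀ ν) :
    (mainCmd d).Simulates Q (inputState n δ C x) ((P.prod uniformLaw).map
      fun ω => thinnedSum (∫ l, (stopIndex l : ℝ) ∂(iidLaw ν))⁻¹ (L ω.1) ω.2) := by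
  have hτ := one_le_integral_stopIndex hS.bound hS.mean_pos
  have hx := hS.mean_pos
  -- Wald's identity turns the parameter realized by the program into `1 / E τ`.
  have ht : (∫ v, v ∂ν) / ∫ l, stoppedSum l ∂(iidLaw ν) =
      (∫ l, (stopIndex l : ℝ) ∂(iidLaw ν))⁻¹ := by
    rw [integral_stoppedSum hS.bound hS.mean_pos]
    have : (∫ l, (stopIndex l : ℝ) ∂(iidLaw ν)) ≠ 0 := by linarith
    field_simp
  have h0 : 0 ≤ (∫ l, (stopIndex l : ℝ) ∂(iidLaw ν))⁻¹ := inv_nonneg.2 (by linarith)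
  have h1 : (∫ l, (stopIndex l : ℝ) ∂(iidLaw ν))⁻¹ ≤ 1 := inv_le_one_of_one_le₀ hτ
  have hwp := fun (F : ℝ → ℝ≥0∞) (hF : Measurable F) (hFM : ∀ v, F v ≤ 1) =>
    wp_mainCmd hd hδ hC hr₀ hS hF ENNReal.one_ne_top hFM
  rw [ht] at hwp
  have hZ : Measurable fun ω : Ω × ℝ =>
      thinnedSum (∫ l, (stopIndex l : ℝ) ∂(iidLaw ν))⁻¹ (L ω.1) ω.2 :=
    (measurable_thinnedSum _).comp ((hL.comp measurable_fst).prodMk measurable_snd)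
  constructor
  -- The test function `1` gives termination with probability one; indicators then identify the law.
  · have h := hwp (fun _ => 1) measurable_const fun _ => le_rfl
    simpa [wp, coin_self h0 h1] using h
  · refine Measure.ext fun A hA => ?_
    have hF : Measurable (A.indicator (1 : ℝ → ℝ≥0∞)) := measurable_one.indicator hA
    have h := hwp (A.indicator 1) hF fun v => Set.indicator_le_self' (fun _ _ => zero_le) v
    rw [← lintegral_indicator_one hA, ← lintegral_indicator_one hA,
      lintegral_map hF (measurable_reg 0), lintegral_map hF hZ, lintegral_thinnedSum hL hLν h0 h1 hF]
    exact h

/-- The joint realization of the variables `Γ S_τ`: i.i.d. copies of `X`, and a uniform variable. -/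
def sumLaw {d : ℕ} (μ : Measure (E d)) [IsProbabilityMeasure μ] : Measure ((ℕ → E d) × ℝ) :=
  (Measure.infinitePi fun _ : ℕ => μ).prod uniformLaw

instance {d : ℕ} (μ : Measure (E d)) [IsProbabilityMeasure μ] : IsProbabilityMeasure (sumLaw μ) := by
  unfold sumLaw
  infer_instance

/-- `Λ_n^+(x) = Γ S_τ`. -/
def levelSumPlus {d : ℕ} (μ : Measure (E d)) [IsProbabilityMeasure μ] (δ C : ℝ) (n : ℕ) (x : E d)
    (ω : (ℕ → E d) × ℝ) : ℝ :=
  thinnedSum (∫ l, (stopIndex fun k => levelSum δ C n x (l k) : ℝ)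
    ∂(Measure.infinitePi fun _ : ℕ => μ))⁻¹ (fun k => levelSum δ C n x (ω.1 k)) ω.2

section Realization

variable {d : ℕ} {δ C : ℝ} {n : ℕ} {x : E d}

theorem measurable_levelSum_seq : Measurable fun (l : ℕ → E d) k => levelSum δ C n x (l k) :=
  measurable_pi_lambda _ fun k => (measurable_levelSum n).comp (measurable_pi_apply k)

variable {μ : Measure (E d)} [IsProbabilityMeasure μ]

theorem measurable_levelSumPlus : Measurable (levelSumPlus μ δ C n x) :=
  (measurable_thinnedSum _).comp
    ((measurable_levelSum_seq.comp measurable_fst).prodMk measurable_snd)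

theorem levelSumPlus_mem (ω : (ℕ → E d) × ℝ) :
    0 ≤ levelSumPlus μ δ C n x ω ∧ levelSumPlus μ δ C n x ω ≤ levelBound d δ C n := by
  have hm : 0 ≤ levelBound d δ C n := (ballVolume_inv_nonneg _).trans (le_levelBound n)
  rw [levelSumPlus, thinnedSum]
  split_ifs
  · exact ⟨stoppedSum_nonneg _, stoppedSum_le hm fun k => abs_levelSum_le n _⟩
  · exact ⟨le_rfl, hm⟩

variable {ν : Measure ℝ}

theorem map_levelSum_seq (hν : μ.map (levelSum δ C n x) = ν) :
    (Measure.infinitePi fun _ : ℕ => μ).map (fun l k => levelSum δ C n x (l k)) = iidLaw ν := by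
  rw [Measure.infinitePi_map_pi (fun _ : ℕ => μ) fun _ => measurable_levelSum n]
  simp only [hν]

variable [IsProbabilityMeasure ν]

theorem levelSumPlus_eq (hν : μ.map (levelSum δ C n x) = ν) : levelSumPlus μ δ C n x = fun ω =>
    thinnedSum (∫ l, (stopIndex l : ℝ) ∂(iidLaw ν))⁻¹ (fun k => levelSum δ C n x (ω.1 k)) ω.2 := by
  have hst : Measurable fun l : ℕ → ℝ => (stopIndex l : ℝ) :=
    (measurable_from_top (f := fun k : ℕ => (k : ℝ))).comp measurable_stopIndex
  rw [← map_levelSum_seq hν, integral_map measurable_levelSum_seq.aemeasurable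
    hst.aestronglyMeasurable]
  rfl

theorem integral_levelSumPlus (hν : μ.map (levelSum δ C n x) = ν) {m : ℝ}
    (hm : ∀ᵐ v ∂ν, |v| ≤ m) (hpos : 0 < ∫ v, v ∂ν) :
    ∫ ω, levelSumPlus μ δ C n x ω ∂(sumLaw μ) = ∫ v, v ∂ν := by
  rw [levelSumPlus_eq hν]
  exact integral_thinnedSum (L := fun (l : ℕ → E d) k => levelSum δ C n x (l k))
    measurable_levelSum_seq (map_levelSum_seq hν) hm hpos

theorem isThinnedStoppedSum_levelSumPlus (hν : μ.map (levelSum δ C n x) = ν) {m : ℝ}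
    (hm : ∀ᵐ v ∂ν, |v| ≤ m) (hpos : 0 < ∫ v, v ∂ν) :
    IsThinnedStoppedSum (sumLaw μ) ν (levelSumPlus μ δ C n x) := by
  rw [levelSumPlus_eq hν, sumLaw]
  exact isThinnedStoppedSum (L := fun (l : ℕ → E d) k => levelSum δ C n x (l k))
    measurable_levelSum_seq (map_levelSum_seq hν) hm hpos

theorem simulates_levelSumPlus (hν : μ.map (levelSum δ C n x) = ν) {Q : Measure (ℕ → E d)}
    [IsProbabilityMeasure Q] (hd : 1 ≤ d) (hδ : 0 < δ) (hC : 0 < C)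
    (hS : Samples Q (Function.update (inputState n δ C x).1 (d + 3) (levelBound d δ C n)) ν) :
    (mainCmd d).Simulates Q (inputState n δ C x) ((sumLaw μ).map (levelSumPlus μ δ C n x)) := by
  rw [levelSumPlus_eq hν, sumLaw]
  exact simulates_mainCmd (L := fun (l : ℕ → E d) k => levelSum δ C n x (l k))
    measurable_levelSum_seq (map_levelSum_seq hν) hd hδ hC rfl hS

end Realization

end ExactSDE
end

theorem mainTheorem5 (d : ℕ) (hd : 1 ≤ d) :
    ∃ prog : ExactSDE.Cmd d,
      ∀ (Ω : Type*) [MeasurableSpace Ω] (P : Measure Ω) [IsProbabilityMeasure P]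
        (X : Ω → ExactSDE.E d) (p : ExactSDE.E d → ℝ) (Y : ℕ → Ω → ExactSDE.E d)
        (z : Fin d → ℤ) (δ C : ℝ),
        Measurable X →
        -- `X` has the density `p`
        Measurable p → (∀ y, 0 ≤ p y) →
        P.map X = volume.withDensity (fun y => ENNReal.ofReal (p y)) →
        -- on the `r_1`-neighbourhood of the cube, `p` is `C`-Lipschitz and at least `δ`
        0 < δ → 0 < C →
        (∀ y ∈ Metric.thickening (ExactSDE.radius δ C 1) (ExactSDE.unitCube z),
          ∀ y' ∈ Metric.thickening (ExactSDE.radius δ C 1) (ExactSDE.unitCube z),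
            |p y - p y'| ≤ C * ‖y - y'‖) →
        (∀ y ∈ Metric.thickening (ExactSDE.radius δ C 1) (ExactSDE.unitCube z), δ ≤ p y) →
        -- `Y 0, Y 1, …` approximate `X` within the tolerances `1/2, 1/4, …`
        (∀ k, Measurable (Y k)) →
        (∀ᵐ ω ∂P, ∀ k, ‖Y k ω - X ω‖ ≤ (1 / 2 : ℝ) ^ (k + 1)) →
        ∃ (Ω' : Type) (_ : MeasurableSpace Ω') (P' : Measure Ω') (_ : IsProbabilityMeasure P')
          (Lplus : ℕ → ExactSDE.E d → Ω' → ℝ),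
          ∀ n : ℕ, ∀ x ∈ ExactSDE.unitCube z,
            Measurable (Lplus n x) ∧
            (∀ ω', 0 ≤ Lplus n x ω' ∧ Lplus n x ω' ≤ ExactSDE.levelBound d δ C n) ∧
            Integrable (fun ω => ExactSDE.levelSum δ C n x (X ω)) P ∧
            ∫ ω', Lplus n x ω' ∂P' = ∫ ω, ExactSDE.levelSum δ C n x (X ω) ∂P ∧
            ExactSDE.IsThinnedStoppedSum P'
              (P.map (fun ω => ExactSDE.levelSum δ C n x (X ω))) (Lplus n x) ∧
            prog.Simulates (P.map (fun ω k => Y k ω)) (ExactSDE.inputState n δ C x)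
              (P'.map (Lplus n x)) := by
  refine ⟨ExactSDE.mainCmd d, ?_⟩
  intro Ω _ P _ X p Y z δ C hX hp hp0 hμ hδ hC hlip hlow hY hYX
  have : IsProbabilityMeasure (P.map X) := Measure.isProbabilityMeasure_map hX.aemeasurable
  have hQ : IsProbabilityMeasure (P.map fun ω k => Y k ω) :=
    Measure.isProbabilityMeasure_map (measurable_pi_lambda _ hY).aemeasurable
  -- A single space carries the family for all `n` and `x`: the same copies of `X` and the same
  -- uniform variable are used throughout.
  refine ⟨(ℕ → ExactSDE.E d) × ℝ, inferInstance, ExactSDE.sumLaw (P.map X), inferInstance,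
    ExactSDE.levelSumPlus (P.map X) δ C, ?_⟩
  intro n x hx
  have hball : Metric.ball x (ExactSDE.radius δ C 1) ⊆
      Metric.thickening (ExactSDE.radius δ C 1) (ExactSDE.unitCube z) :=
    Metric.ball_subset_thickening hx _
  -- The Lipschitz hypothesis is used with `y' = x`, which must itself lie in the neighbourhood.
  have hxb := hball (Metric.mem_ball_self (ExactSDE.radius_pos hδ hC le_rfl))
  have hΛ : Measurable fun ω => ExactSDE.levelSum δ C n x (X ω) :=
    (ExactSDE.measurable_levelSum n).comp hX
  have hlaw : IsProbabilityMeasure (P.map fun ω => ExactSDE.levelSum δ C n x (X ω)) :=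
    Measure.isProbabilityMeasure_map hΛ.aemeasurable
  have hν : (P.map X).map (ExactSDE.levelSum δ C n x) =
      P.map fun ω => ExactSDE.levelSum δ C n x (X ω) :=
    Measure.map_map (ExactSDE.measurable_levelSum n) hX
  have hS := ExactSDE.samples (n := n) hd hδ hC rfl hX hY hYX hμ hp0
    (fun y hy => hlip y (hball hy) x hxb) fun y hy => hlow y (hball hy)
  refine ⟨ExactSDE.measurable_levelSumPlus, ExactSDE.levelSumPlus_mem,
    Integrable.of_bound hΛ.aestronglyMeasurable _
      (.of_forall fun ω => ExactSDE.abs_levelSum_le n _), ?_,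
    ExactSDE.isThinnedStoppedSum_levelSumPlus hν hS.bound hS.mean_pos,
    ExactSDE.simulates_levelSumPlus hν hd hδ hC hS⟩
  rw [ExactSDE.integral_levelSumPlus hν hS.bound hS.mean_pos,
    integral_map hΛ.aemeasurable (by fun_prop)]
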